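/- Let $(z_t)_{t\in\mathbb Z}$ be a stationary AR(2) process with (unknown) mean $\mu$, $$z_t-\mu=\phi_1(z_{t-1}-\mu)+\phi_2(z_{t-2}-\mu)+a_t,$$ where the $a_t$ are independent $N(0,\sigma^2)$ variables with $\sigma^2>0$ and $(\phi_1,\phi_2)$ is in the admissible region $|\phi_2|<1$, $\phi_1+\phi_2<1$, $\phi_2-\phi_1<1$. From the observations $z_1,\dots,z_n$, with sample mean $\bar z_n$, form the mean-corrected autocovariances $$\overline{\mathcal S}_{m,k,i}=\frac1n\sum_{t=i}^n (z_{t-m}-\bar z_n)(z_{t-k}-\bar z_n)\qquad(\max(m,k)<i\le n)$$ and put $C=\overline{\mathcal S}_{0,0,3}+\overline{\mathcal S}_{2,2,3}$, $D=\overline{\mathcal S}_{0,0,2}+\overline{\mathcal S}_{1,1,2}$, $E=\overline{\mathcal S}_{0,2,3}$, $F=\overline{\mathcal S}_{0,1,2}$, $G=\overline{\mathcal S}_{1,1,3}$, $H=\overline{\mathcal S}_{0,1,3}+\overline{\mathcal S}_{2,1,3}$. The Burg estimators are $$\hat\phi_2=1-\frac{CD^2-2ED^2}{CD^2+8F^2G-4FHD},\qquad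 \hat\phi_1=\frac{2F}{D}\,(1-\hat\phi_2).$$ Then, as $n\to\infty$, the expectations exist for all large $n$ and $$\mathbb E(\hat\phi_1-\phi_1)=-\frac{1+\phi_1+\phi_2}{n}+o\!\left(\frac1n\right),\qquad \mathbb E(\hat\phi_2-\phi_2)=-\frac{2+4\phi_2}{n}+o\!\left(\frac1n\right).$$ The biases of the least squares estimators, i.e. of the $(b_1,b_2)$ minimizing $\sum_{t=3}^n\bigl((z_t-\bar z_n)-b_1(z_{t-1}-\bar z_n)-b_2(z_{t-2}-\bar z_n)\bigr)^2$, are the same to this order: their expectations exist for all large $n$ and satisfy the same two expansions. -/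

import Mathlib

open MeasureTheory ProbabilityTheory Filter Topology Asymptotics
open scoped NNReal

/-- `z` is a (second-order) stationary Gaussian AR(2) process with mean `μ`, coefficients `φ₁`, `φ₂`
and innovations `a`: the `a t` are i.i.d. `N(0, σ²)` and
`z t - μ = φ₁ (z (t-1) - μ) + φ₂ (z (t-2) - μ) + a t` almost surely, for every integer time `t`. -/
structure IsStationaryAR2 {Ω : Type*} [MeasurableSpace Ω] (P : Measure Ω) (μ φ₁ φ₂ : ℝ) (σ : ℝ≥0)
    (a z : ℤ → Ω → ℝ) : Prop where
  innovation_indep : iIndepFun a P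
  innovation_law : ∀ t, HasLaw (a t) (gaussianReal 0 (σ ^ 2)) P
  recursion : ∀ t, ∀ᵐ ω ∂P,
    z t ω - μ = φ₁ * (z (t - 1) ω - μ) + φ₂ * (z (t - 2) ω - μ) + a t ω
  memLp : ∀ t, MemLp (z t) 2 P
  mean_stationary : ∀ s t, ∫ ω, z s ω ∂P = ∫ ω, z t ω ∂P
  cov_stationary : ∀ s t h, cov[z (s + h), z (t + h); P] = cov[z s, z t; P]

/-- The sample mean of the observations `x 1, …, x n`. -/
noncomputable def sampleMean (x : ℤ → ℝ) (n : ℕ) : ℝ :=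
  (∑ t ∈ Finset.Icc 1 n, x (t : ℤ)) / n

/-- The mean-corrected sample autocovariance
`S̄_{m,k,i} = (1/n) ∑_{t=i}^n (x (t-m) - x̄) (x (t-k) - x̄)`; it involves only the observations
`x 1, …, x n` when `max m k < i`. -/
noncomputable def autocov (x : ℤ → ℝ) (n m k i : ℕ) : ℝ :=
  (∑ t ∈ Finset.Icc i n,
    (x ((t : ℤ) - m) - sampleMean x n) * (x ((t : ℤ) - k) - sampleMean x n)) / n

/-- The mean-corrected Burg estimate of `φ₂` from `x 1, …, x n`. -/
noncomputable def burgPhi2 (x : ℤ → ℝ) (n : ℕ) : ℝ :=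
  let C := autocov x n 0 0 3 + autocov x n 2 2 3
  let D := autocov x n 0 0 2 + autocov x n 1 1 2
  let E := autocov x n 0 2 3
  let F := autocov x n 0 1 2
  let G := autocov x n 1 1 3
  let H := autocov x n 0 1 3 + autocov x n 2 1 3
  1 - (C * D ^ 2 - 2 * E * D ^ 2) / (C * D ^ 2 + 8 * F ^ 2 * G - 4 * F * H * D)

/-- The mean-corrected Burg estimate of `φ₁` from `x 1, …, x n`. -/
noncomputable def burgPhi1 (x : ℤ → ℝ) (n : ℕ) : ℝ :=
  let D := autocov x n 0 0 2 + autocov x n 1 1 2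
  let F := autocov x n 0 1 2
  2 * F / D * (1 - burgPhi2 x n)

/-- Determinant of the least squares normal equations
`S̄_{1,1,3} b₁ + S̄_{1,2,3} b₂ = S̄_{0,1,3}`, `S̄_{1,2,3} b₁ + S̄_{2,2,3} b₂ = S̄_{0,2,3}`, which are those
of minimizing
`∑_{t=3}^n ((x t - x̄) - b₁ (x (t-1) - x̄) - b₂ (x (t-2) - x̄))²` over `b₁`, `b₂`. -/
noncomputable def lsDet (x : ℤ → ℝ) (n : ℕ) : ℝ :=
  autocov x n 1 1 3 * autocov x n 2 2 3 - autocov x n 1 2 3 ^ 2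

/-- The mean-corrected least squares estimate of `φ₁` (solution `b₁` of the normal equations). -/
noncomputable def lsPhi1 (x : ℤ → ℝ) (n : ℕ) : ℝ :=
  (autocov x n 0 1 3 * autocov x n 2 2 3 - autocov x n 0 2 3 * autocov x n 1 2 3) / lsDet x n

/-- The mean-corrected least squares estimate of `φ₂` (solution `b₂` of the normal equations). -/
noncomputable def lsPhi2 (x : ℤ → ℝ) (n : ℕ) : ℝ :=
  (autocov x n 0 2 3 * autocov x n 1 1 3 - autocov x n 0 1 3 * autocov x n 1 2 3) / lsDet x n

/-- The statistic `T`, computed from `n` observations of the process `z`, has bias `b / n` to order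
`1 / n` as an estimator of `θ`: its expectation exists for all large `n`, and
`E (T_n - θ) = b / n + o (1 / n)`. -/
def HasBiasToOrderInv {Ω : Type*} [MeasurableSpace Ω] (P : Measure Ω) (z : ℤ → Ω → ℝ)
    (T : (ℤ → ℝ) → ℕ → ℝ) (θ b : ℝ) : Prop :=
  (∀ᶠ n : ℕ in atTop, Integrable (fun ω => T (fun t => z t ω) n) P) ∧
  (fun n : ℕ => (∫ ω, (T (fun t => z t ω) n - θ) ∂P) - b / n) =o[atTop] (fun n : ℕ => 1 / (n : ℝ))

/-! The estimators depend only on deviations from the sample mean, so the process may be centred. Up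
to null sets, an admissible stationary solution y is the causal moving average of its innovations
(`IsStationaryAR2.exists_isCausalAR2`). Hence all its moments are bounded, and its past is
independent of later innovations.

Multiplying the recursion by y_{t-1} and by y_{t-2}, squaring it, and summing over t gives a linear
system for the sums of lagged products. It is driven by three martingales, with increments
y_{t-1}a_t, y_{t-2}a_t and a_t² - v. So each sample autocovariance is γ_k, plus a linear combination
of these martingales divided by n (of size n^{-1/2} in every moment), plus O(1/n). Its bias is
((1-i)γ_k - v/(1-φ₁-φ₂)²)/n + o(1/n), where the second part is the effect of the sample mean
(`IsCausalAR2.autocov_hasJet`). The triple of limit, linear part and bias is recorded by `HasJet`.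
Jets are stable under sums and products, which is the delta method to second order.

Each estimator T satisfies T·D = N with N and D polynomials in autocovariances and D → d ≠ 0.
`HasJet.tendsto_ratio` expands 1/D as a finite geometric series in (D - d)/d and reads off the bias
of T. It needs only that E T² grows at most polynomially, since the series can be made so long that
its remainder beats any given power of n. The remaining computation is algebra in φ₂ and the lag one
autocorrelation r = φ₁/(1-φ₂).

The Burg estimators satisfy the moment condition because they are bounded: `burgPhi2` is a
normalized correlation of forward and backward residuals. For least squares one bounds E det⁻⁴
(`IsCausalAR2.lintegral_inv_lsDet_le`). The number det^{-1/2} is an average, over Cauchy distributed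
x, of the inverse normalized quadratic form in the direction (1, x). By Jensen and Fubini a fixed
direction suffices. There the form dominates the squares of 32 independent Gaussian combinations of
innovations with variance at least v, and negative moments of these of order 1/2 are finite. -/

/-! ### Orders of magnitude measured in all moments -/

section MomentBounds

variable {Ω ι : Type*} [MeasurableSpace Ω] {P : Measure Ω}

/-- A family of random variables all of whose even moments are finite and uniformly bounded. -/
structure BddMoments (P : Measure Ω) (X : ι → Ω → ℝ) : Prop where
  aesm : ∀ i, AEStronglyMeasurable (X i) P
  bound : ∀ m : ℕ, ∃ C : ℝ, ∀ i,
    Integrable (fun ω => X i ω ^ (2 * m)) P ∧ ∫ ω, X i ω ^ (2 * m) ∂P ≤ C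

namespace BddMoments

variable {X Y : ι → Ω → ℝ}

theorem of_le {Z : ι → Ω → ℝ} (hZ : ∀ i, AEStronglyMeasurable (Z i) P)
    (h : ∀ m : ℕ, ∃ C : ℝ, ∃ B : ι → Ω → ℝ, ∀ i, Integrable (B i) P ∧ ∫ ω, B i ω ∂P ≤ C ∧
      ∀ᵐ ω ∂P, Z i ω ^ (2 * m) ≤ B i ω) : BddMoments P Z := by
  refine ⟨hZ, fun m => ?_⟩
  obtain ⟨C, B, hB⟩ := h m
  refine ⟨C, fun i => ?_⟩
  obtain ⟨h1, h2, h3⟩ := hB i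
  have hi : Integrable (fun ω => Z i ω ^ (2 * m)) P := by
    refine h1.mono' ((hZ i).pow _) ?_
    filter_upwards [h3] with ω hω
    rw [Real.norm_eq_abs, abs_of_nonneg ((even_two_mul m).pow_nonneg _)]
    exact hω
  exact ⟨hi, (integral_mono_ae hi h1 h3).trans h2⟩

theorem congr (hX : BddMoments P X) (h : ∀ i, X i =ᵐ[P] Y i) : BddMoments P Y := by
  refine of_le (fun i => (hX.aesm i).congr (h i)) fun m => ?_
  obtain ⟨C, hC⟩ := hX.bound m
  refine ⟨C, fun i ω => X i ω ^ (2 * m), fun i => ⟨(hC i).1, (hC i).2, ?_⟩⟩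
  filter_upwards [h i] with ω hω
  rw [hω]

theorem comp {κ : Type*} (hX : BddMoments P X) (f : κ → ι) : BddMoments P (fun k => X (f k)) :=
  ⟨fun _ => hX.aesm _, fun m => (hX.bound m).imp fun _ hC _ => hC _⟩

theorem add (hX : BddMoments P X) (hY : BddMoments P Y) :
    BddMoments P (fun i ω => X i ω + Y i ω) := by
  refine of_le (fun i => (hX.aesm i).add (hY.aesm i)) fun m => ?_
  obtain ⟨C, hC⟩ := hX.bound m
  obtain ⟨D, hD⟩ := hY.bound m
  refine ⟨2 ^ (2 * m - 1) * (C + D),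
    fun i ω => 2 ^ (2 * m - 1) * (X i ω ^ (2 * m) + Y i ω ^ (2 * m)), fun i => ⟨?_, ?_, ?_⟩⟩
  · exact ((hC i).1.add (hD i).1).const_mul _
  · rw [integral_const_mul, integral_add (hC i).1 (hD i).1]
    have := (hC i).2
    have := (hD i).2
    gcongr
  · exact Eventually.of_forall fun ω => (even_two_mul m).add_pow_le

theorem mul (hX : BddMoments P X) (hY : BddMoments P Y) :
    BddMoments P (fun i ω => X i ω * Y i ω) := by
  refine of_le (fun i => (hX.aesm i).mul (hY.aesm i)) fun m => ?_
  obtain ⟨C, hC⟩ := hX.bound (2 * m)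
  obtain ⟨D, hD⟩ := hY.bound (2 * m)
  refine ⟨C + D, fun i ω => X i ω ^ (2 * (2 * m)) + Y i ω ^ (2 * (2 * m)),
    fun i => ⟨(hC i).1.add (hD i).1, ?_, Eventually.of_forall fun ω => ?_⟩⟩
  · rw [integral_add (hC i).1 (hD i).1]
    exact add_le_add (hC i).2 (hD i).2
  · have e1 : X i ω ^ (2 * (2 * m)) = (X i ω ^ (2 * m)) ^ 2 := by rw [← pow_mul]; ring_nf
    have e2 : Y i ω ^ (2 * (2 * m)) = (Y i ω ^ (2 * m)) ^ 2 := by rw [← pow_mul]; ring_nf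
    simp only [e1, e2, mul_pow]
    nlinarith [sq_nonneg (X i ω ^ (2 * m) - Y i ω ^ (2 * m)), sq_nonneg (X i ω ^ (2 * m)),
      sq_nonneg (Y i ω ^ (2 * m))]

theorem const [IsFiniteMeasure P] {c : ι → ℝ} {K : ℝ} (hc : ∀ i, |c i| ≤ K) :
    BddMoments P (fun i (_ : Ω) => c i) := by
  refine of_le (fun i => aestronglyMeasurable_const) fun m =>
    ⟨P.real Set.univ * K ^ (2 * m), fun i ω => K ^ (2 * m), fun i => ⟨integrable_const _, ?_, ?_⟩⟩
  · simp [mul_comm]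
  · refine Eventually.of_forall fun ω => ?_
    rw [← (even_two_mul m).pow_abs]
    exact pow_le_pow_left₀ (abs_nonneg _) (hc i) _

theorem const_mul [IsFiniteMeasure P] (hX : BddMoments P X) {c : ι → ℝ} {K : ℝ}
    (hc : ∀ i, |c i| ≤ K) : BddMoments P (fun i ω => c i * X i ω) :=
  (const hc).mul hX

theorem smul [IsFiniteMeasure P] (hX : BddMoments P X) (c : ℝ) :
    BddMoments P (fun i ω => c * X i ω) :=
  hX.const_mul (c := fun _ => c) (fun _ => le_rfl)

theorem neg [IsFiniteMeasure P] (hX : BddMoments P X) : BddMoments P (fun i ω => -X i ω) := by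
  simpa using hX.smul (-1)

theorem sub [IsFiniteMeasure P] (hX : BddMoments P X) (hY : BddMoments P Y) :
    BddMoments P (fun i ω => X i ω - Y i ω) := by
  simpa [sub_eq_add_neg] using hX.add hY.neg

theorem pow [IsFiniteMeasure P] (hX : BddMoments P X) (k : ℕ) :
    BddMoments P (fun i ω => X i ω ^ k) := by
  induction k with
  | zero => simpa using const (P := P) (ι := ι) (c := fun _ => 1) (K := 1) (by simp)
  | succ k ih => simpa only [pow_succ] using ih.mul hX

theorem abs_le_one_add_sq (x : ℝ) : |x| ≤ 1 + x ^ (2 * 1) := by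
  rw [mul_one, ← sq_abs]
  nlinarith [sq_nonneg (|x| - 1), abs_nonneg x]

theorem integrable [IsFiniteMeasure P] (hX : BddMoments P X) (i : ι) : Integrable (X i) P := by
  obtain ⟨C, hC⟩ := hX.bound 1
  refine ((integrable_const (1 : ℝ)).add (hC i).1).mono' (hX.aesm i) ?_
  exact Eventually.of_forall fun ω => abs_le_one_add_sq _

theorem abs_integral_le [IsProbabilityMeasure P] (hX : BddMoments P X) :
    ∃ C : ℝ, ∀ i, |∫ ω, X i ω ∂P| ≤ C := by
  obtain ⟨C, hC⟩ := hX.bound 1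
  refine ⟨1 + C, fun i => ?_⟩
  calc |∫ ω, X i ω ∂P| ≤ ∫ ω, |X i ω| ∂P := abs_integral_le_integral_abs
    _ ≤ ∫ ω, (1 + X i ω ^ (2 * 1)) ∂P :=
        integral_mono (hX.integrable i).abs ((integrable_const _).add (hC i).1)
          fun ω => abs_le_one_add_sq _
    _ ≤ 1 + C := by
        rw [integral_add (integrable_const _) (hC i).1]
        simpa using (hC i).2

theorem sum [IsFiniteMeasure P] {κ : Type*} {Z : κ → ι → Ω → ℝ} (s : Finset κ)
    (h : ∀ k ∈ s, BddMoments P (Z k)) : BddMoments P (fun i ω => ∑ k ∈ s, Z k i ω) := by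
  classical
  induction s using Finset.induction_on with
  | empty => simpa using const (P := P) (ι := ι) (c := fun _ => 0) (K := 0) (by simp)
  | insert a s ha ih =>
    simp only [Finset.sum_insert ha]
    exact (h a (Finset.mem_insert_self _ _)).add
      (ih fun k hk => h k (Finset.mem_insert_of_mem hk))

end BddMoments

/-- `X n = O(n ^ (-k / 2))` in all moments. -/
def MomentO (P : Measure Ω) (k : ℕ) (X : ℕ → Ω → ℝ) : Prop :=
  BddMoments P (fun (n : ℕ) ω => √(n + 1) ^ k * X n ω)

namespace MomentO

variable {X Y : ℕ → Ω → ℝ} {k l : ℕ}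

theorem congr (hX : MomentO P k X) (h : ∀ n, X n =ᵐ[P] Y n) : MomentO P k Y :=
  BddMoments.congr hX fun n => by
    filter_upwards [h n] with ω hω
    rw [hω]

theorem of_bdd (hX : BddMoments P X) : MomentO P 0 X := by simpa [MomentO] using hX

theorem add (hX : MomentO P k X) (hY : MomentO P k Y) : MomentO P k (fun n ω => X n ω + Y n ω) := by
  unfold MomentO
  simpa only [mul_add] using BddMoments.add hX hY

theorem mul (hX : MomentO P k X) (hY : MomentO P l Y) :
    MomentO P (k + l) (fun n ω => X n ω * Y n ω) := by
  refine (BddMoments.mul hX hY).congr fun n => Eventually.of_forall fun ω => ?_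
  simp only [pow_add]
  ring

theorem one_le_sqrt (n : ℕ) : (1 : ℝ) ≤ √(n + 1) := by
  rw [Real.one_le_sqrt]
  linarith [(Nat.cast_nonneg n : (0 : ℝ) ≤ n)]

/-- Since n · n^{-3/2} → 0, terms of order 3 are invisible in a bias of order 1/n. -/
theorem tendsto_integral [IsProbabilityMeasure P] (hX : MomentO P 3 X) :
    Tendsto (fun n : ℕ => (n : ℝ) * ∫ ω, X n ω ∂P) atTop (𝓝 0) := by
  obtain ⟨C, hC⟩ := BddMoments.abs_integral_le hX
  have hlim : Tendsto (fun n : ℕ => C * (√((n : ℝ) + 1))⁻¹) atTop (𝓝 (C * 0)) := by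
    refine Tendsto.const_mul _ (tendsto_inv_atTop_zero.comp (Real.tendsto_sqrt_atTop.comp ?_))
    exact tendsto_atTop_add_const_right _ _ tendsto_natCast_atTop_atTop
  rw [mul_zero] at hlim
  refine squeeze_zero_norm (fun n => ?_) hlim
  have h1 := hC n
  have h0 := one_le_sqrt n
  have hs : 0 < √((n : ℝ) + 1) := by linarith
  rw [integral_const_mul, abs_mul, abs_of_nonneg (by positivity)] at h1
  rw [Real.norm_eq_abs, abs_mul, abs_of_nonneg (by positivity), ← div_eq_mul_inv, le_div_iff₀ hs]
  refine le_trans ?_ h1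
  have h2 : √((n : ℝ) + 1) ^ 2 = n + 1 := Real.sq_sqrt (by positivity)
  have h3 : √((n : ℝ) + 1) ^ 3 = √((n : ℝ) + 1) * (n + 1) := by rw [pow_succ', h2]
  rw [h3]
  nlinarith [abs_nonneg (∫ ω, X n ω ∂P), mul_nonneg hs.le (abs_nonneg (∫ ω, X n ω ∂P))]

variable [IsFiniteMeasure P]

theorem of_scale {c : ℕ → ℝ} {K : ℝ} (hX : BddMoments P X) (hc : ∀ n : ℕ, |√(n + 1) ^ k * c n| ≤ K) :
    MomentO P k (fun n ω => c n * X n ω) := by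
  refine (hX.const_mul hc).congr fun n => Eventually.of_forall fun ω => ?_
  simp only
  ring

theorem mono (hX : MomentO P k X) (h : l ≤ k) : MomentO P l X := by
  have hc : ∀ n : ℕ, |(√((n : ℝ) + 1) ^ (k - l))⁻¹| ≤ 1 := fun n => by
    rw [abs_inv]
    refine inv_le_one_of_one_le₀ ?_
    rw [abs_of_nonneg (by positivity)]
    exact one_le_pow₀ (one_le_sqrt n)
  refine (BddMoments.const_mul hX hc).congr fun n => Eventually.of_forall fun ω => ?_
  have h1 : √((n : ℝ) + 1) ^ (k - l) ≠ 0 := by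
    have := one_le_sqrt n
    positivity
  have h2 : √((n : ℝ) + 1) ^ k = √((n : ℝ) + 1) ^ (k - l) * √((n : ℝ) + 1) ^ l := by
    rw [← pow_add, Nat.sub_add_cancel h]
  simp only [h2]
  field_simp

theorem smul (hX : MomentO P k X) (c : ℝ) : MomentO P k (fun n ω => c * X n ω) := by
  refine (BddMoments.smul hX c).congr fun n => Eventually.of_forall fun ω => ?_
  simp only
  ring

theorem neg (hX : MomentO P k X) : MomentO P k (fun n ω => -X n ω) := by
  simpa using hX.smul (-1)

theorem sub (hX : MomentO P k X) (hY : MomentO P k Y) : MomentO P k (fun n ω => X n ω - Y n ω) := by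
  simpa [sub_eq_add_neg] using hX.add hY.neg

theorem const (c : ℝ) : MomentO P 0 (fun _ (_ : Ω) => c) :=
  of_bdd (BddMoments.const (c := fun _ => c) fun _ => le_rfl)

theorem pow (hX : MomentO P k X) (j : ℕ) : MomentO P (k * j) (fun n ω => X n ω ^ j) := by
  induction j with
  | zero => simpa using const (P := P) 1
  | succ j ih => simpa only [pow_succ, Nat.mul_succ] using ih.mul hX

theorem bdd (hX : MomentO P k X) : BddMoments P X := by
  simpa [MomentO] using hX.mono (Nat.zero_le k)

theorem sum {κ : Type*} {Z : κ → ℕ → Ω → ℝ} (s : Finset κ)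
    (h : ∀ j ∈ s, MomentO P k (Z j)) : MomentO P k (fun n ω => ∑ j ∈ s, Z j n ω) := by
  unfold MomentO
  simpa only [Finset.mul_sum] using BddMoments.sum s h

/-- `X / n` for a family with bounded moments. -/
theorem inv_mul (hX : BddMoments P X) : MomentO P 2 (fun n ω => (n : ℝ)⁻¹ * X n ω) := by
  refine of_scale (K := 2) hX fun n => ?_
  rw [Real.sq_sqrt (by positivity), abs_of_nonneg (by positivity)]
  rcases Nat.eq_zero_or_pos n with rfl | hn
  · simp
  · have : (1 : ℝ) ≤ n := by exact_mod_cast hn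
    rw [← div_eq_mul_inv, div_le_iff₀ (by linarith)]
    linarith

end MomentO

end MomentBounds

/-! ### Second order delta method, for polynomials and for ratios -/

section Jets

variable {Ω κ : Type*} [MeasurableSpace Ω] {P : Measure Ω} [IsProbabilityMeasure P]

theorem tendsto_integral_add_momentO {A R : ℕ → Ω → ℝ} {a : ℝ} (hA : ∀ n, Integrable (A n) P)
    (h : Tendsto (fun n : ℕ => (n : ℝ) * ∫ ω, A n ω ∂P) atTop (𝓝 a)) (hR : MomentO P 3 R) :
    Tendsto (fun n : ℕ => (n : ℝ) * ∫ ω, (A n ω + R n ω) ∂P) atTop (𝓝 a) := by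
  have h1 := h.add hR.tendsto_integral
  rw [add_zero] at h1
  refine h1.congr fun n => ?_
  rw [integral_add (hA n) (hR.bdd.integrable n)]
  ring

variable [Fintype κ]

/-- `X n = c + ∑ i, l i * Δ i n + O(1/n)` in all moments, and `n * E (X n - c) → ρ`. -/
structure HasJet (P : Measure Ω) (Δ : κ → ℕ → Ω → ℝ) (X : ℕ → Ω → ℝ) (c : ℝ) (l : κ → ℝ)
    (ρ : ℝ) : Prop where
  rem : MomentO P 2 (fun n ω => X n ω - c - ∑ i, l i * Δ i n ω)
  bias : Tendsto (fun n : ℕ => (n : ℝ) * ∫ ω, (X n ω - c) ∂P) atTop (𝓝 ρ)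

/-- A vector of fluctuations of order `n ^ (-1/2)` with `n * E (Δ i n * Δ j n) → S i j`. -/
structure IsFluctuation (P : Measure Ω) (Δ : κ → ℕ → Ω → ℝ) (S : κ → κ → ℝ) : Prop where
  order : ∀ i, MomentO P 1 (Δ i)
  cov : ∀ i j, Tendsto (fun n : ℕ => (n : ℝ) * ∫ ω, Δ i n ω * Δ j n ω ∂P) atTop (𝓝 (S i j))

namespace HasJet

variable {Δ : κ → ℕ → Ω → ℝ} {S : κ → κ → ℝ} {X Y : ℕ → Ω → ℝ} {c d ρ ρ' : ℝ} {l l' : κ → ℝ}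

theorem linear_order (hΔ : IsFluctuation P Δ S) (l : κ → ℝ) :
    MomentO P 1 (fun n ω => ∑ i, l i * Δ i n ω) :=
  MomentO.sum _ fun i _ => (hΔ.order i).smul (l i)

theorem order (hΔ : IsFluctuation P Δ S) (hX : HasJet P Δ X c l ρ) :
    MomentO P 1 (fun n ω => X n ω - c) :=
  ((hX.rem.mono one_le_two).add (linear_order hΔ l)).congr fun n =>
    Eventually.of_forall fun ω => by ring

theorem bdd (hΔ : IsFluctuation P Δ S) (hX : HasJet P Δ X c l ρ) : MomentO P 0 X :=
  (((hX.order hΔ).mono zero_le_one).add (MomentO.const c)).congr fun n =>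
    Eventually.of_forall fun ω => by ring

/-- With L, L' the linear parts, (X-c)(Y-d) - LL' = (X-c-L)(Y-d) + L(Y-d-L') has order 3, so only
the covariances of the fluctuations survive. -/
theorem tendsto_cross (hΔ : IsFluctuation P Δ S) (hX : HasJet P Δ X c l ρ)
    (hY : HasJet P Δ Y d l' ρ') :
    Tendsto (fun n : ℕ => (n : ℝ) * ∫ ω, (X n ω - c) * (Y n ω - d) ∂P) atTop
      (𝓝 (∑ i, ∑ j, l i * l' j * S i j)) := by
  have hint : ∀ n i j, Integrable (fun ω => l i * l' j * (Δ i n ω * Δ j n ω)) P := fun n i j =>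
    (((hΔ.order i).mul (hΔ.order j)).bdd.integrable n).const_mul _
  have h1 : Tendsto (fun n : ℕ => (n : ℝ) * ∫ ω, ∑ i, ∑ j, l i * l' j * (Δ i n ω * Δ j n ω) ∂P)
      atTop (𝓝 (∑ i, ∑ j, l i * l' j * S i j)) := by
    have : Tendsto (fun n : ℕ => ∑ i, ∑ j, l i * l' j * ((n : ℝ) * ∫ ω, Δ i n ω * Δ j n ω ∂P))
        atTop (𝓝 (∑ i, ∑ j, l i * l' j * S i j)) :=
      tendsto_finsetSum _ fun i _ => tendsto_finsetSum _ fun j _ => (hΔ.cov i j).const_mul _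
    refine this.congr fun n => ?_
    rw [integral_finsetSum _ fun i _ => integrable_finsetSum _ fun j _ => hint n i j,
      Finset.mul_sum]
    refine Finset.sum_congr rfl fun i _ => ?_
    rw [integral_finsetSum _ fun j _ => hint n i j, Finset.mul_sum]
    refine Finset.sum_congr rfl fun j _ => ?_
    rw [integral_const_mul]
    ring
  have h2 : MomentO P 3 (fun n ω => (X n ω - c - ∑ i, l i * Δ i n ω) * (Y n ω - d) +
      (∑ i, l i * Δ i n ω) * (Y n ω - d - ∑ i, l' i * Δ i n ω)) :=
    (hX.rem.mul (hY.order hΔ)).add ((linear_order hΔ l).mul hY.rem)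
  refine (tendsto_integral_add_momentO (fun n => integrable_finsetSum _ fun i _ =>
    integrable_finsetSum _ fun j _ => hint n i j) h1 h2).congr fun n => ?_
  congr 1
  refine integral_congr_ae (Eventually.of_forall fun ω => ?_)
  have : ∑ i, ∑ j, l i * l' j * (Δ i n ω * Δ j n ω) =
      (∑ i, l i * Δ i n ω) * ∑ j, l' j * Δ j n ω := by
    rw [Finset.sum_mul_sum]
    exact Finset.sum_congr rfl fun i _ => Finset.sum_congr rfl fun j _ => by ring
  simp only [this]
  ring

theorem add (hΔ : IsFluctuation P Δ S) (hX : HasJet P Δ X c l ρ) (hY : HasJet P Δ Y d l' ρ') :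
    HasJet P Δ (fun n ω => X n ω + Y n ω) (c + d) (fun i => l i + l' i) (ρ + ρ') := by
  refine ⟨(hX.rem.add hY.rem).congr fun n => Eventually.of_forall fun ω => ?_,
    (hX.bias.add hY.bias).congr fun n => ?_⟩
  · simp only [add_mul, Finset.sum_add_distrib]
    ring
  · rw [← mul_add, ← integral_add ((hX.order hΔ).bdd.integrable n)
      ((hY.order hΔ).bdd.integrable n)]
    congr 2 with ω
    ring

theorem smul (hX : HasJet P Δ X c l ρ) (a : ℝ) :
    HasJet P Δ (fun n ω => a * X n ω) (a * c) (fun i => a * l i) (a * ρ) := by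
  refine ⟨(hX.rem.smul a).congr fun n => Eventually.of_forall fun ω => ?_,
    (hX.bias.const_mul a).congr fun n => ?_⟩
  · simp only [mul_assoc, ← Finset.mul_sum]
    ring
  · rw [mul_left_comm, ← integral_const_mul]
    congr 2 with ω
    ring

theorem sub (hΔ : IsFluctuation P Δ S) (hX : HasJet P Δ X c l ρ) (hY : HasJet P Δ Y d l' ρ') :
    HasJet P Δ (fun n ω => X n ω - Y n ω) (c - d) (fun i => l i - l' i) (ρ - ρ') := by
  simpa [sub_eq_add_neg] using hX.add hΔ (hY.smul (-1))

/-- From XY - cd = c(Y-d) + d(X-c) + (X-c)(Y-d): the last term adds nothing to the linear part but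
contributes a covariance to the bias. -/
theorem mul (hΔ : IsFluctuation P Δ S) (hX : HasJet P Δ X c l ρ) (hY : HasJet P Δ Y d l' ρ') :
    HasJet P Δ (fun n ω => X n ω * Y n ω) (c * d) (fun i => c * l' i + d * l i)
      (c * ρ' + d * ρ + ∑ i, ∑ j, l i * l' j * S i j) := by
  refine ⟨(((hY.rem.smul c).add (hX.rem.smul d)).add ((hX.order hΔ).mul (hY.order hΔ))).congr
    fun n => Eventually.of_forall fun ω => ?_,
    (((hY.bias.const_mul c).add (hX.bias.const_mul d)).add (hX.tendsto_cross hΔ hY)).congr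
    fun n => ?_⟩
  · simp only [add_mul, Finset.sum_add_distrib, mul_assoc, ← Finset.mul_sum]
    ring
  · have hx := (hX.order hΔ).bdd.integrable n
    have hy := (hY.order hΔ).bdd.integrable n
    have hxy := ((hX.order hΔ).mul (hY.order hΔ)).bdd.integrable n
    have : ∫ ω, (X n ω * Y n ω - c * d) ∂P = ∫ ω, (c * (Y n ω - d) + d * (X n ω - c) +
        (X n ω - c) * (Y n ω - d)) ∂P := by
      congr 1 with ω
      ring
    have hs : Integrable (fun ω => c * (Y n ω - d) + d * (X n ω - c)) P :=
      (hy.const_mul c).add (hx.const_mul d)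
    rw [this, integral_add hs hxy, integral_add (hy.const_mul c) (hx.const_mul d), integral_const_mul, integral_const_mul]
    ring

omit [IsProbabilityMeasure P] in
theorem congr (hX : HasJet P Δ X c l ρ) (h : ∀ n, X n =ᵐ[P] Y n) : HasJet P Δ Y c l ρ := by
  refine ⟨hX.rem.congr fun n => ?_, hX.bias.congr fun n => ?_⟩
  · filter_upwards [h n] with ω hω
    rw [hω]
  · congr 1
    refine integral_congr_ae ?_
    filter_upwards [h n] with ω hω
    rw [hω]

omit [IsProbabilityMeasure P] in
theorem cast (hX : HasJet P Δ X c l ρ) (hc : c = d) (hl : ∀ i, l i = l' i) (hρ : ρ = ρ') :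
    HasJet P Δ X d l' ρ' := by
  obtain rfl : l = l' := funext hl
  subst hc hρ
  exact hX

omit [Fintype κ] [IsProbabilityMeasure P] in
theorem _root_.IsFluctuation.smul [IsFiniteMeasure P] (hΔ : IsFluctuation P Δ S) (a : ℝ) :
    IsFluctuation P (fun i n ω => a * Δ i n ω) (fun i j => a ^ 2 * S i j) := by
  refine ⟨fun i => (hΔ.order i).smul a, fun i j => ((hΔ.cov i j).const_mul (a ^ 2)).congr
    fun n => ?_⟩
  rw [mul_left_comm, ← integral_const_mul]
  congr 2 with ω
  ring

omit [IsProbabilityMeasure P] in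
theorem rescale (hX : HasJet P Δ X c l ρ) {a : ℝ} (ha : a ≠ 0) :
    HasJet P (fun i n ω => a * Δ i n ω) X c (fun i => a⁻¹ * l i) ρ := by
  refine ⟨hX.rem.congr fun n => Eventually.of_forall fun ω => ?_, hX.bias⟩
  have hs : ∑ i, a⁻¹ * l i * (a * Δ i n ω) = ∑ i, l i * Δ i n ω :=
    Finset.sum_congr rfl fun i _ => by field_simp
  simp only [hs]

/-- A product `T * V` is negligible if the second moments of `T` grow polynomially and `V` is of
sufficiently small order. -/
theorem tendsto_integral_mul_of_sq_le {T V : ℕ → Ω → ℝ} {A : ℕ} {K : ℝ}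
    (hT : ∀ n, AEStronglyMeasurable (T n) P)
    (hT2 : ∀ᶠ n : ℕ in atTop, Integrable (fun ω => T n ω ^ 2) P ∧
      ∫ ω, T n ω ^ 2 ∂P ≤ K * (n : ℝ) ^ A) (hV : MomentO P (A + 4) V) :
    (∀ᶠ n : ℕ in atTop, Integrable (fun ω => T n ω * V n ω) P) ∧
    Tendsto (fun n : ℕ => (n : ℝ) * ∫ ω, T n ω * V n ω ∂P) atTop (𝓝 0) := by
  obtain ⟨C, hC⟩ := hV.bound 1
  have key : ∀ᶠ n : ℕ in atTop, Integrable (fun ω => T n ω * V n ω) P ∧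
      ‖(n : ℝ) * ∫ ω, T n ω * V n ω ∂P‖ ≤ (K + C) * (n : ℝ)⁻¹ := by
    filter_upwards [hT2, eventually_ge_atTop 1] with n hn hn1
    have hn0 : (1 : ℝ) ≤ n := by exact_mod_cast hn1
    have hnp : (0 : ℝ) < n := by linarith
    -- Young's inequality with weight x = n^(A+2): 2|TV| ≤ T²/x + xV². Order A+4 of V makes both
    -- terms integrate to O(n⁻²), one power more than the factor n requires.
    set B : Ω → ℝ := fun ω => ((n : ℝ) ^ (A + 2))⁻¹ * T n ω ^ 2 +
      ((n : ℝ) ^ 2)⁻¹ * (√((n : ℝ) + 1) ^ (A + 4) * V n ω) ^ (2 * 1) with hB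
    have hBi : Integrable B P := (hn.1.const_mul _).add ((hC n).1.const_mul _)
    have hle : ∀ ω, |T n ω * V n ω| ≤ B ω := fun ω => by
      have e1 : (√((n : ℝ) + 1) ^ (A + 4)) ^ 2 = ((n : ℝ) + 1) ^ (A + 4) := by
        rw [← pow_mul, mul_comm, pow_mul, Real.sq_sqrt (by positivity)]
      have e2 : (n : ℝ) ^ (A + 4) ≤ ((n : ℝ) + 1) ^ (A + 4) := by gcongr; linarith
      have e3 : ((n : ℝ) ^ 2)⁻¹ * (n : ℝ) ^ (A + 4) = (n : ℝ) ^ (A + 2) := by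
        rw [show A + 4 = 2 + (A + 2) by ring, pow_add]
        field_simp
      have h1 : (n : ℝ) ^ (A + 2) * V n ω ^ 2 ≤
          ((n : ℝ) ^ 2)⁻¹ * (√((n : ℝ) + 1) ^ (A + 4) * V n ω) ^ (2 * 1) := by
        rw [mul_one, mul_pow, e1, ← mul_assoc, ← e3]
        gcongr
      refine le_trans ?_ (add_le_add_right h1 _)
      set x : ℝ := (n : ℝ) ^ (A + 2)
      have hx : 0 < x := by positivity
      have hq : 0 ≤ x⁻¹ * (|T n ω| - x * |V n ω|) ^ 2 := by positivity
      have : x⁻¹ * (|T n ω| - x * |V n ω|) ^ 2 =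
          x⁻¹ * T n ω ^ 2 + x * V n ω ^ 2 - 2 * (|T n ω| * |V n ω|) := by
        rw [← sq_abs (T n ω), ← sq_abs (V n ω)]
        field_simp
        ring
      rw [abs_mul]
      nlinarith [mul_nonneg (abs_nonneg (T n ω)) (abs_nonneg (V n ω))]
    have hVm : AEStronglyMeasurable (V n) P := hV.bdd.aesm n
    have hi : Integrable (fun ω => T n ω * V n ω) P :=
      hBi.mono' ((hT n).mul hVm) (Eventually.of_forall hle)
    refine ⟨hi, ?_⟩
    have h2 : |∫ ω, T n ω * V n ω ∂P| ≤ ∫ ω, B ω ∂P :=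
      abs_integral_le_integral_abs.trans (integral_mono hi.abs hBi hle)
    have h3 : ∫ ω, B ω ∂P ≤ ((n : ℝ) ^ (A + 2))⁻¹ * (K * (n : ℝ) ^ A) + ((n : ℝ) ^ 2)⁻¹ * C := by
      rw [hB, integral_add (hn.1.const_mul _) ((hC n).1.const_mul _), integral_const_mul,
        integral_const_mul]
      have := hn.2
      have := (hC n).2
      gcongr
    rw [Real.norm_eq_abs, abs_mul, abs_of_pos hnp]
    calc (n : ℝ) * |∫ ω, T n ω * V n ω ∂P|
        ≤ n * (((n : ℝ) ^ (A + 2))⁻¹ * (K * (n : ℝ) ^ A) + ((n : ℝ) ^ 2)⁻¹ * C) := by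
          gcongr
          exact h2.trans h3
      _ = (K + C) * (n : ℝ)⁻¹ := by
          rw [pow_add]
          field_simp
  refine ⟨key.mono fun n h => h.1, squeeze_zero_norm' (key.mono fun n h => h.2) ?_⟩
  simpa using (tendsto_inv_atTop_zero.comp tendsto_natCast_atTop_atTop).const_mul (K + C)

/-- A ratio `T = N / D` (in the form `T * D = N`) of sequences with jets, where `D` has non-zero
limit and `T` has polynomially bounded second moments, has expectation expanding as expected. -/
theorem tendsto_ratio (hΔ : IsFluctuation P Δ S) {T N D : ℕ → Ω → ℝ} {θ : ℝ} {A : ℕ} {K : ℝ}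
    (hN : HasJet P Δ N (θ * d) l ρ) (hD : HasJet P Δ D d l' ρ') (hd : d ≠ 0)
    (hT : ∀ n, AEStronglyMeasurable (T n) P)
    (hT2 : ∀ᶠ n : ℕ in atTop, Integrable (fun ω => T n ω ^ 2) P ∧
      ∫ ω, T n ω ^ 2 ∂P ≤ K * (n : ℝ) ^ A)
    (hTD : ∀ n, ∀ᵐ ω ∂P, T n ω * D n ω = N n ω) :
    (∀ᶠ n : ℕ in atTop, Integrable (T n) P) ∧
    Tendsto (fun n : ℕ => (n : ℝ) * ∫ ω, (T n ω - θ) ∂P) atTop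
      (𝓝 ((ρ - θ * ρ') / d - (∑ i, ∑ j, (l i - θ * l' i) * l' j * S i j) / d ^ 2)) := by
  set Z : ℕ → Ω → ℝ := fun n ω => N n ω - θ * D n ω with hZ
  set U : ℕ → Ω → ℝ := fun n ω => D n ω - d with hU
  have hNZ : HasJet P Δ Z 0 (fun i => l i - θ * l' i) (ρ - θ * ρ') :=
    (hN.sub hΔ (hD.smul θ)).cast (sub_self _) (fun _ => rfl) rfl
  have hZ1 : MomentO P 1 Z := by simpa using hNZ.order hΔ
  have hU1 : MomentO P 1 U := hD.order hΔ
  set s : ℕ → Ω → ℝ := fun n ω => -d⁻¹ * U n ω with hs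
  have hs1 : MomentO P 1 s := hU1.smul _
  have hsk : ∀ k, MomentO P k (fun n ω => s n ω ^ k) := fun k => by simpa using hs1.pow k
  -- With D = d(1 - s), the terms j = 0, 1 of the geometric series carry the bias. Those with j ≥ 2
  -- have order at least 3, because Z is already of order 1.
  set R : ℕ → Ω → ℝ := fun n ω => ∑ j ∈ Finset.Ico 2 (A + 4), d⁻¹ * (Z n ω * s n ω ^ j) with hR
  have hR3 : MomentO P 3 R := MomentO.sum _ fun j hj =>
    ((hZ1.mul (hsk j)).mono (by have := (Finset.mem_Ico.1 hj).1; omega)).smul _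
  have hVZ : MomentO P 2 (fun n ω => Z n ω * U n ω) := hZ1.mul hU1
  have hm : Tendsto (fun n : ℕ => (n : ℝ) * ∫ ω, (d⁻¹ * Z n ω - (d ^ 2)⁻¹ * (Z n ω * U n ω)) ∂P)
      atTop (𝓝 ((ρ - θ * ρ') / d - (∑ i, ∑ j, (l i - θ * l' i) * l' j * S i j) / d ^ 2)) := by
    have h1 := (hNZ.bias.const_mul d⁻¹).sub ((hNZ.tendsto_cross hΔ hD).const_mul (d ^ 2)⁻¹)
    simp only [sub_zero] at h1
    rw [div_eq_inv_mul, div_eq_inv_mul]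
    refine h1.congr fun n => ?_
    rw [integral_sub ((hZ1.bdd.integrable n).const_mul _) ((hVZ.bdd.integrable n).const_mul _),
      integral_const_mul, integral_const_mul]
    ring
  have hMi : ∀ n, Integrable (fun ω => d⁻¹ * Z n ω - (d ^ 2)⁻¹ * (Z n ω * U n ω)) P := fun n =>
    ((hZ1.bdd.integrable n).const_mul _).sub ((hVZ.bdd.integrable n).const_mul _)
  have h1 := tendsto_integral_add_momentO hMi hm hR3
  have h2 := tendsto_integral_mul_of_sq_le hT hT2 (hsk (A + 4))
  have h3 : MomentO P 3 (fun n ω => -θ * s n ω ^ (A + 4)) :=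
    ((hsk (A + 4)).mono (by omega)).smul _
  have hMRi : ∀ n, Integrable (fun ω => d⁻¹ * Z n ω - (d ^ 2)⁻¹ * (Z n ω * U n ω) + R n ω) P :=
    fun n => (hMi n).add (hR3.bdd.integrable n)
  have h4 := tendsto_integral_add_momentO hMRi h1 h3
  have hTi : ∀ n, Integrable (fun ω => d⁻¹ * Z n ω - (d ^ 2)⁻¹ * (Z n ω * U n ω) + R n ω +
      -θ * s n ω ^ (A + 4)) P := fun n => (hMRi n).add (h3.bdd.integrable n)
  -- The identity (T - θ)(1 - s) = d⁻¹Z uses only T·D = N, so the finite expansion is exact even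
  -- where D vanishes. The remainder (T - θ)s^(A+4) is split because only its T part needs the
  -- second moment bound.
  have hexp : ∀ n, ∀ᵐ ω ∂P, (d⁻¹ * Z n ω - (d ^ 2)⁻¹ * (Z n ω * U n ω) + R n ω +
      -θ * s n ω ^ (A + 4)) + T n ω * s n ω ^ (A + 4) = T n ω - θ := fun n => by
    filter_upwards [hTD n] with ω hω
    have e1 : (T n ω - θ) * (1 - s n ω) = d⁻¹ * Z n ω := by
      simp only [hs, hU, hZ, ← hω]
      field_simp
      ring
    have e2 : R n ω = d⁻¹ * Z n ω * ∑ j ∈ Finset.Ico 2 (A + 4), s n ω ^ j := by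
      rw [Finset.mul_sum]
      exact Finset.sum_congr rfl fun j _ => by ring
    have e3 : (∑ j ∈ Finset.Ico 2 (A + 4), s n ω ^ j) * (1 - s n ω) =
        s n ω ^ 2 - s n ω ^ (A + 4) := by
      rw [mul_comm]
      have := geom_sum_Ico_mul (s n ω) (show 2 ≤ A + 4 by omega)
      linear_combination -this
    have e4 : (d ^ 2)⁻¹ * (Z n ω * U n ω) = -(d⁻¹ * Z n ω) * s n ω := by
      simp only [hs]
      field_simp
    rw [e4, e2, ← e1]
    linear_combination (T n ω - θ) * e3
  have hsum := h4.add h2.2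
  rw [add_zero] at hsum
  refine ⟨?_, hsum.congr' ?_⟩
  · filter_upwards [h2.1] with n hn
    have := (((hTi n).add hn).congr (hexp n)).add (integrable_const θ)
    refine this.congr (Eventually.of_forall fun ω => ?_)
    simp
  · filter_upwards [h2.1] with n hn
    rw [← mul_add, ← integral_add (hTi n) hn, integral_congr_ae (hexp n)]

end HasJet

end Jets

/-! ### Moments and covariances of martingale sums -/

section MartingaleMoments

theorem abs_pow_mul_pow_le (x d : ℝ) {j k : ℕ} (hj : j ≤ 2 * k) :
    |d ^ j * x ^ (2 * k - j)| ≤ x ^ (2 * k) + d ^ (2 * k) := by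
  rw [abs_mul, abs_pow, abs_pow, ← (even_two_mul k).pow_abs x, ← (even_two_mul k).pow_abs d]
  rcases le_total |x| |d| with h | h
  · calc |d| ^ j * |x| ^ (2 * k - j) ≤ |d| ^ j * |d| ^ (2 * k - j) := by gcongr
      _ = |d| ^ (2 * k) := by rw [← pow_add]; congr 1; omega
      _ ≤ _ := by linarith [pow_nonneg (abs_nonneg x) (2 * k)]
  · calc |d| ^ j * |x| ^ (2 * k - j) ≤ |x| ^ j * |x| ^ (2 * k - j) := by gcongr
      _ = |x| ^ (2 * k) := by rw [← pow_add]; congr 1; omega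
      _ ≤ _ := by linarith [pow_nonneg (abs_nonneg d) (2 * k)]

/-- Binomial expansion in which the term linear in d is kept exact, since orthogonality will
annihilate it. All higher terms are dominated by the two extreme ones. -/
theorem add_pow_even_le (k : ℕ) (x d : ℝ) :
    (x + d) ^ (2 * (k + 1)) ≤ x ^ (2 * (k + 1)) + 2 * (k + 1) * (x ^ (2 * k + 1) * d) +
      (∑ j ∈ Finset.range (2 * k + 1), ((2 * (k + 1)).choose (j + 2) : ℝ)) *
        (x ^ (2 * k) * d ^ 2 + d ^ (2 * (k + 1))) := by
  rw [add_comm x d, add_pow, show 2 * (k + 1) + 1 = 2 * k + 1 + 1 + 1 by ring,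
    Finset.sum_range_succ', Finset.sum_range_succ', Finset.sum_mul]
  have h : ∀ j ∈ Finset.range (2 * k + 1),
      d ^ (j + 1 + 1) * x ^ (2 * (k + 1) - (j + 1 + 1)) * ((2 * (k + 1)).choose (j + 1 + 1) : ℝ) ≤
      ((2 * (k + 1)).choose (j + 2) : ℝ) * (x ^ (2 * k) * d ^ 2 + d ^ (2 * (k + 1))) := by
    intro j hj
    have hj' : j ≤ 2 * k := by have := Finset.mem_range.1 hj; omega
    have h1 := (le_abs_self _).trans (abs_pow_mul_pow_le x d hj')
    rw [mul_comm, show 2 * (k + 1) - (j + 1 + 1) = 2 * k - j by omega]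
    refine mul_le_mul_of_nonneg_left ?_ (Nat.cast_nonneg _)
    calc d ^ (j + 1 + 1) * x ^ (2 * k - j) = d ^ 2 * (d ^ j * x ^ (2 * k - j)) := by ring
      _ ≤ d ^ 2 * (x ^ (2 * k) + d ^ (2 * k)) := by gcongr
      _ = _ := by ring
  have h2 := Finset.sum_le_sum h
  have e1 : 2 * (k + 1) - (0 + 1) = 2 * k + 1 := by omega
  simp only [e1, zero_add, pow_one, pow_zero, Nat.choose_one_right, Nat.choose_zero_right,
    Nat.sub_zero, one_mul, Nat.cast_one, mul_one]
  push_cast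
  linarith

/-- Either d² ≤ e x², and the first term dominates, or x² ≤ d²/e, and the second does. The free
weight e is tuned to n in the martingale bound. -/
theorem pow_mul_sq_le (k : ℕ) (x d : ℝ) {e : ℝ} (he : 0 < e) :
    x ^ (2 * k) * d ^ 2 ≤ e * x ^ (2 * (k + 1)) + (e⁻¹) ^ k * d ^ (2 * (k + 1)) := by
  have hx : ∀ y : ℝ, 0 ≤ y ^ (2 * (k + 1)) := fun y => (even_two_mul _).pow_nonneg y
  rcases le_total (d ^ 2) (e * x ^ 2) with h | h
  · have h1 : x ^ (2 * k) * d ^ 2 ≤ x ^ (2 * k) * (e * x ^ 2) :=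
      mul_le_mul_of_nonneg_left h ((even_two_mul _).pow_nonneg x)
    have h2 : x ^ (2 * k) * (e * x ^ 2) = e * x ^ (2 * (k + 1)) := by ring
    have h3 : 0 ≤ (e⁻¹) ^ k * d ^ (2 * (k + 1)) := mul_nonneg (by positivity) (hx d)
    linarith
  · have h0 : x ^ 2 ≤ e⁻¹ * d ^ 2 := by
      rw [inv_mul_eq_div, le_div_iff₀ he]
      linarith
    have h1 : x ^ (2 * k) ≤ (e⁻¹ * d ^ 2) ^ k := by
      rw [pow_mul]
      exact pow_le_pow_left₀ (sq_nonneg x) h0 k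
    have h2 : x ^ (2 * k) * d ^ 2 ≤ (e⁻¹ * d ^ 2) ^ k * d ^ 2 := by gcongr
    have h3 : (e⁻¹ * d ^ 2) ^ k * d ^ 2 = (e⁻¹) ^ k * d ^ (2 * (k + 1)) := by
      rw [mul_pow, ← pow_mul]; ring
    linarith [mul_nonneg he.le (hx x)]

variable {Ω : Type*} [m0 : MeasurableSpace Ω] {P : Measure Ω} [IsProbabilityMeasure P]

/-- A martingale difference sequence with bounded moments: `D t` is `F t`-measurable and orthogonal
to everything `F (t - 1)`-measurable. -/
structure IsMDS (P : Measure Ω) (F : ℤ → MeasurableSpace Ω) (D : ℤ → Ω → ℝ) : Prop where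
  meas : ∀ t, Measurable[F t] (D t)
  bdd : BddMoments P D
  -- `Z` need not be integrable: a divergent Bochner integral is 0, which agrees with the required
  -- value.
  orth : ∀ t (Z : Ω → ℝ), Measurable[F (t - 1)] Z → ∫ ω, Z ω * D t ω ∂P = 0

namespace IsMDS

variable {F : ℤ → MeasurableSpace Ω} {D D' : ℤ → Ω → ℝ}

/-- The partial sums `∑_{t=3}^n D t`. -/
def psum (D : ℤ → Ω → ℝ) (n : ℕ) (ω : Ω) : ℝ := ∑ t ∈ Finset.Icc 3 n, D t ω

omit m0 in
theorem psum_succ (D : ℤ → Ω → ℝ) {n : ℕ} (hn : 2 ≤ n) (ω : Ω) :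
    psum D (n + 1) ω = psum D n ω + D ((n : ℤ) + 1) ω := by
  rw [psum, Finset.sum_Icc_succ_top (by omega)]
  simp [psum]

omit [IsProbabilityMeasure P] in
theorem psum_meas (hF : Monotone F) (hD : IsMDS P F D) (n : ℕ) :
    Measurable[F n] (psum D n) := by
  refine Finset.measurable_fun_sum _ fun t ht => ?_
  exact (hD.meas t).mono (hF (by exact_mod_cast (Finset.mem_Icc.1 ht).2)) le_rfl

omit [IsProbabilityMeasure P] in
theorem single (hD : BddMoments P D) (t : ℤ) : BddMoments P (fun (_ : Unit) => D t) :=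
  hD.comp fun _ => t

theorem psum_bdd (hD : BddMoments P D) (n : ℕ) : BddMoments P (fun (_ : Unit) => psum D n) :=
  BddMoments.sum _ fun t _ => single hD t

/-- Moment bound for martingales (a Burkholder inequality with a simple proof). -/
theorem integral_psum_pow_le (hF : Monotone F) (hD : IsMDS P F D) (m : ℕ) :
    ∃ A : ℝ, ∀ n : ℕ, ∫ ω, psum D n ω ^ (2 * m) ∂P ≤ A * (n : ℝ) ^ m := by
  rcases m with _ | k
  · exact ⟨1, fun n => by simp⟩
  obtain ⟨C, hC⟩ := hD.bdd.bound (k + 1)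
  set c : ℝ := ∑ j ∈ Finset.range (2 * k + 1), ((2 * (k + 1)).choose (j + 2) : ℝ) with hc
  have hc0 : 0 ≤ c := Finset.sum_nonneg fun _ _ => Nat.cast_nonneg _
  have hC0 : 0 ≤ C := (integral_nonneg fun ω => (even_two_mul _).pow_nonneg _).trans (hC 0).2
  set c' : ℝ := c + 1 with hc'
  have hcp : 0 < c' := by linarith
  set G : ℝ := c' * ((2 * c') ^ k + 1) * C with hG
  have hG0 : 0 ≤ G := by positivity
  refine ⟨2 * G, fun n => ?_⟩
  rcases le_total n 2 with hn | hn
  · have : ∀ ω, psum D n ω = 0 := fun ω => by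
      rw [psum, Finset.Icc_eq_empty (by omega), Finset.sum_empty]
    simp only [this]
    rw [zero_pow (by omega)]
    simp only [integral_zero]
    positivity
  induction n, hn using Nat.le_induction with
  | base =>
    have : ∀ ω, psum D 2 ω = 0 := fun ω => by simp [psum]
    simp only [this]
    rw [zero_pow (by omega)]
    simp only [integral_zero]
    positivity
  | succ n hn ih =>
    have hn0 : (0 : ℝ) < n := by exact_mod_cast (by omega : 0 < n)
    have hn1 : (1 : ℝ) ≤ n := by exact_mod_cast (by omega : 1 ≤ n)
    have hMb := psum_bdd hD.bdd n
    have hDb := single hD.bdd ((n : ℤ) + 1)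
    set M := psum D n with hM
    set d := D ((n : ℤ) + 1) with hd
    have i1 : Integrable (fun ω => M ω ^ (2 * (k + 1))) P := (hMb.pow _).integrable ()
    have i2 : Integrable (fun ω => d ω ^ (2 * (k + 1))) P := (hDb.pow _).integrable ()
    have i3 : Integrable (fun ω => M ω ^ (2 * k + 1) * d ω) P :=
      ((hMb.pow _).mul hDb).integrable ()
    have i0 : Integrable (fun ω => (M ω + d ω) ^ (2 * (k + 1))) P :=
      ((hMb.add hDb).pow _).integrable ()
    have horth : ∫ ω, M ω ^ (2 * k + 1) * d ω ∂P = 0 := by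
      refine hD.orth ((n : ℤ) + 1) (fun ω => M ω ^ (2 * k + 1)) ?_
      rw [add_sub_cancel_right]
      exact (psum_meas hF hD n).pow_const _
    -- This weight makes the growth factor 1 + 1/(2n), so 2Gn^(k+1) gains Gn^k. The new increment
    -- costs at most another Gn^k, and n^(k+1) + n^k ≤ (n+1)^(k+1) closes the induction.
    set e : ℝ := (2 * c' * n)⁻¹ with he
    have hep : 0 < e := by positivity
    have hpt : ∀ ω, (M ω + d ω) ^ (2 * (k + 1)) ≤ (1 + c' * e) * M ω ^ (2 * (k + 1)) +
        2 * (k + 1) * (M ω ^ (2 * k + 1) * d ω) +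
        c' * ((e⁻¹) ^ k + 1) * d ω ^ (2 * (k + 1)) := fun ω => by
      have h1 := add_pow_even_le k (M ω) (d ω)
      have h2 := pow_mul_sq_le k (M ω) (d ω) hep
      rw [← hc] at h1
      have h3 : c * (M ω ^ (2 * k) * d ω ^ 2 + d ω ^ (2 * (k + 1))) ≤
          c' * (e * M ω ^ (2 * (k + 1)) + (e⁻¹) ^ k * d ω ^ (2 * (k + 1)) +
            d ω ^ (2 * (k + 1))) := by
        have : 0 ≤ M ω ^ (2 * k) * d ω ^ 2 + d ω ^ (2 * (k + 1)) :=
          add_nonneg (mul_nonneg ((even_two_mul _).pow_nonneg _) (sq_nonneg _))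
            ((even_two_mul _).pow_nonneg _)
        refine mul_le_mul (by linarith) (by linarith) this hcp.le
      linarith
    have h1 : ∫ ω, (M ω + d ω) ^ (2 * (k + 1)) ∂P ≤ (1 + c' * e) * (2 * G * (n : ℝ) ^ (k + 1)) +
        c' * ((e⁻¹) ^ k + 1) * C := by
      have i12 : Integrable (fun ω => (1 + c' * e) * M ω ^ (2 * (k + 1)) +
        2 * (k + 1) * (M ω ^ (2 * k + 1) * d ω)) P :=
        (i1.const_mul (1 + c' * e)).add (i3.const_mul (2 * ((k : ℝ) + 1)))
      refine (integral_mono (g := fun ω => (1 + c' * e) * M ω ^ (2 * (k + 1)) +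
        2 * (k + 1) * (M ω ^ (2 * k + 1) * d ω) + c' * ((e⁻¹) ^ k + 1) * d ω ^ (2 * (k + 1)))
        i0 (i12.add (i2.const_mul (c' * ((e⁻¹) ^ k + 1)))) hpt).trans ?_
      rw [integral_add i12 (i2.const_mul (c' * ((e⁻¹) ^ k + 1))),
        integral_add (i1.const_mul _) (i3.const_mul _), integral_const_mul, integral_const_mul,
        integral_const_mul, horth, mul_zero, add_zero]
      have := (hC ((n : ℤ) + 1)).2
      gcongr
    have h2 : (1 + c' * e) * (2 * G * (n : ℝ) ^ (k + 1)) = 2 * G * (n : ℝ) ^ (k + 1) +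
        G * (n : ℝ) ^ k := by
      rw [he, pow_succ]
      field_simp
    have h3 : c' * ((e⁻¹) ^ k + 1) * C ≤ G * (n : ℝ) ^ k := by
      have : (e⁻¹) ^ k + 1 ≤ ((2 * c') ^ k + 1) * (n : ℝ) ^ k := by
        rw [he, inv_inv, mul_pow, add_mul, one_mul]
        gcongr
        exact one_le_pow₀ hn1
      calc c' * ((e⁻¹) ^ k + 1) * C ≤ c' * (((2 * c') ^ k + 1) * (n : ℝ) ^ k) * C := by gcongr
        _ = G * (n : ℝ) ^ k := by rw [hG]; ring
    have h4 : (n : ℝ) ^ (k + 1) + (n : ℝ) ^ k ≤ ((n : ℝ) + 1) ^ (k + 1) := by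
      have : (n : ℝ) ^ k ≤ ((n : ℝ) + 1) ^ k := by gcongr; linarith
      rw [pow_succ, pow_succ]
      nlinarith
    simp only [psum_succ D hn]
    push_cast
    refine h1.trans ?_
    nlinarith

theorem momentO (hF : Monotone F) (hD : IsMDS P F D) :
    MomentO P 1 (fun n ω => (n : ℝ)⁻¹ * psum D n ω) := by
  refine ⟨fun n => (((psum_bdd hD.bdd n).aesm ()).const_mul _).const_mul _, fun m => ?_⟩
  obtain ⟨A, hA⟩ := integral_psum_pow_le hF hD m
  refine ⟨2 ^ m * A, fun n => ?_⟩
  have i1 : Integrable (fun ω => psum D n ω ^ (2 * m)) P :=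
    ((psum_bdd hD.bdd n).pow _).integrable ()
  have hA0 : 0 ≤ ∫ ω, psum D n ω ^ (2 * m) ∂P :=
    integral_nonneg fun ω => (even_two_mul _).pow_nonneg _
  have e : ∀ ω, (√((n : ℝ) + 1) ^ 1 * ((n : ℝ)⁻¹ * psum D n ω)) ^ (2 * m) =
      (((n : ℝ) + 1) * (n : ℝ)⁻¹ ^ 2) ^ m * psum D n ω ^ (2 * m) := fun ω => by
    rw [pow_one, mul_pow, mul_pow, pow_mul, Real.sq_sqrt (by positivity), mul_pow, ← pow_mul]
    ring
  simp only [e]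
  refine ⟨i1.const_mul _, ?_⟩
  rw [integral_const_mul]
  rcases Nat.eq_zero_or_pos n with rfl | hn
  · rcases m with _ | m
    · simpa using hA 1
    · have : 0 ≤ 2 ^ (m + 1) * A := by
        have h1 := (integral_nonneg fun ω => (even_two_mul (m + 1)).pow_nonneg _).trans (hA 1)
        simp only [Nat.cast_one, one_pow, mul_one] at h1
        positivity
      simpa using this
  · have hn1 : (1 : ℝ) ≤ n := by exact_mod_cast hn
    have hn0 : (0 : ℝ) < n := by linarith
    have hA1 := hA n
    calc (((n : ℝ) + 1) * (n : ℝ)⁻¹ ^ 2) ^ m * ∫ ω, psum D n ω ^ (2 * m) ∂P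
        ≤ (2 * n * (n : ℝ)⁻¹ ^ 2) ^ m * (A * (n : ℝ) ^ m) := by
          gcongr
          linarith
      _ = 2 ^ m * A := by
          rw [mul_left_comm, ← mul_pow]
          have : 2 * (n : ℝ) * (n : ℝ)⁻¹ ^ 2 * n = 2 := by field_simp
          rw [this]
          ring

/-- Orthogonality kills the mixed terms. The count is n - 2 because the sums start at t = 3. -/
theorem integral_psum_mul (hF : Monotone F) (hD : IsMDS P F D) (hD' : IsMDS P F D') {s : ℝ}
    (hs : ∀ t, ∫ ω, D t ω * D' t ω ∂P = s) {n : ℕ} (hn : 2 ≤ n) :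
    ∫ ω, psum D n ω * psum D' n ω ∂P = (n - 2) * s := by
  induction n, hn using Nat.le_induction with
  | base => simp [psum]
  | succ n hn ih =>
    have b1 := psum_bdd hD.bdd n
    have b2 := psum_bdd hD'.bdd n
    have d1 := single hD.bdd ((n : ℤ) + 1)
    have d2 := single hD'.bdd ((n : ℤ) + 1)
    have o1 : ∫ ω, psum D n ω * D' ((n : ℤ) + 1) ω ∂P = 0 :=
      hD'.orth _ _ (by rw [add_sub_cancel_right]; exact psum_meas hF hD n)
    have o2 : ∫ ω, psum D' n ω * D ((n : ℤ) + 1) ω ∂P = 0 :=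
      hD.orth _ _ (by rw [add_sub_cancel_right]; exact psum_meas hF hD' n)
    have e : ∀ ω, psum D (n + 1) ω * psum D' (n + 1) ω =
        (psum D n ω * psum D' n ω + psum D n ω * D' ((n : ℤ) + 1) ω) +
        (psum D' n ω * D ((n : ℤ) + 1) ω + D ((n : ℤ) + 1) ω * D' ((n : ℤ) + 1) ω) := fun ω => by
      rw [psum_succ D hn, psum_succ D' hn]
      ring
    have j1 := (b1.mul b2).integrable ()
    have j2 := (b1.mul d2).integrable ()
    have j3 := (b2.mul d1).integrable ()
    have j4 := (d1.mul d2).integrable ()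
    have j12 : Integrable (fun ω => psum D n ω * psum D' n ω +
      psum D n ω * D' ((n : ℤ) + 1) ω) P := j1.add j2
    have j34 : Integrable (fun ω => psum D' n ω * D ((n : ℤ) + 1) ω +
      D ((n : ℤ) + 1) ω * D' ((n : ℤ) + 1) ω) P := j3.add j4
    simp only [e]
    rw [integral_add j12 j34, integral_add j1 j2, integral_add j3 j4, ih, o1, o2, hs]
    push_cast
    ring

theorem tendsto_cov (hF : Monotone F) (hD : IsMDS P F D) (hD' : IsMDS P F D') {s : ℝ}
    (hs : ∀ t, ∫ ω, D t ω * D' t ω ∂P = s) :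
    Tendsto (fun n : ℕ => (n : ℝ) * ∫ ω, ((n : ℝ)⁻¹ * psum D n ω) * ((n : ℝ)⁻¹ * psum D' n ω) ∂P)
      atTop (𝓝 s) := by
  have h : Tendsto (fun n : ℕ => s - 2 * s * (n : ℝ)⁻¹) atTop (𝓝 (s - 2 * s * 0)) :=
    (tendsto_const_nhds).sub
      ((tendsto_inv_atTop_zero.comp tendsto_natCast_atTop_atTop).const_mul _)
  rw [mul_zero, sub_zero] at h
  refine h.congr' ?_
  filter_upwards [eventually_ge_atTop 2] with n hn
  have hn0 : (0 : ℝ) < n := by exact_mod_cast (by omega : 0 < n)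
  have e : ∀ ω, ((n : ℝ)⁻¹ * psum D n ω) * ((n : ℝ)⁻¹ * psum D' n ω) =
      (n : ℝ)⁻¹ ^ 2 * (psum D n ω * psum D' n ω) := fun ω => by ring
  simp only [e]
  rw [integral_const_mul, integral_psum_mul hF hD hD' hs hn]
  field_simp

end IsMDS

end MartingaleMoments

/-! ### Boundary terms of shifted sums -/

section Boundary

variable {Ω : Type*} [MeasurableSpace Ω] {P : Measure Ω}

/-- Uniform moment bounds ignore finitely many indices, so identities valid only for large n are
enough. -/
theorem BddMoments.of_eq_of_le {X Y : ℕ → Ω → ℝ} (N : ℕ) (hY : BddMoments P Y)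
    (h : ∀ n, N ≤ n → X n = Y n) (hX : ∀ n, BddMoments P (fun _ : Unit => X n)) :
    BddMoments P X := by
  refine ⟨fun n => (hX n).aesm (), fun m => ?_⟩
  obtain ⟨C, hC⟩ := hY.bound m
  refine ⟨max C (∑ i ∈ Finset.range N, ∫ ω, X i ω ^ (2 * m) ∂P), fun n => ?_⟩
  have hi : Integrable (fun ω => X n ω ^ (2 * m)) P := by
    obtain ⟨_, hB⟩ := (hX n).bound m
    exact (hB ()).1
  refine ⟨hi, ?_⟩
  rcases le_or_gt N n with hn | hn
  · rw [h n hn]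
    exact (hC n).2.trans (le_max_left _ _)
  · refine le_trans ?_ (le_max_right _ _)
    exact Finset.single_le_sum (f := fun i => ∫ ω, X i ω ^ (2 * m) ∂P)
      (fun i _ => integral_nonneg fun ω => (even_two_mul m).pow_nonneg _) (Finset.mem_range.2 hn)

variable [IsProbabilityMeasure P]

theorem MomentO.of_eq_of_le {X Y : ℕ → Ω → ℝ} {k : ℕ} (N : ℕ) (hY : MomentO P k Y)
    (h : ∀ n, N ≤ n → X n = Y n) (hX : ∀ n, BddMoments P (fun _ : Unit => X n)) :
    MomentO P k X := by
  refine BddMoments.of_eq_of_le N hY (fun n hn => ?_) fun n => (hX n).smul _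
  rw [h n hn]

theorem bddMoments_sum_single {f : ℤ → Ω → ℝ} (hf : BddMoments P f) (s : Finset ℕ) (m : ℤ) :
    BddMoments P (fun (_ : Unit) ω => ∑ t ∈ s, f (t - m) ω) :=
  BddMoments.sum _ fun t _ => hf.comp fun _ => (t : ℤ) - m

/-- Shifting the window of summation changes sums by boundary terms only. -/
theorem bddMoments_shift {f : ℤ → Ω → ℝ} (hf : BddMoments P f) (i m : ℕ) :
    BddMoments P (fun (n : ℕ) ω => ∑ t ∈ Finset.Icc i n, f ((t : ℤ) - m) ω -
      ∑ t ∈ Finset.Icc 1 n, f t ω) := by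
  have hs : ∀ (i : ℕ) (m : ℤ) (n : ℕ), BddMoments P
      (fun (_ : Unit) ω => ∑ t ∈ Finset.Icc i n, f ((t : ℤ) - m) ω) := fun i m n =>
    bddMoments_sum_single hf _ m
  have hs1 : ∀ n : ℕ, BddMoments P
      (fun (_ : Unit) ω => ∑ t ∈ Finset.Icc 1 n, f (t : ℤ) ω) := fun n => by
    simpa using hs 1 0 n
  induction m with
  | zero =>
    refine BddMoments.of_eq_of_le (i + 1) (Y := fun _ ω => ∑ t ∈ Finset.Icc i (i + 1), f (t - 0) ω -
      ∑ t ∈ Finset.Icc 1 (i + 1), f (t - 0) ω) (((hs i 0 (i + 1)).sub (hs 1 0 (i + 1))).comp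
        fun _ => ()) (fun n hn => ?_) fun n => by simpa using (hs i 0 n).sub (hs1 n)
    funext ω
    induction n, hn using Nat.le_induction with
    | base => simp
    | succ n hn ih =>
      rw [Finset.sum_Icc_succ_top (by omega), Finset.sum_Icc_succ_top (by omega), ← ih]
      simp
  | succ m ih =>
    -- One further shift gains a term at the left end of the window and loses one at the right end.
    have hb : BddMoments P (fun (n : ℕ) ω => f ((i : ℤ) - (m + 1)) ω - f ((n : ℤ) - m) ω) :=
      (hf.comp fun _ => (i : ℤ) - (m + 1)).sub (hf.comp fun n : ℕ => (n : ℤ) - m)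
    refine BddMoments.of_eq_of_le i (ih.add hb) (fun n hn => ?_) fun n => by
      simpa using (hs i (m + 1) n).sub (hs1 n)
    funext ω
    have : ∑ t ∈ Finset.Icc i n, f ((t : ℤ) - (m + 1)) ω = ∑ t ∈ Finset.Icc i n, f ((t : ℤ) - m) ω +
        (f ((i : ℤ) - (m + 1)) ω - f ((n : ℤ) - m) ω) := by
      induction n, hn using Nat.le_induction with
      | base => simp
      | succ n hn ih2 =>
        rw [Finset.sum_Icc_succ_top (by omega), Finset.sum_Icc_succ_top (by omega), ih2]
        push_cast
        rw [show (n : ℤ) + 1 - (m + 1) = n - m by ring]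
        ring
    push_cast
    rw [this]
    ring

end Boundary

/-! ### Causal AR(2) processes and their driving martingales -/

section CausalProcess

variable {Ω : Type*} [MeasurableSpace Ω] {P : Measure Ω}

/-- A centred causal AR(2) process with bounded moments, adapted to the filtration `F`, with
autocovariance function `γ` and innovations `a`. -/
structure IsCausalAR2 (P : Measure Ω) (φ₁ φ₂ : ℝ) (v : ℝ≥0) (F : ℤ → MeasurableSpace Ω)
    (γ : ℤ → ℝ) (a y : ℤ → Ω → ℝ) : Prop where
  mono : Monotone F
  le : ∀ t, F t ≤ ‹MeasurableSpace Ω›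
  y_meas : ∀ t, Measurable[F t] (y t)
  recursion : ∀ t ω, y t ω = φ₁ * y (t - 1) ω + φ₂ * y (t - 2) ω + a t ω
  indep_future : ∀ t, Indep (F t)
    (⨆ s ∈ Set.Ioi t, MeasurableSpace.comap (a s) inferInstance) P
  law : ∀ t, HasLaw (a t) (gaussianReal 0 v) P
  bdd : BddMoments P y
  mean : ∀ t, ∫ ω, y t ω ∂P = 0
  cov : ∀ s t, ∫ ω, y s ω * y t ω ∂P = γ (s - t)

namespace IsCausalAR2

variable [IsProbabilityMeasure P] {φ₁ φ₂ : ℝ} {v : ℝ≥0} {F : ℤ → MeasurableSpace Ω} {γ : ℤ → ℝ}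
  {a y : ℤ → Ω → ℝ}

omit [IsProbabilityMeasure P] in
theorem indep (h : IsCausalAR2 P φ₁ φ₂ v F γ a y) (t : ℤ) (Z : Ω → ℝ)
    (hZ : Measurable[F (t - 1)] Z) : IndepFun Z (a t) P := by
  rw [IndepFun_iff_Indep]
  refine indep_of_indep_of_le_left (indep_of_indep_of_le_right (h.indep_future (t - 1)) ?_)
    hZ.comap_le
  exact le_iSup₂_of_le t (Set.mem_Ioi.2 (by omega)) le_rfl

theorem a_bdd (h : IsCausalAR2 P φ₁ φ₂ v F γ a y) : BddMoments P a := by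
  refine ((h.bdd.sub ((h.bdd.comp fun t => t - 1).smul φ₁)).sub
    ((h.bdd.comp fun t => t - 2).smul φ₂)).congr fun t => Eventually.of_forall fun ω => ?_
  have := h.recursion t ω
  simp only
  linarith

omit [IsProbabilityMeasure P] in
theorem y_meas' (h : IsCausalAR2 P φ₁ φ₂ v F γ a y) {s t : ℤ} (hst : s ≤ t) :
    Measurable[F t] (y s) := (h.y_meas s).mono (h.mono hst) le_rfl

omit [IsProbabilityMeasure P] in
theorem a_meas (h : IsCausalAR2 P φ₁ φ₂ v F γ a y) (t : ℤ) : Measurable[F t] (a t) := by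
  have e : a t = fun ω => y t ω - φ₁ * y (t - 1) ω - φ₂ * y (t - 2) ω := by
    funext ω
    have := h.recursion t ω
    linarith
  rw [e]
  exact ((h.y_meas t).sub ((h.y_meas' (by omega)).const_mul φ₁)).sub
    ((h.y_meas' (by omega)).const_mul φ₂)

omit [IsProbabilityMeasure P] in
theorem integral_comp_a (h : IsCausalAR2 P φ₁ φ₂ v F γ a y) {f : ℝ → ℝ} (hf : Measurable f)
    (t : ℤ) : ∫ ω, f (a t ω) ∂P = ∫ x, f x ∂(gaussianReal 0 v) := by
  rw [← (h.law t).map_eq, integral_map (h.law t).aemeasurable hf.aestronglyMeasurable]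

omit [IsProbabilityMeasure P] in
theorem integral_mul_comp_a (h : IsCausalAR2 P φ₁ φ₂ v F γ a y) {f : ℝ → ℝ} (hf : Measurable f)
    {t : ℤ} {Z : Ω → ℝ} (hZ : Measurable[F (t - 1)] Z) :
    ∫ ω, Z ω * f (a t ω) ∂P = (∫ ω, Z ω ∂P) * ∫ x, f x ∂(gaussianReal 0 v) := by
  have h1 : IndepFun Z (fun ω => f (a t ω)) P := (h.indep t Z hZ).comp measurable_id hf
  rw [← h.integral_comp_a hf t]
  exact h1.integral_fun_mul_eq_mul_integral (hZ.mono (h.le _) le_rfl).aestronglyMeasurable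
    (hf.comp ((h.a_meas t).mono (h.le _) le_rfl)).aestronglyMeasurable

omit [IsProbabilityMeasure P] in
-- The factor f(a t) has mean zero and is independent of everything known at time t - 1, including
-- the multiplier Y t.
theorem isMDS (h : IsCausalAR2 P φ₁ φ₂ v F γ a y) {f : ℝ → ℝ} (hf : Measurable f)
    (hf0 : ∫ x, f x ∂(gaussianReal 0 v) = 0) (hfb : BddMoments P fun t ω => f (a t ω))
    {Y : ℤ → Ω → ℝ} (hY : ∀ t, Measurable[F (t - 1)] (Y t)) (hYb : BddMoments P Y) :
    IsMDS P F (fun t ω => Y t ω * f (a t ω)) where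
  meas t := ((hY t).mono (h.mono (by omega)) le_rfl).mul (hf.comp (h.a_meas t))
  bdd := hYb.mul hfb
  orth t Z hZ := by
    have := h.integral_mul_comp_a hf (t := t) (Z := fun ω => Z ω * Y t ω) (hZ.mul (hY t))
    simpa only [hf0, mul_zero, mul_assoc] using this

theorem integral_sq_gaussian (v : ℝ≥0) : ∫ x, x ^ 2 ∂(gaussianReal 0 v) = v := by
  have h := variance_fun_id_gaussianReal (μ := 0) (v := v)
  rw [variance_of_integral_eq_zero (by fun_prop) (by simp)] at h
  exact h

theorem integrable_sq_gaussian (v : ℝ≥0) : Integrable (fun x : ℝ => x ^ 2) (gaussianReal 0 v) :=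
  (memLp_id_gaussianReal (μ := 0) (v := v) 2).integrable_sq

theorem integral_sq_sub_gaussian (v : ℝ≥0) : ∫ x, (x ^ 2 - (v : ℝ)) ∂(gaussianReal 0 v) = 0 := by
  rw [integral_sub (integrable_sq_gaussian v) (integrable_const _), integral_sq_gaussian]
  simp

/-- The martingale difference sequences driving the sample autocovariances. -/
def incr (v : ℝ≥0) (a y : ℤ → Ω → ℝ) : Fin 3 → ℤ → Ω → ℝ :=
  -- The factor 1 in the last entry gives all three the shape Y t · f(a t) required by `isMDS`.
  ![fun t ω => y (t - 1) ω * a t ω, fun t ω => y (t - 2) ω * a t ω, fun t ω => 1 * (a t ω ^ 2 - v)]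

theorem incr_isMDS (h : IsCausalAR2 P φ₁ φ₂ v F γ a y) : ∀ i, IsMDS P F (incr v a y i) := by
  have h2 : BddMoments P (fun t ω => a t ω ^ 2 - (v : ℝ)) :=
    (h.a_bdd.pow 2).sub (BddMoments.const (c := fun _ => (v : ℝ)) fun _ => le_rfl)
  intro i
  fin_cases i
  · exact h.isMDS (f := id) measurable_id (by simp) h.a_bdd (Y := fun t => y (t - 1))
      (fun t => h.y_meas _) (h.bdd.comp _)
  · exact h.isMDS (f := id) measurable_id (by simp) h.a_bdd (Y := fun t => y (t - 2))
      (fun t => h.y_meas' (by omega)) (h.bdd.comp _)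
  · exact h.isMDS (f := fun x => x ^ 2 - (v : ℝ)) (by fun_prop) (integral_sq_sub_gaussian v) h2
      (Y := fun _ _ => 1) (fun t => measurable_const)
      (BddMoments.const (c := fun _ => 1) fun _ => le_rfl)

theorem a_isMDS (h : IsCausalAR2 P φ₁ φ₂ v F γ a y) : IsMDS P F a := by
  simpa using h.isMDS (f := id) measurable_id (by simp) h.a_bdd (Y := fun _ _ => 1)
      (fun t => measurable_const) (BddMoments.const (c := fun _ => 1) fun _ => le_rfl)

/-- The limiting covariance matrix of the normalized martingales. -/
noncomputable def covMatrix (v : ℝ≥0) (γ : ℤ → ℝ) : Fin 3 → Fin 3 → ℝ :=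
  ![![v * γ 0, v * γ 1, 0], ![v * γ 1, v * γ 0, 0],
    ![0, 0, ∫ x, (x ^ 2 - (v : ℝ)) ^ 2 ∂(gaussianReal 0 v)]]

omit [IsProbabilityMeasure P] in
theorem cov_neg (h : IsCausalAR2 P φ₁ φ₂ v F γ a y) (k : ℤ) : γ (-k) = γ k := by
  have h1 := h.cov 0 k
  have h2 := h.cov k 0
  simp only [zero_sub, sub_zero] at h1 h2
  rw [← h1, ← h2]
  congr 1 with ω
  ring

omit [IsProbabilityMeasure P] in
-- Past and present factorize by independence. The mixed entries with a² - v vanish because y has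
-- mean zero.
theorem incr_cov (h : IsCausalAR2 P φ₁ φ₂ v F γ a y) (i j : Fin 3) (t : ℤ) :
    ∫ ω, incr v a y i t ω * incr v a y j t ω ∂P = covMatrix v γ i j := by
  have key : ∀ r s : ℤ, 1 ≤ r → 1 ≤ s →
      ∫ ω, (y (t - r) ω * a t ω) * (y (t - s) ω * a t ω) ∂P = v * γ (s - r) := fun r s hr hs => by
    have h1 := h.integral_mul_comp_a (f := fun x => x ^ 2) (by fun_prop) (t := t)
      (Z := fun ω => y (t - r) ω * y (t - s) ω)
      ((h.y_meas' (by omega)).mul (h.y_meas' (by omega)))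
    rw [integral_sq_gaussian, h.cov, show t - r - (t - s) = s - r by ring] at h1
    rw [mul_comm, ← h1]
    congr 1 with ω
    ring
  have key2 : ∀ r : ℤ, 1 ≤ r →
      ∫ ω, (y (t - r) ω * a t ω) * (1 * (a t ω ^ 2 - v)) ∂P = 0 := fun r hr => by
    have h1 := h.integral_mul_comp_a (f := fun x => x * (x ^ 2 - v)) (by fun_prop) (t := t)
      (Z := fun ω => y (t - r) ω) (h.y_meas' (by omega))
    rw [h.mean, zero_mul] at h1
    rw [← h1]
    congr 1 with ω
    ring
  have key2' : ∀ r : ℤ, 1 ≤ r →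
      ∫ ω, (1 * (a t ω ^ 2 - v)) * (y (t - r) ω * a t ω) ∂P = 0 := fun r hr => by
    rw [← key2 r hr]
    congr 1 with ω
    ring
  fin_cases i <;> fin_cases j <;> simp only [incr, covMatrix]
  · simpa using key 1 1 le_rfl le_rfl
  · simpa using key 1 2 le_rfl (by norm_num)
  · simpa using key2 1 le_rfl
  · have := key 2 1 (by norm_num) le_rfl
    rw [show (1 : ℤ) - 2 = -1 by norm_num, h.cov_neg] at this
    simpa using this
  · simpa using key 2 2 (by norm_num) (by norm_num)
  · simpa using key2 2 (by norm_num)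
  · simpa using key2' 1 le_rfl
  · simpa using key2' 2 (by norm_num)
  · have := h.integral_comp_a (f := fun x => (x ^ 2 - (v : ℝ)) ^ 2) (by fun_prop) t
    simpa [sq] using this

/-- The normalized martingales driving the sample autocovariances. -/
noncomputable def fluct (v : ℝ≥0) (a y : ℤ → Ω → ℝ) (i : Fin 3) (n : ℕ) (ω : Ω) : ℝ :=
  (n : ℝ)⁻¹ * IsMDS.psum (incr v a y i) n ω

theorem isFluctuation (h : IsCausalAR2 P φ₁ φ₂ v F γ a y) :
    IsFluctuation P (fluct v a y) (covMatrix v γ) where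
  order i := (h.incr_isMDS i).momentO h.mono
  cov i j := (h.incr_isMDS i).tendsto_cov h.mono (h.incr_isMDS j) (h.incr_cov i j)

theorem psum_bdd (h : IsCausalAR2 P φ₁ φ₂ v F γ a y) (i : Fin 3) (n : ℕ) :
    BddMoments P (fun _ : Unit => IsMDS.psum (incr v a y i) n) :=
  IsMDS.psum_bdd (h.incr_isMDS i).bdd n

end IsCausalAR2

end CausalProcess

/-! ### Jets of the mean-corrected autocovariances -/

section AutocovExpansion

variable {Ω : Type*} [MeasurableSpace Ω] {P : Measure Ω}

namespace IsCausalAR2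

variable [IsProbabilityMeasure P] {φ₁ φ₂ : ℝ} {v : ℝ≥0} {F : ℤ → MeasurableSpace Ω} {γ : ℤ → ℝ}
  {a y : ℤ → Ω → ℝ}

/-- The normalized sample mean. -/
noncomputable def smean (y : ℤ → Ω → ℝ) (n : ℕ) (ω : Ω) : ℝ := sampleMean (fun t => y t ω) n

omit [MeasurableSpace Ω] in
theorem smean_eq (y : ℤ → Ω → ℝ) (n : ℕ) (ω : Ω) :
    smean y n ω = (n : ℝ)⁻¹ * ∑ t ∈ Finset.Icc 1 n, y t ω := by
  rw [smean, sampleMean, div_eq_inv_mul]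

theorem bdd_sum (h : IsCausalAR2 P φ₁ φ₂ v F γ a y) (n : ℕ) :
    BddMoments P (fun (_ : Unit) ω => ∑ t ∈ Finset.Icc 1 n, y t ω) := by
  simpa using bddMoments_sum_single h.bdd (Finset.Icc 1 n) 0

theorem smean_bdd (h : IsCausalAR2 P φ₁ φ₂ v F γ a y) (n : ℕ) :
    BddMoments P (fun _ : Unit => smean y n) :=
  ((h.bdd_sum n).smul (n : ℝ)⁻¹).congr fun _ => Eventually.of_forall fun ω =>
    (smean_eq y n ω).symm

/-- The sample mean is, up to boundary terms, proportional to the mean of the innovations. -/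
theorem bdd_sum_sub_psum (h : IsCausalAR2 P φ₁ φ₂ v F γ a y) :
    BddMoments P (fun (n : ℕ) ω => (1 - φ₁ - φ₂) * ∑ t ∈ Finset.Icc 1 n, y t ω -
      IsMDS.psum a n ω) := by
  have h0 := bddMoments_shift h.bdd 3 0
  have h1 := bddMoments_shift h.bdd 3 1
  have h2 := bddMoments_shift h.bdd 3 2
  refine (((h1.smul φ₁).add (h2.smul φ₂)).sub h0).congr fun n => Eventually.of_forall fun ω => ?_
  have e : IsMDS.psum a n ω = ∑ t ∈ Finset.Icc 3 n, y t ω -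
      φ₁ * ∑ t ∈ Finset.Icc 3 n, y ((t : ℤ) - 1) ω -
      φ₂ * ∑ t ∈ Finset.Icc 3 n, y ((t : ℤ) - 2) ω := by
    rw [IsMDS.psum, Finset.mul_sum, Finset.mul_sum, ← Finset.sum_sub_distrib,
      ← Finset.sum_sub_distrib]
    refine Finset.sum_congr rfl fun t _ => ?_
    linarith [h.recursion t ω]
  simp only [e, Nat.cast_one, Nat.cast_ofNat, Nat.cast_zero, sub_zero]
  ring

theorem smean_split (h : IsCausalAR2 P φ₁ φ₂ v F γ a y) (hκ : 1 - φ₁ - φ₂ ≠ 0) :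
    MomentO P 2 (fun n ω => smean y n ω - (1 - φ₁ - φ₂)⁻¹ * ((n : ℝ)⁻¹ * IsMDS.psum a n ω)) := by
  refine ((MomentO.inv_mul h.bdd_sum_sub_psum).smul (1 - φ₁ - φ₂)⁻¹).congr fun n =>
    Eventually.of_forall fun ω => ?_
  simp only [smean_eq]
  field_simp

theorem smean_order (h : IsCausalAR2 P φ₁ φ₂ v F γ a y) (hκ : 1 - φ₁ - φ₂ ≠ 0) :
    MomentO P 1 (smean y) := by
  refine (((h.smean_split hκ).mono one_le_two).add
    ((h.a_isMDS.momentO h.mono).smul (1 - φ₁ - φ₂)⁻¹)).congr fun n =>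
    Eventually.of_forall fun ω => ?_
  ring

/-- To leading order the sample mean is (1 - φ₁ - φ₂)⁻¹ times the average innovation, whose variance
is asymptotic to v/n. This is the price of estimating μ. -/
theorem tendsto_smean_sq (h : IsCausalAR2 P φ₁ φ₂ v F γ a y) (hκ : 1 - φ₁ - φ₂ ≠ 0) :
    Tendsto (fun n : ℕ => (n : ℝ) * ∫ ω, smean y n ω ^ 2 ∂P) atTop
      (𝓝 (v / (1 - φ₁ - φ₂) ^ 2)) := by
  set c := (1 - φ₁ - φ₂)⁻¹ with hc
  have hva : ∀ t, ∫ ω, a t ω * a t ω ∂P = v := fun t => by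
    have := h.integral_comp_a (f := fun x => x ^ 2) (by fun_prop) t
    rw [integral_sq_gaussian] at this
    rw [← this]
    congr 1 with ω
    ring
  have hA : MomentO P 1 (fun n ω => (n : ℝ)⁻¹ * IsMDS.psum a n ω) := h.a_isMDS.momentO h.mono
  have h1 := (h.a_isMDS.tendsto_cov h.mono h.a_isMDS hva).const_mul (c ^ 2)
  have hR : MomentO P 3 (fun n ω => (smean y n ω - c * ((n : ℝ)⁻¹ * IsMDS.psum a n ω)) *
      (smean y n ω + c * ((n : ℝ)⁻¹ * IsMDS.psum a n ω))) :=
    (h.smean_split hκ).mul ((h.smean_order hκ).add (hA.smul c))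
  have h2 : Tendsto (fun n : ℕ => (n : ℝ) * ∫ ω, c ^ 2 * (((n : ℝ)⁻¹ * IsMDS.psum a n ω) *
      ((n : ℝ)⁻¹ * IsMDS.psum a n ω)) ∂P) atTop (𝓝 (c ^ 2 * v)) := by
    refine h1.congr fun n => ?_
    rw [integral_const_mul]
    ring
  have h3 := tendsto_integral_add_momentO
    (fun n => ((hA.mul hA).bdd.integrable n).const_mul _) h2 hR
  have e : (v : ℝ) / (1 - φ₁ - φ₂) ^ 2 = c ^ 2 * v := by
    rw [hc]
    field_simp
  rw [e]
  refine h3.congr fun n => ?_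
  congr 2 with ω
  ring

/-- The sum of lagged products `∑_{t=1}^n y_t y_{t-k}`. -/
def lagSum (y : ℤ → Ω → ℝ) (k : ℕ) (n : ℕ) (ω : Ω) : ℝ :=
  ∑ t ∈ Finset.Icc 1 n, y t ω * y ((t : ℤ) - k) ω

theorem bdd_window_sub_lagSum (h : IsCausalAR2 P φ₁ φ₂ v F γ a y) (i m k : ℕ) :
    BddMoments P (fun (n : ℕ) ω => ∑ t ∈ Finset.Icc i n,
      y ((t : ℤ) - m) ω * y ((t : ℤ) - m - k) ω - lagSum y k n ω) :=
  bddMoments_shift (f := fun t ω => y t ω * y (t - k) ω) (h.bdd.mul (h.bdd.comp fun t => t - k)) i m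

theorem bdd_window (h : IsCausalAR2 P φ₁ φ₂ v F γ a y) (i m k n : ℕ) :
    BddMoments P (fun (_ : Unit) ω => ∑ t ∈ Finset.Icc i n,
      y ((t : ℤ) - m) ω * y ((t : ℤ) - m - k) ω) :=
  bddMoments_sum_single (f := fun t ω => y t ω * y (t - k) ω)
    (h.bdd.mul (h.bdd.comp fun t => t - k)) _ m

/-- `lagSum k` is `n * γ k` plus a linear combination of the driving martingales, up to boundary
terms. -/
def LagExpansion (P : Measure Ω) (v : ℝ≥0) (γ : ℤ → ℝ) (a y : ℤ → Ω → ℝ) (k : ℕ)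
    (l : Fin 3 → ℝ) : Prop :=
  BddMoments P (fun (n : ℕ) ω => lagSum y k n ω - n * γ k - ∑ i, l i * IsMDS.psum (incr v a y i) n ω)

/-- Mean-corrected versus uncorrected sums of lagged products. -/
theorem sum_mean_corrected (x : ℤ → ℝ) (c : ℝ) {i n : ℕ} (hi : i ≤ n + 1) (m k : ℕ) :
    ∑ t ∈ Finset.Icc i n, (x ((t : ℤ) - m) - c) * (x ((t : ℤ) - (m + k : ℕ)) - c) =
      ∑ t ∈ Finset.Icc i n, x ((t : ℤ) - m) * x ((t : ℤ) - m - k) -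
      c * (∑ t ∈ Finset.Icc i n, x ((t : ℤ) - m) +
        ∑ t ∈ Finset.Icc i n, x ((t : ℤ) - (m + k : ℕ))) + ((n : ℝ) + 1 - i) * c ^ 2 := by
  have hcard : ((n : ℝ) + 1 - i) * c ^ 2 = ∑ _t ∈ Finset.Icc i n, c ^ 2 := by
    rw [Finset.sum_const, Nat.card_Icc, nsmul_eq_mul, Nat.cast_sub hi]
    push_cast
    ring
  rw [hcard, mul_add, Finset.mul_sum, Finset.mul_sum, ← Finset.sum_add_distrib,
    ← Finset.sum_sub_distrib, ← Finset.sum_add_distrib]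
  refine Finset.sum_congr rfl fun t _ => ?_
  push_cast
  rw [show (t : ℤ) - (m + k) = t - m - k by ring]
  ring

theorem autocov_bdd (h : IsCausalAR2 P φ₁ φ₂ v F γ a y) (m k i n : ℕ) :
    BddMoments P (fun (_ : Unit) ω => autocov (fun t => y t ω) n m k i) := by
  have h1 : BddMoments P (fun (_ : Unit) ω => ∑ t ∈ Finset.Icc i n,
      (y ((t : ℤ) - m) ω - smean y n ω) * (y ((t : ℤ) - k) ω - smean y n ω)) :=
    BddMoments.sum _ fun t _ => ((h.bdd.comp fun _ => _).sub (h.smean_bdd n)).mul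
      ((h.bdd.comp fun _ => _).sub (h.smean_bdd n))
  refine (h1.smul (n : ℝ)⁻¹).congr fun _ => Eventually.of_forall fun ω => ?_
  simp only [autocov, div_eq_inv_mul, smean]

/-- The window starting at i has n + 1 - i products, which explains (1 - i)γ k in the bias. Mean
correction subtracts the squared sample mean, which is O(1/n) and hence absent from the linear part.
-/
theorem autocov_hasJet (h : IsCausalAR2 P φ₁ φ₂ v F γ a y) (hκ : 1 - φ₁ - φ₂ ≠ 0) {k : ℕ}
    {l : Fin 3 → ℝ} (hl : LagExpansion P v γ a y k l) (m i : ℕ) :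
    HasJet P (fluct v a y) (fun n ω => autocov (fun t => y t ω) n m (m + k) i) (γ k) l
      ((1 - i) * γ k - v / (1 - φ₁ - φ₂) ^ 2) := by
  set W : ℕ → Ω → ℝ := fun n ω => ∑ t ∈ Finset.Icc i n,
    y ((t : ℤ) - m) ω * y ((t : ℤ) - m - k) ω with hW
  set e₁ : ℕ → Ω → ℝ := fun n ω => ∑ t ∈ Finset.Icc i n, y ((t : ℤ) - m) ω -
    ∑ t ∈ Finset.Icc 1 n, y t ω with he₁
  set e₂ : ℕ → Ω → ℝ := fun n ω => ∑ t ∈ Finset.Icc i n, y ((t : ℤ) - (m + k : ℕ)) ω -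
    ∑ t ∈ Finset.Icc 1 n, y t ω with he₂
  have b₁ : BddMoments P e₁ := bddMoments_shift h.bdd i m
  have b₂ : BddMoments P e₂ := bddMoments_shift h.bdd i (m + k)
  have hm1 := h.smean_order hκ
  -- Everything beyond W/n minus the squared sample mean: boundary terms times mean/n, and (1 - i)
  -- times mean²/n. Both have order at least 3.
  set Q : ℕ → Ω → ℝ := fun n ω => -(smean y n ω * ((n : ℝ)⁻¹ * (e₁ n ω + e₂ n ω))) +
    smean y n ω * (smean y n ω * ((n : ℝ)⁻¹ * (1 - i))) with hQ
  have hQ3 : MomentO P 3 Q :=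
    (hm1.mul (MomentO.inv_mul (b₁.add b₂))).neg.add ((hm1.mul (hm1.mul (MomentO.inv_mul
      (BddMoments.const (P := P) (c := fun _ : ℕ => 1 - (i : ℝ)) fun _ => le_rfl)))).mono
      (by norm_num))
  have hexp : ∀ n : ℕ, i + 1 ≤ n → ∀ ω, autocov (fun t => y t ω) n m (m + k) i =
      (n : ℝ)⁻¹ * W n ω - smean y n ω ^ 2 + Q n ω := fun n hn ω => by
    have hn0 : (n : ℝ) ≠ 0 := by
      have : 0 < n := by omega
      positivity
    have hs : ∑ t ∈ Finset.Icc 1 n, y t ω = n * smean y n ω := by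
      rw [smean_eq]
      field_simp
    have hA : ∑ t ∈ Finset.Icc i n, y ((t : ℤ) - m) ω = e₁ n ω + n * smean y n ω := by
      simp only [he₁, hs]
      ring
    have hB : ∑ t ∈ Finset.Icc i n, y ((t : ℤ) - (m + k : ℕ)) ω = e₂ n ω + n * smean y n ω := by
      simp only [he₂, hs]
      ring
    have := sum_mean_corrected (fun t => y t ω) (smean y n ω) (by omega : i ≤ n + 1) m k
    rw [autocov, show sampleMean (fun t => y t ω) n = smean y n ω from rfl, this, hA, hB]
    simp only [hQ, hW]
    field_simp
    ring
  constructor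
  · have h1 : MomentO P 2 (fun n ω => (n : ℝ)⁻¹ * ((W n ω - lagSum y k n ω) +
        (lagSum y k n ω - n * γ k - ∑ i, l i * IsMDS.psum (incr v a y i) n ω))) :=
      MomentO.inv_mul ((h.bdd_window_sub_lagSum i m k).add hl)
    have h2 : MomentO P 2 (fun n ω => smean y n ω * smean y n ω) := hm1.mul hm1
    refine MomentO.of_eq_of_le (i + 1) ((h1.sub h2).add (hQ3.mono (by norm_num)))
      (fun n hn => ?_) fun n => ?_
    · funext ω
      have hn0 : (n : ℝ) ≠ 0 := by
        have : 0 < n := by omega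
        positivity
      have e3 : ∑ i, l i * fluct v a y i n ω =
          (n : ℝ)⁻¹ * ∑ i, l i * IsMDS.psum (incr v a y i) n ω := by
        rw [Finset.mul_sum]
        exact Finset.sum_congr rfl fun j _ => by rw [fluct]; ring
      rw [hexp n hn ω, e3]
      field_simp
      ring
    · refine ((h.autocov_bdd m (m + k) i n).sub (BddMoments.const (c := fun _ => γ k)
        fun _ => le_rfl)).sub (BddMoments.sum _ fun j _ => BddMoments.smul ?_ _)
      exact (h.psum_bdd j n).smul _
  · have h1 : Tendsto (fun n : ℕ => (1 - i) * γ k - (n : ℝ) * ∫ ω, smean y n ω ^ 2 ∂P) atTop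
        (𝓝 ((1 - i) * γ k - v / (1 - φ₁ - φ₂) ^ 2)) :=
      tendsto_const_nhds.sub (h.tendsto_smean_sq hκ)
    have h2 := h1.add hQ3.tendsto_integral
    rw [add_zero] at h2
    refine h2.congr' ?_
    filter_upwards [eventually_ge_atTop (i + 1)] with n hn
    have hn0 : (n : ℝ) ≠ 0 := by
      have : 0 < n := by omega
      positivity
    have iW : Integrable (fun ω => (n : ℝ)⁻¹ * W n ω) P :=
      ((h.bdd_window i m k n).integrable ()).const_mul _
    have iS : Integrable (fun ω => smean y n ω ^ 2) P := ((h.smean_bdd n).pow 2).integrable ()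
    have iWS : Integrable (fun ω => (n : ℝ)⁻¹ * W n ω - smean y n ω ^ 2) P := iW.sub iS
    have iQ := hQ3.bdd.integrable n
    have iWSQ : Integrable (fun ω => (n : ℝ)⁻¹ * W n ω - smean y n ω ^ 2 + Q n ω) P := iWS.add iQ
    have eW : ∫ ω, W n ω ∂P = ((n : ℝ) + 1 - i) * γ k := by
      simp only [hW]
      rw [integral_finsetSum]
      · simp only [h.cov]
        simp only [sub_sub_cancel, Finset.sum_const, Nat.card_Icc, nsmul_eq_mul]
        rw [Nat.cast_sub (by omega)]
        push_cast
        ring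
      · exact fun t _ => ((IsMDS.single h.bdd _).mul (IsMDS.single h.bdd _)).integrable ()
    simp only [hexp n hn]
    rw [integral_sub iWSQ (integrable_const _), integral_add iWS iQ, integral_sub iW iS,
      integral_const_mul, eW]
    simp only [integral_const, probReal_univ, smul_eq_mul, one_mul]
    field_simp
    ring

end IsCausalAR2

end AutocovExpansion

/-! ### Linear system for the sums of lagged products -/

section LagExpansions

variable {Ω : Type*} [MeasurableSpace Ω] {P : Measure Ω}

theorem autocov_comm (x : ℤ → ℝ) (n m k i : ℕ) : autocov x n m k i = autocov x n k m i := by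
  simp only [autocov, mul_comm]

namespace IsCausalAR2

variable [IsProbabilityMeasure P] {φ₁ φ₂ : ℝ} {v : ℝ≥0} {F : ℤ → MeasurableSpace Ω} {γ : ℤ → ℝ}
  {a y : ℤ → Ω → ℝ}

theorem yule_walker (h : IsCausalAR2 P φ₁ φ₂ v F γ a y) {k : ℤ} (hk : 1 ≤ k) :
    γ k = φ₁ * γ (k - 1) + φ₂ * γ (k - 2) := by
  have h1 := h.integral_mul_comp_a (f := id) measurable_id (t := k) (Z := y 0)
    (h.y_meas' (by omega))
  simp only [h.mean, zero_mul, id] at h1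
  have i1 := (((IsMDS.single h.bdd (k - 1)).mul (IsMDS.single h.bdd 0)).smul φ₁).integrable ()
  have i2 := (((IsMDS.single h.bdd (k - 2)).mul (IsMDS.single h.bdd 0)).smul φ₂).integrable ()
  have i3 := ((IsMDS.single h.bdd 0).mul (IsMDS.single h.a_bdd k)).integrable ()
  have i12 : Integrable (fun ω => φ₁ * (y (k - 1) ω * y 0 ω) + φ₂ * (y (k - 2) ω * y 0 ω)) P :=
    i1.add i2
  have h2 : ∫ ω, y k ω * y 0 ω ∂P = ∫ ω, (φ₁ * (y (k - 1) ω * y 0 ω) +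
      φ₂ * (y (k - 2) ω * y 0 ω) + y 0 ω * a k ω) ∂P := by
    congr 1 with ω
    rw [h.recursion k ω]
    ring
  rw [integral_add i12 i3, integral_add i1 i2, integral_const_mul, integral_const_mul, h.cov,
    h.cov, h.cov, h1] at h2
  simpa using h2

theorem yule_walker_zero (h : IsCausalAR2 P φ₁ φ₂ v F γ a y) :
    γ 0 = φ₁ * γ 1 + φ₂ * γ 2 + v := by
  have h1 := h.integral_mul_comp_a (f := id) measurable_id (t := 0) (Z := y (0 - 1))
    (h.y_meas _)
  have h2 := h.integral_mul_comp_a (f := id) measurable_id (t := 0) (Z := y (0 - 2))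
    (h.y_meas' (by omega))
  have h3 := h.integral_comp_a (f := fun x => x ^ 2) (by fun_prop) 0
  rw [integral_sq_gaussian] at h3
  simp only [h.mean, zero_mul, id] at h1 h2
  have b := IsMDS.single h.bdd
  have ba := IsMDS.single h.a_bdd
  have i1 := (((b 0).mul (b (0 - 1))).smul φ₁).integrable ()
  have i2 := (((b 0).mul (b (0 - 2))).smul φ₂).integrable ()
  have i3 := (((b (0 - 1)).mul (ba 0)).smul φ₁).integrable ()
  have i4 := (((b (0 - 2)).mul (ba 0)).smul φ₂).integrable ()
  have i5 := ((ba 0).pow 2).integrable ()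
  have i12 : Integrable (fun ω => φ₁ * (y 0 ω * y (0 - 1) ω) + φ₂ * (y 0 ω * y (0 - 2) ω)) P :=
    i1.add i2
  have i34 : Integrable (fun ω => φ₁ * (y (0 - 1) ω * a 0 ω) + φ₂ * (y (0 - 2) ω * a 0 ω)) P :=
    i3.add i4
  have i345 : Integrable (fun ω => φ₁ * (y (0 - 1) ω * a 0 ω) + φ₂ * (y (0 - 2) ω * a 0 ω) +
    a 0 ω ^ 2) P := i34.add i5
  have e : ∫ ω, y 0 ω * y 0 ω ∂P = ∫ ω, ((φ₁ * (y 0 ω * y (0 - 1) ω) +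
      φ₂ * (y 0 ω * y (0 - 2) ω)) + (φ₁ * (y (0 - 1) ω * a 0 ω) + φ₂ * (y (0 - 2) ω * a 0 ω) +
      a 0 ω ^ 2)) ∂P := by
    congr 1 with ω
    rw [h.recursion 0 ω]
    ring
  rw [integral_add i12 i345, integral_add i34 i5, integral_add i1 i2, integral_add i3 i4, h3] at e
  simp only [integral_const_mul, h.cov, h1, h2] at e
  simpa using e

theorem gamma_one (h : IsCausalAR2 P φ₁ φ₂ v F γ a y) : γ 1 = φ₁ * γ 0 + φ₂ * γ 1 := by
  have := h.yule_walker (k := 1) le_rfl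
  norm_num at this
  rw [h.cov_neg 1] at this
  exact this

theorem gamma_two (h : IsCausalAR2 P φ₁ φ₂ v F γ a y) : γ 2 = φ₁ * γ 1 + φ₂ * γ 0 := by
  have := h.yule_walker (k := 2) (by norm_num)
  norm_num at this
  exact this

/-- Determinant of the linear system for the linear parts of the sample autocovariances. -/
def lagDet (φ₁ φ₂ : ℝ) : ℝ := (1 - φ₂) * (1 - φ₁ ^ 2 - φ₂ ^ 2) - 2 * φ₁ ^ 2 * φ₂

/-- Linear part of the lag zero sample autocovariance. -/
noncomputable def lin₀ (φ₁ φ₂ : ℝ) : Fin 3 → ℝ :=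
  ![2 * φ₁ / lagDet φ₁ φ₂, 2 * φ₂ * (1 - φ₂) / lagDet φ₁ φ₂, (1 - φ₂) / lagDet φ₁ φ₂]

/-- Linear part of the lag one sample autocovariance. -/
noncomputable def lin₁ (φ₁ φ₂ : ℝ) : Fin 3 → ℝ :=
  ![(1 + φ₁ ^ 2 - φ₂ ^ 2) / lagDet φ₁ φ₂, 2 * φ₁ * φ₂ / lagDet φ₁ φ₂, φ₁ / lagDet φ₁ φ₂]

/-- Linear part of the lag two sample autocovariance. -/
noncomputable def lin₂ (φ₁ φ₂ : ℝ) : Fin 3 → ℝ :=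
  fun i => φ₁ * lin₁ φ₁ φ₂ i + φ₂ * lin₀ φ₁ φ₂ i + ![0, 1, 0] i

/-- The recursion multiplied by y_{t-1} and summed over t ≥ 3; moving the windows to a common one
leaves bounded boundary terms. -/
theorem lag_one_equation (h : IsCausalAR2 P φ₁ φ₂ v F γ a y) :
    BddMoments P (fun n ω => lagSum y 1 n ω - φ₁ * lagSum y 0 n ω - φ₂ * lagSum y 1 n ω -
      IsMDS.psum (incr v a y 0) n ω) := by
  have b01 := h.bdd_window_sub_lagSum 3 0 1
  have b10 := h.bdd_window_sub_lagSum 3 1 0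
  have b11 := h.bdd_window_sub_lagSum 3 1 1
  refine (((b10.smul φ₁).add (b11.smul φ₂)).sub b01).congr fun n =>
    Eventually.of_forall fun ω => ?_
  have e : ∑ t ∈ Finset.Icc 3 n, y (t - (0 : ℕ)) ω * y (t - (0 : ℕ) - (1 : ℕ)) ω =
      φ₁ * ∑ t ∈ Finset.Icc 3 n, y (t - (1 : ℕ)) ω * y (t - (1 : ℕ) - (0 : ℕ)) ω +
      φ₂ * ∑ t ∈ Finset.Icc 3 n, y (t - (1 : ℕ)) ω * y (t - (1 : ℕ) - (1 : ℕ)) ω +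
      IsMDS.psum (incr v a y 0) n ω := by
    rw [IsMDS.psum, Finset.mul_sum, Finset.mul_sum, ← Finset.sum_add_distrib,
      ← Finset.sum_add_distrib]
    refine Finset.sum_congr rfl fun t _ => ?_
    have := h.recursion t ω
    simp only [incr, Nat.cast_zero, Nat.cast_one, sub_zero, sub_sub, one_add_one_eq_two,
      Matrix.cons_val_zero]
    rw [this]
    ring
  simp only [e]
  ring

theorem lag_two_equation (h : IsCausalAR2 P φ₁ φ₂ v F γ a y) :
    BddMoments P (fun n ω => lagSum y 2 n ω - φ₁ * lagSum y 1 n ω - φ₂ * lagSum y 0 n ω -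
      IsMDS.psum (incr v a y 1) n ω) := by
  have b01 := h.bdd_window_sub_lagSum 3 0 2
  have b10 := h.bdd_window_sub_lagSum 3 1 1
  have b11 := h.bdd_window_sub_lagSum 3 2 0
  refine (((b10.smul φ₁).add (b11.smul φ₂)).sub b01).congr fun n =>
    Eventually.of_forall fun ω => ?_
  have e : ∑ t ∈ Finset.Icc 3 n, y (t - (0 : ℕ)) ω * y (t - (0 : ℕ) - (2 : ℕ)) ω =
      φ₁ * ∑ t ∈ Finset.Icc 3 n, y (t - (1 : ℕ)) ω * y (t - (1 : ℕ) - (1 : ℕ)) ω +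
      φ₂ * ∑ t ∈ Finset.Icc 3 n, y (t - (2 : ℕ)) ω * y (t - (2 : ℕ) - (0 : ℕ)) ω +
      IsMDS.psum (incr v a y 1) n ω := by
    rw [IsMDS.psum, Finset.mul_sum, Finset.mul_sum, ← Finset.sum_add_distrib,
      ← Finset.sum_add_distrib]
    refine Finset.sum_congr rfl fun t _ => ?_
    have := h.recursion t ω
    simp only [incr, Nat.cast_zero, Nat.cast_one, Nat.cast_ofNat, sub_zero, sub_sub,
      one_add_one_eq_two, Matrix.cons_val_zero, Matrix.cons_val_one]
    rw [this]
    ring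
  simp only [e]
  ring

/-- The squared recursion, summed. Writing a² = (a² - v) + v yields the third martingale and the
drift nv. -/
theorem lag_zero_equation (h : IsCausalAR2 P φ₁ φ₂ v F γ a y) :
    BddMoments P (fun n ω => lagSum y 0 n ω - (φ₁ ^ 2 + φ₂ ^ 2) * lagSum y 0 n ω -
      2 * φ₁ * φ₂ * lagSum y 1 n ω - 2 * φ₁ * IsMDS.psum (incr v a y 0) n ω -
      2 * φ₂ * IsMDS.psum (incr v a y 1) n ω - IsMDS.psum (incr v a y 2) n ω - n * v) := by
  have b00 := h.bdd_window_sub_lagSum 3 0 0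
  have b10 := h.bdd_window_sub_lagSum 3 1 0
  have b20 := h.bdd_window_sub_lagSum 3 2 0
  have b11 := h.bdd_window_sub_lagSum 3 1 1
  have bv := bddMoments_shift (P := P) (f := fun _ _ => (v : ℝ))
    (BddMoments.const (c := fun _ => (v : ℝ)) fun _ => le_rfl) 3 0
  refine (((((b10.smul (φ₁ ^ 2)).add (b20.smul (φ₂ ^ 2))).add (b11.smul (2 * φ₁ * φ₂))).add
    bv).sub b00).congr fun n => Eventually.of_forall fun ω => ?_
  have e : ∑ t ∈ Finset.Icc 3 n, y (t - (0 : ℕ)) ω * y (t - (0 : ℕ) - (0 : ℕ)) ω =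
      φ₁ ^ 2 * ∑ t ∈ Finset.Icc 3 n, y (t - (1 : ℕ)) ω * y (t - (1 : ℕ) - (0 : ℕ)) ω +
      φ₂ ^ 2 * ∑ t ∈ Finset.Icc 3 n, y (t - (2 : ℕ)) ω * y (t - (2 : ℕ) - (0 : ℕ)) ω +
      2 * φ₁ * φ₂ * ∑ t ∈ Finset.Icc 3 n, y (t - (1 : ℕ)) ω * y (t - (1 : ℕ) - (1 : ℕ)) ω +
      2 * φ₁ * IsMDS.psum (incr v a y 0) n ω + 2 * φ₂ * IsMDS.psum (incr v a y 1) n ω +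
      IsMDS.psum (incr v a y 2) n ω + ∑ t ∈ Finset.Icc 3 n, (v : ℝ) := by
    simp only [IsMDS.psum, Finset.mul_sum, ← Finset.sum_add_distrib]
    refine Finset.sum_congr rfl fun t _ => ?_
    have := h.recursion t ω
    simp only [incr, Nat.cast_zero, Nat.cast_one, Nat.cast_ofNat, sub_zero, sub_sub,
      one_add_one_eq_two, Matrix.cons_val_zero, Matrix.cons_val_one, Matrix.cons_val_two,
      Matrix.tail_cons, Matrix.head_cons]
    rw [this]
    ring
  have e1 : ∑ t ∈ Finset.Icc 1 n, (v : ℝ) = n * v := by simp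
  simp only [e, e1]
  ring

theorem lagDet_mul_gamma_zero (h : IsCausalAR2 P φ₁ φ₂ v F γ a y) :
    lagDet φ₁ φ₂ * γ 0 = (1 - φ₂) * v := by
  have g0 := h.yule_walker_zero
  rw [h.gamma_two] at g0
  rw [lagDet]
  linear_combination (1 - φ₂) * g0 + φ₁ * (1 + φ₂) * h.gamma_one

theorem lagDet_mul_gamma_one (h : IsCausalAR2 P φ₁ φ₂ v F γ a y) :
    lagDet φ₁ φ₂ * γ 1 = φ₁ * v := by
  have g0 := h.yule_walker_zero
  rw [h.gamma_two] at g0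
  rw [lagDet]
  linear_combination φ₁ * g0 + (1 - φ₂ ^ 2) * h.gamma_one

theorem lagExpansion_zero (h : IsCausalAR2 P φ₁ φ₂ v F γ a y) (hd : lagDet φ₁ φ₂ ≠ 0) :
    LagExpansion P v γ a y 0 (lin₀ φ₁ φ₂) := by
  -- Cramer's rule: these multipliers eliminate the lag one sum from the two equations.
  refine ((((h.lag_zero_equation).smul (1 - φ₂)).add
    ((h.lag_one_equation).smul (2 * φ₁ * φ₂))).smul (lagDet φ₁ φ₂)⁻¹).congr fun n =>
    Eventually.of_forall fun ω => ?_
  have gd := h.lagDet_mul_gamma_zero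
  simp only [Fin.sum_univ_three, lin₀, Matrix.cons_val_zero, Matrix.cons_val_one,
    Matrix.cons_val_two, Matrix.tail_cons, Matrix.head_cons, Nat.cast_zero]
  field_simp
  rw [lagDet] at gd ⊢
  linear_combination (n : ℝ) * gd

theorem lagExpansion_one (h : IsCausalAR2 P φ₁ φ₂ v F γ a y) (hd : lagDet φ₁ φ₂ ≠ 0) :
    LagExpansion P v γ a y 1 (lin₁ φ₁ φ₂) := by
  refine ((((h.lag_zero_equation).smul φ₁).add
    ((h.lag_one_equation).smul (1 - φ₁ ^ 2 - φ₂ ^ 2))).smul (lagDet φ₁ φ₂)⁻¹).congr fun n =>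
    Eventually.of_forall fun ω => ?_
  have gd := h.lagDet_mul_gamma_one
  simp only [Fin.sum_univ_three, lin₁, Matrix.cons_val_zero, Matrix.cons_val_one,
    Matrix.cons_val_two, Matrix.tail_cons, Matrix.head_cons, Nat.cast_one]
  field_simp
  rw [lagDet] at gd ⊢
  linear_combination (n : ℝ) * gd

theorem lagExpansion_two (h : IsCausalAR2 P φ₁ φ₂ v F γ a y) (hd : lagDet φ₁ φ₂ ≠ 0) :
    LagExpansion P v γ a y 2 (lin₂ φ₁ φ₂) := by
  refine (((h.lagExpansion_one hd).smul φ₁).add (((h.lagExpansion_zero hd).smul φ₂).add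
    h.lag_two_equation)).congr fun n => Eventually.of_forall fun ω => ?_
  have g2 := h.gamma_two
  simp only [Fin.sum_univ_three, lin₂, Matrix.cons_val_zero, Matrix.cons_val_one,
    Matrix.cons_val_two, Matrix.tail_cons, Matrix.head_cons, Nat.cast_zero, Nat.cast_one,
    Nat.cast_ofNat, g2]
  ring

end IsCausalAR2

end LagExpansions

/-! ### Jets in terms of the lag one autocorrelation -/

section EstimatorBias

variable {Ω : Type*} [MeasurableSpace Ω] {P : Measure Ω}

/-- The denominator of the Burg estimate of `φ₂`. -/
noncomputable def burgDen (x : ℤ → ℝ) (n : ℕ) : ℝ :=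
  (autocov x n 0 0 3 + autocov x n 2 2 3) * (autocov x n 0 0 2 + autocov x n 1 1 2) ^ 2 +
    8 * autocov x n 0 1 2 ^ 2 * autocov x n 1 1 3 -
    4 * autocov x n 0 1 2 * (autocov x n 0 1 3 + autocov x n 2 1 3) *
      (autocov x n 0 0 2 + autocov x n 1 1 2)

/-- The numerator of the Burg estimate of `φ₁`. -/
noncomputable def burgNum₁ (x : ℤ → ℝ) (n : ℕ) : ℝ :=
  2 * autocov x n 0 1 2 * (autocov x n 0 0 2 + autocov x n 1 1 2) *
    (autocov x n 0 0 3 + autocov x n 2 2 3 - 2 * autocov x n 0 2 3)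

/-- The numerator of the Burg estimate of `φ₂`. -/
noncomputable def burgNum₂ (x : ℤ → ℝ) (n : ℕ) : ℝ :=
  8 * autocov x n 0 1 2 ^ 2 * autocov x n 1 1 3 -
    4 * autocov x n 0 1 2 * (autocov x n 0 1 3 + autocov x n 2 1 3) *
      (autocov x n 0 0 2 + autocov x n 1 1 2) +
    2 * autocov x n 0 2 3 * (autocov x n 0 0 2 + autocov x n 1 1 2) ^ 2

namespace IsCausalAR2

/-- The admissible region of an AR(2) process. -/
structure Admissible (φ₁ φ₂ : ℝ) : Prop where
  abs_lt_one : |φ₂| < 1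
  add_lt : φ₁ + φ₂ < 1
  sub_lt : φ₂ - φ₁ < 1

/-- The reparametrization by the lag one autocorrelation `r`. -/
theorem Admissible.exists_param {φ₁ φ₂ : ℝ} (h : Admissible φ₁ φ₂) :
    ∃ r : ℝ, φ₁ = r * (1 - φ₂) ∧ 0 < 1 - r ∧ 0 < 1 + r ∧ 0 < 1 - φ₂ ∧ 0 < 1 + φ₂ := by
  obtain ⟨h1, h2⟩ := abs_lt.1 h.abs_lt_one
  have hq : 0 < 1 - φ₂ := by linarith
  refine ⟨φ₁ / (1 - φ₂), by field_simp, ?_, ?_, hq, by linarith⟩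
  · rw [sub_pos, div_lt_one hq]
    linarith [h.add_lt]
  · rw [← neg_lt_iff_pos_add', lt_div_iff₀ hq]
    linarith [h.sub_lt]

variable [IsProbabilityMeasure P] {φ₁ φ₂ : ℝ} {v : ℝ≥0} {F : ℤ → MeasurableSpace Ω} {γ : ℤ → ℝ}
  {a y : ℤ → Ω → ℝ}

/-- The jets of all the sample autocovariances entering the estimators, in terms of the lag one
autocorrelation `r` and the variance `g`. -/
theorem autocov_jets (h : IsCausalAR2 P φ₁ φ₂ v F γ a y) (hv : 0 < v) {r : ℝ}
    (hr : φ₁ = r * (1 - φ₂)) (h1 : 0 < 1 - r) (h2 : 0 < 1 + r) (h3 : 0 < 1 - φ₂)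
    (h4 : 0 < 1 + φ₂) : ∃ (Δ : Fin 3 → ℕ → Ω → ℝ) (g e τ : ℝ), 0 < g ∧
    e = ((1 - φ₂) * (1 + φ₂) * ((1 - r) * (1 + r)))⁻¹ ∧
    IsFluctuation P Δ ![![g ^ 2 * e, r * g ^ 2 * e, 0], ![r * g ^ 2 * e, g ^ 2 * e, 0],
      ![0, 0, τ]] ∧
    (∀ m i : ℕ, HasJet P Δ (fun n ω => autocov (fun t => y t ω) n m m i) g
      ![2 * r, 2 * φ₂, 1] (g * (1 - i - (1 + r) ^ 2 * (1 + φ₂) ^ 2 * e))) ∧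
    (∀ m i : ℕ, HasJet P Δ (fun n ω => autocov (fun t => y t ω) n m (m + 1) i) (r * g)
      ![1 + φ₂ + r ^ 2 * (1 - φ₂), 2 * r * φ₂, r]
      (g * (r * (1 - i) - (1 + r) ^ 2 * (1 + φ₂) ^ 2 * e))) ∧
    (∀ m i : ℕ, HasJet P Δ (fun n ω => autocov (fun t => y t ω) n m (m + 2) i)
      ((r ^ 2 * (1 - φ₂) + φ₂) * g)
      ![r * (1 - φ₂) * (1 + φ₂ + r ^ 2 * (1 - φ₂)) + 2 * r * φ₂,
        2 * r ^ 2 * φ₂ * (1 - φ₂) + 2 * φ₂ ^ 2 + (1 - φ₂) * (1 + φ₂) * ((1 - r) * (1 + r)),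
        r ^ 2 * (1 - φ₂) + φ₂]
      (g * ((r ^ 2 * (1 - φ₂) + φ₂) * (1 - i) - (1 + r) ^ 2 * (1 + φ₂) ^ 2 * e))) := by
  have hdet : lagDet φ₁ φ₂ = (1 + φ₂) * (1 - φ₂) ^ 2 * ((1 - r) * (1 + r)) := by
    rw [lagDet, hr]
    ring
  have hd : lagDet φ₁ φ₂ ≠ 0 := by
    rw [hdet]
    positivity
  have hκe : 1 - φ₁ - φ₂ = (1 - r) * (1 - φ₂) := by rw [hr]; ring
  have hκ : 1 - φ₁ - φ₂ ≠ 0 := by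
    rw [hκe]
    positivity
  have hv' : (0 : ℝ) < v := by exact_mod_cast hv
  have hg0 := h.lagDet_mul_gamma_zero
  set e : ℝ := ((1 - φ₂) * (1 + φ₂) * ((1 - r) * (1 + r)))⁻¹ with he
  have hep : 0 < e := by positivity
  have hg : γ 0 = v * e := by
    rw [hdet] at hg0
    rw [he, ← div_eq_mul_inv, eq_div_iff (by positivity)]
    exact mul_left_cancel₀ h3.ne' (by linear_combination hg0)
  have hgp : 0 < γ 0 := by
    rw [hg]
    positivity
  have hg1 : γ 1 = r * γ 0 := by
    have := h.gamma_one
    rw [hr] at this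
    have h5 : (1 - φ₂) * γ 1 = (1 - φ₂) * (r * γ 0) := by linear_combination this
    exact mul_left_cancel₀ h3.ne' h5
  have hg2 : γ 2 = (r ^ 2 * (1 - φ₂) + φ₂) * γ 0 := by
    rw [h.gamma_two, hg1, hr]
    ring
  have hw : (v : ℝ) / (1 - φ₁ - φ₂) ^ 2 = γ 0 * ((1 + r) ^ 2 * (1 + φ₂) ^ 2 * e) := by
    rw [hκe, hg, he]
    field_simp
  have j0 := fun m i => (h.autocov_hasJet hκ (h.lagExpansion_zero hd) m i).rescale hep.ne'
  have j1 := fun m i => (h.autocov_hasJet hκ (h.lagExpansion_one hd) m i).rescale hep.ne'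
  have j2 := fun m i => (h.autocov_hasJet hκ (h.lagExpansion_two hd) m i).rescale hep.ne'
  have l0 : ∀ j, e⁻¹ * lin₀ φ₁ φ₂ j = ![2 * r, 2 * φ₂, 1] j := by
    intro j
    simp only [lin₀, hdet, he, inv_inv]
    simp only [hr]
    fin_cases j <;> simp <;> field_simp
  have l1 : ∀ j, e⁻¹ * lin₁ φ₁ φ₂ j = ![1 + φ₂ + r ^ 2 * (1 - φ₂), 2 * r * φ₂, r] j := by
    intro j
    simp only [lin₁, hdet, he, inv_inv]
    simp only [hr]
    fin_cases j <;> simp <;> field_simp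
    ring
  -- Scaling the martingales by e = γ 0 / v clears the denominators of the linear parts and removes
  -- v from the relevant covariances.
  refine ⟨fun i n ω => e * fluct v a y i n ω, γ 0, e, e ^ 2 * covMatrix v γ 2 2, hgp, rfl, ?_,
    fun m i => (j0 m i).cast rfl l0 ?_, fun m i => (j1 m i).cast hg1 l1 ?_,
    fun m i => (j2 m i).cast hg2 (fun j => ?_) ?_⟩
  · have hS := h.isFluctuation.smul e
    refine ⟨hS.order, fun i j => ?_⟩
    convert hS.cov i j using 2
    rw [hg]
    fin_cases i <;> fin_cases j <;> simp [covMatrix, hg1, hg] <;> ring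
  · rw [hw]
    push_cast
    ring
  · rw [hw]
    push_cast
    rw [hg1]
    ring
  · have : e⁻¹ * lin₂ φ₁ φ₂ j = φ₁ * (e⁻¹ * lin₁ φ₁ φ₂ j) + φ₂ * (e⁻¹ * lin₀ φ₁ φ₂ j) +
        e⁻¹ * ![0, 1, 0] j := by
      rw [lin₂]
      ring
    rw [this, l0, l1, he, inv_inv, hr]
    fin_cases j <;> simp <;> ring
  · rw [hw]
    push_cast
    rw [hg2]
    ring

end IsCausalAR2

end EstimatorBias

/-! ### Asymptotic bias of the four estimators -/

section EstimatorJets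

variable {Ω : Type*} [MeasurableSpace Ω] {P : Measure Ω}

namespace IsCausalAR2

variable [IsProbabilityMeasure P] {φ₁ φ₂ : ℝ} {v : ℝ≥0} {F : ℤ → MeasurableSpace Ω} {γ : ℤ → ℝ}
  {a y : ℤ → Ω → ℝ}

/-- The estimator enters only through T·det = N and a polynomial second moment bound, which are
established separately. -/
theorem ls_tendsto₁ (h : IsCausalAR2 P φ₁ φ₂ v F γ a y) (hv : 0 < v) (hadm : Admissible φ₁ φ₂)
    {T : ℕ → Ω → ℝ} {A : ℕ} {K : ℝ} (hT : ∀ n, AEStronglyMeasurable (T n) P)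
    (hT2 : ∀ᶠ n : ℕ in atTop, Integrable (fun ω => T n ω ^ 2) P ∧
      ∫ ω, T n ω ^ 2 ∂P ≤ K * (n : ℝ) ^ A)
    (hTD : ∀ n ω, T n ω * lsDet (fun t => y t ω) n =
      autocov (fun t => y t ω) n 0 1 3 * autocov (fun t => y t ω) n 2 2 3 -
      autocov (fun t => y t ω) n 0 2 3 * autocov (fun t => y t ω) n 1 2 3) :
    (∀ᶠ n : ℕ in atTop, Integrable (T n) P) ∧
    Tendsto (fun n : ℕ => (n : ℝ) * ∫ ω, (T n ω - φ₁) ∂P) atTop (𝓝 (-(1 + φ₁ + φ₂))) := by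
  obtain ⟨r, hr, h1, h2, h3, h4⟩ := hadm.exists_param
  obtain ⟨Δ, g, e, τ, hg, he, hΔ, j0, j1, j2⟩ := h.autocov_jets hv hr h1 h2 h3 h4
  have hN := ((j1 0 3).mul hΔ (j0 2 3)).sub hΔ ((j2 0 3).mul hΔ (j1 1 3))
  have hD := ((j0 1 3).mul hΔ (j0 2 3)).sub hΔ ((j1 1 3).mul hΔ (j1 1 3))
  have hD' : HasJet P (Δ) (fun n ω => lsDet (fun t => y t ω) n) _ _ _ :=
    hD.congr fun n => Eventually.of_forall fun ω => by simp only [lsDet]; ring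
  -- Consistency: at the true autocovariances Cramer's numerator is φ₁ times the determinant, by the
  -- Yule–Walker equations.
  have hc : r * g * g - (r ^ 2 * (1 - φ₂) + φ₂) * g * (r * g) = φ₁ * (g * g - r * g * (r * g)) := by
    rw [hr]
    ring
  have hd : g * g - r * g * (r * g) ≠ 0 := by
    rw [show g * g - r * g * (r * g) = g ^ 2 * ((1 - r) * (1 + r)) by ring]
    positivity
  have key := HasJet.tendsto_ratio hΔ (hN.cast hc (fun _ => rfl) rfl) hD' hd hT hT2
    fun n => Eventually.of_forall fun ω => hTD n ω
  refine ⟨key.1, ?_⟩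
  -- The fourth moment quantity τ cancels. The third martingale moves the autocovariances along
  -- their own limit vector, that is, it only rescales them, and a ratio of forms of equal degree
  -- does not see this.
  convert key.2 using 2
  simp only [Fin.sum_univ_three, Matrix.cons_val_zero, Matrix.cons_val_one,
    Matrix.cons_val_two, Matrix.tail_cons, Matrix.head_cons]
  rw [show g * g - r * g * (r * g) = g ^ 2 * ((1 - r) * (1 + r)) by ring, hr]
  push_cast
  rw [he]
  field_simp
  ring

theorem ls_tendsto₂ (h : IsCausalAR2 P φ₁ φ₂ v F γ a y) (hv : 0 < v) (hadm : Admissible φ₁ φ₂)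
    {T : ℕ → Ω → ℝ} {A : ℕ} {K : ℝ} (hT : ∀ n, AEStronglyMeasurable (T n) P)
    (hT2 : ∀ᶠ n : ℕ in atTop, Integrable (fun ω => T n ω ^ 2) P ∧
      ∫ ω, T n ω ^ 2 ∂P ≤ K * (n : ℝ) ^ A)
    (hTD : ∀ n ω, T n ω * lsDet (fun t => y t ω) n =
      autocov (fun t => y t ω) n 0 2 3 * autocov (fun t => y t ω) n 1 1 3 -
      autocov (fun t => y t ω) n 0 1 3 * autocov (fun t => y t ω) n 1 2 3) :
    (∀ᶠ n : ℕ in atTop, Integrable (T n) P) ∧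
    Tendsto (fun n : ℕ => (n : ℝ) * ∫ ω, (T n ω - φ₂) ∂P) atTop (𝓝 (-(2 + 4 * φ₂))) := by
  obtain ⟨r, hr, h1, h2, h3, h4⟩ := hadm.exists_param
  obtain ⟨Δ, g, e, τ, hg, he, hΔ, j0, j1, j2⟩ := h.autocov_jets hv hr h1 h2 h3 h4
  have hN := ((j2 0 3).mul hΔ (j0 1 3)).sub hΔ ((j1 0 3).mul hΔ (j1 1 3))
  have hD := ((j0 1 3).mul hΔ (j0 2 3)).sub hΔ ((j1 1 3).mul hΔ (j1 1 3))
  have hD' : HasJet P (Δ) (fun n ω => lsDet (fun t => y t ω) n) _ _ _ :=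
    hD.congr fun n => Eventually.of_forall fun ω => by simp only [lsDet]; ring
  have hc : (r ^ 2 * (1 - φ₂) + φ₂) * g * g - r * g * (r * g) = φ₂ * (g * g - r * g * (r * g)) := by
    ring
  have hd : g * g - r * g * (r * g) ≠ 0 := by
    rw [show g * g - r * g * (r * g) = g ^ 2 * ((1 - r) * (1 + r)) by ring]
    positivity
  have key := HasJet.tendsto_ratio hΔ (hN.cast hc (fun _ => rfl) rfl) hD' hd hT hT2
    fun n => Eventually.of_forall fun ω => hTD n ω
  refine ⟨key.1, ?_⟩
  convert key.2 using 2
  simp only [Fin.sum_univ_three, Matrix.cons_val_zero, Matrix.cons_val_one,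
    Matrix.cons_val_two, Matrix.tail_cons, Matrix.head_cons]
  rw [show g * g - r * g * (r * g) = g ^ 2 * ((1 - r) * (1 + r)) by ring]
  push_cast
  rw [he]
  field_simp
  ring

theorem burg_tendsto₁ (h : IsCausalAR2 P φ₁ φ₂ v F γ a y) (hv : 0 < v) (hadm : Admissible φ₁ φ₂)
    {T : ℕ → Ω → ℝ} {A : ℕ} {K : ℝ} (hT : ∀ n, AEStronglyMeasurable (T n) P)
    (hT2 : ∀ᶠ n : ℕ in atTop, Integrable (fun ω => T n ω ^ 2) P ∧
      ∫ ω, T n ω ^ 2 ∂P ≤ K * (n : ℝ) ^ A)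
    (hTD : ∀ n ω, T n ω * burgDen (fun t => y t ω) n = burgNum₁ (fun t => y t ω) n) :
    (∀ᶠ n : ℕ in atTop, Integrable (T n) P) ∧
    Tendsto (fun n : ℕ => (n : ℝ) * ∫ ω, (T n ω - φ₁) ∂P) atTop (𝓝 (-(1 + φ₁ + φ₂))) := by
  obtain ⟨r, hr, h1, h2, h3, h4⟩ := hadm.exists_param
  obtain ⟨Δ, g, e, τ, hg, he, hΔ, j0, j1, j2⟩ := h.autocov_jets hv hr h1 h2 h3 h4
  have jC := (j0 0 3).add hΔ (j0 2 3)
  have jD := (j0 0 2).add hΔ (j0 1 2)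
  have jE := j2 0 3
  have jF := j1 0 2
  have jG := j0 1 3
  have jH := (j1 0 3).add hΔ (j1 1 3)
  have jD2 := jD.mul hΔ jD
  have jFG := jF.mul hΔ (jF.mul hΔ jG)
  have jFHD := jF.mul hΔ (jH.mul hΔ jD)
  have hD := ((jC.mul hΔ jD2).add hΔ (jFG.smul 8)).sub hΔ (jFHD.smul 4)
  have hN := ((jF.mul hΔ jD).mul hΔ (jC.sub hΔ (jE.smul 2))).smul 2
  have hD' : HasJet P (Δ) (fun n ω => burgDen (fun t => y t ω) n) _ _ _ :=
    hD.congr fun n => Eventually.of_forall fun ω => by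
      simp only [burgDen, autocov_comm _ n 2 1]
      ring
  have hN' : HasJet P (Δ) (fun n ω => burgNum₁ (fun t => y t ω) n) _ _ _ :=
    hN.congr fun n => Eventually.of_forall fun ω => by
      simp only [burgNum₁, mul_assoc]
  -- In the limit C and D tend to 2g, G to g, F to rg and H to 2rg.
  have hd0 : (g + g) * ((g + g) * (g + g)) + 8 * (r * g * (r * g * g)) -
      4 * (r * g * ((r * g + r * g) * (g + g))) = 8 * g ^ 3 * ((1 - r) * (1 + r)) := by
    ring
  have hd : (g + g) * ((g + g) * (g + g)) + 8 * (r * g * (r * g * g)) -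
      4 * (r * g * ((r * g + r * g) * (g + g))) ≠ 0 := by
    rw [hd0]
    positivity
  have key := HasJet.tendsto_ratio hΔ (hN'.cast (by rw [hr]; ring) (fun _ => rfl) rfl) hD' hd
    hT hT2 (θ := φ₁) fun n => Eventually.of_forall fun ω => hTD n ω
  refine ⟨key.1, ?_⟩
  convert key.2 using 2
  simp only [Fin.sum_univ_three, Matrix.cons_val_zero, Matrix.cons_val_one,
    Matrix.cons_val_two, Matrix.tail_cons, Matrix.head_cons]
  rw [hd0, hr]
  push_cast
  rw [he]
  field_simp
  ring

set_option maxHeartbeats 1000000 in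
theorem burg_tendsto₂ (h : IsCausalAR2 P φ₁ φ₂ v F γ a y) (hv : 0 < v) (hadm : Admissible φ₁ φ₂)
    {T : ℕ → Ω → ℝ} {A : ℕ} {K : ℝ} (hT : ∀ n, AEStronglyMeasurable (T n) P)
    (hT2 : ∀ᶠ n : ℕ in atTop, Integrable (fun ω => T n ω ^ 2) P ∧
      ∫ ω, T n ω ^ 2 ∂P ≤ K * (n : ℝ) ^ A)
    (hTD : ∀ n ω, T n ω * burgDen (fun t => y t ω) n = burgNum₂ (fun t => y t ω) n) :
    (∀ᶠ n : ℕ in atTop, Integrable (T n) P) ∧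
    Tendsto (fun n : ℕ => (n : ℝ) * ∫ ω, (T n ω - φ₂) ∂P) atTop (𝓝 (-(2 + 4 * φ₂))) := by
  obtain ⟨r, hr, h1, h2, h3, h4⟩ := hadm.exists_param
  obtain ⟨Δ, g, e, τ, hg, he, hΔ, j0, j1, j2⟩ := h.autocov_jets hv hr h1 h2 h3 h4
  have jC := (j0 0 3).add hΔ (j0 2 3)
  have jD := (j0 0 2).add hΔ (j0 1 2)
  have jE := j2 0 3
  have jF := j1 0 2
  have jG := j0 1 3
  have jH := (j1 0 3).add hΔ (j1 1 3)
  have jD2 := jD.mul hΔ jD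
  have jFG := jF.mul hΔ (jF.mul hΔ jG)
  have jFHD := jF.mul hΔ (jH.mul hΔ jD)
  have hD := ((jC.mul hΔ jD2).add hΔ (jFG.smul 8)).sub hΔ (jFHD.smul 4)
  have hN := ((jFG.smul 8).sub hΔ (jFHD.smul 4)).add hΔ ((jE.mul hΔ jD2).smul 2)
  have hD' : HasJet P (Δ) (fun n ω => burgDen (fun t => y t ω) n) _ _ _ :=
    hD.congr fun n => Eventually.of_forall fun ω => by
      simp only [burgDen, autocov_comm _ n 2 1]
      ring
  have hN' : HasJet P (Δ) (fun n ω => burgNum₂ (fun t => y t ω) n) _ _ _ :=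
    hN.congr fun n => Eventually.of_forall fun ω => by
      simp only [burgNum₂, autocov_comm _ n 2 1]
      ring
  have hd0 : (g + g) * ((g + g) * (g + g)) + 8 * (r * g * (r * g * g)) -
      4 * (r * g * ((r * g + r * g) * (g + g))) = 8 * g ^ 3 * ((1 - r) * (1 + r)) := by
    ring
  have hd : (g + g) * ((g + g) * (g + g)) + 8 * (r * g * (r * g * g)) -
      4 * (r * g * ((r * g + r * g) * (g + g))) ≠ 0 := by
    rw [hd0]
    positivity
  have key := HasJet.tendsto_ratio hΔ (hN'.cast (by rw [hd0]; ring) (fun _ => rfl) rfl) hD' hd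
    hT hT2 (θ := φ₂) fun n => Eventually.of_forall fun ω => hTD n ω
  refine ⟨key.1, ?_⟩
  convert key.2 using 2
  simp only [Fin.sum_univ_three, Matrix.cons_val_zero, Matrix.cons_val_one,
    Matrix.cons_val_two, Matrix.tail_cons, Matrix.head_cons]
  rw [hd0]
  push_cast
  rw [he]
  field_simp
  ring

end IsCausalAR2

end EstimatorJets

/-! ### Pathwise bounds and the identities T·D = N -/

section DeterministicBounds

theorem autocov_eq_sum (x : ℤ → ℝ) (n m k i : ℕ) : autocov x n m k i =
    ∑ t ∈ Finset.Icc i n, (x ((t : ℤ) - m) - sampleMean x n) *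
      (x ((t : ℤ) - k) - sampleMean x n) / n := by
  rw [autocov, Finset.sum_div]

/-- Both signs come from expanding a sum of squares of u_t ± u_{t-1}, with u the centred
observations. -/
theorem abs_two_mul_autocov_le (x : ℤ → ℝ) (n : ℕ) :
    |2 * autocov x n 0 1 2| ≤ autocov x n 0 0 2 + autocov x n 1 1 2 := by
  have key : ∀ c : ℝ, c ^ 2 = 1 →
      0 ≤ autocov x n 0 0 2 + autocov x n 1 1 2 + c * (2 * autocov x n 0 1 2) := fun c hc => by
    have : autocov x n 0 0 2 + autocov x n 1 1 2 + c * (2 * autocov x n 0 1 2) =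
        ∑ t ∈ Finset.Icc 2 n, ((x ((t : ℤ) - (0 : ℕ)) - sampleMean x n) +
          c * (x ((t : ℤ) - (1 : ℕ)) - sampleMean x n)) ^ 2 / n := by
      simp only [autocov_eq_sum, Finset.mul_sum, ← Finset.sum_add_distrib]
      refine Finset.sum_congr rfl fun t _ => ?_
      linear_combination (-(x ((t : ℤ) - (1 : ℕ)) - sampleMean x n) ^ 2 / n) * hc
    rw [this]
    exact Finset.sum_nonneg fun t _ => by positivity
  rw [abs_le]
  constructor
  · linarith [key 1 (by norm_num)]
  · linarith [key (-1) (by norm_num)]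

/-- The left side is twice the inner product of the forward residuals u_t - r u_{t-1} and the
backward residuals u_{t-2} - r u_{t-1}. The right side is the sum of their squared norms. -/
theorem abs_cross_le (x : ℤ → ℝ) (n : ℕ) (r : ℝ) :
    |2 * (autocov x n 0 2 3 + r ^ 2 * autocov x n 1 1 3 -
      r * (autocov x n 0 1 3 + autocov x n 2 1 3))| ≤
    autocov x n 0 0 3 + autocov x n 2 2 3 + 2 * r ^ 2 * autocov x n 1 1 3 -
      2 * r * (autocov x n 0 1 3 + autocov x n 2 1 3) := by
  have key : ∀ c : ℝ, c ^ 2 = 1 →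
      0 ≤ autocov x n 0 0 3 + autocov x n 2 2 3 + 2 * r ^ 2 * autocov x n 1 1 3 -
      2 * r * (autocov x n 0 1 3 + autocov x n 2 1 3) + c * (2 * (autocov x n 0 2 3 +
        r ^ 2 * autocov x n 1 1 3 - r * (autocov x n 0 1 3 + autocov x n 2 1 3))) :=
    fun c hc => by
    have : autocov x n 0 0 3 + autocov x n 2 2 3 + 2 * r ^ 2 * autocov x n 1 1 3 -
        2 * r * (autocov x n 0 1 3 + autocov x n 2 1 3) + c * (2 * (autocov x n 0 2 3 +
          r ^ 2 * autocov x n 1 1 3 - r * (autocov x n 0 1 3 + autocov x n 2 1 3))) =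
        ∑ t ∈ Finset.Icc 3 n, (((x ((t : ℤ) - (0 : ℕ)) - sampleMean x n) -
          r * (x ((t : ℤ) - (1 : ℕ)) - sampleMean x n)) +
          c * ((x ((t : ℤ) - (2 : ℕ)) - sampleMean x n) -
          r * (x ((t : ℤ) - (1 : ℕ)) - sampleMean x n))) ^ 2 / n := by
      simp only [autocov_eq_sum, Finset.mul_sum, ← Finset.sum_add_distrib,
        ← Finset.sum_sub_distrib]
      refine Finset.sum_congr rfl fun t _ => ?_
      linear_combination (-((x ((t : ℤ) - (2 : ℕ)) - sampleMean x n) -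
          r * (x ((t : ℤ) - (1 : ℕ)) - sampleMean x n)) ^ 2 / n) * hc
    rw [this]
    exact Finset.sum_nonneg fun t _ => by positivity
  rw [abs_le]
  constructor
  · linarith [key 1 (by norm_num)]
  · linarith [key (-1) (by norm_num)]

theorem burgPhi2_eq (x : ℤ → ℝ) (n : ℕ) : burgPhi2 x n = 1 -
    (autocov x n 0 0 2 + autocov x n 1 1 2) ^ 2 *
      (autocov x n 0 0 3 + autocov x n 2 2 3 - 2 * autocov x n 0 2 3) / burgDen x n := by
  simp only [burgPhi2, burgDen]
  ring

theorem burgPhi1_eq (x : ℤ → ℝ) (n : ℕ) : burgPhi1 x n =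
    2 * autocov x n 0 1 2 / (autocov x n 0 0 2 + autocov x n 1 1 2) * (1 - burgPhi2 x n) := rfl

theorem burgDen_eq (x : ℤ → ℝ) (n : ℕ) (hD : autocov x n 0 0 2 + autocov x n 1 1 2 ≠ 0) {r : ℝ}
    (hr : r = 2 * autocov x n 0 1 2 / (autocov x n 0 0 2 + autocov x n 1 1 2)) :
    burgDen x n = (autocov x n 0 0 2 + autocov x n 1 1 2) ^ 2 *
      (autocov x n 0 0 3 + autocov x n 2 2 3 + 2 * r ^ 2 * autocov x n 1 1 3 -
        2 * r * (autocov x n 0 1 3 + autocov x n 2 1 3)) := by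
  rw [hr, burgDen]
  field_simp
  ring

/-- The case of a zero denominator matters, since `burgPhi2` is then 1 by division by zero. Either D
= 0, or the residual energy vanishes; the cross term then vanishes too and forces C = 2E. -/
theorem one_sub_burgPhi2_mul (x : ℤ → ℝ) (n : ℕ) : (1 - burgPhi2 x n) * burgDen x n =
    (autocov x n 0 0 2 + autocov x n 1 1 2) ^ 2 *
      (autocov x n 0 0 3 + autocov x n 2 2 3 - 2 * autocov x n 0 2 3) := by
  by_cases h0 : burgDen x n = 0
  · rw [h0, mul_zero]
    by_cases hD : autocov x n 0 0 2 + autocov x n 1 1 2 = 0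
    · rw [hD]
      ring
    · have h1 := burgDen_eq x n hD rfl
      have h2 := abs_cross_le x n
        (2 * autocov x n 0 1 2 / (autocov x n 0 0 2 + autocov x n 1 1 2))
      rw [h0] at h1
      have h3 := (mul_eq_zero.1 h1.symm).resolve_left (pow_ne_zero 2 hD)
      rw [h3] at h2
      have h4 := abs_nonpos_iff.1 h2
      rw [show autocov x n 0 0 3 + autocov x n 2 2 3 - 2 * autocov x n 0 2 3 = 0 by
        linear_combination h3 - h4, mul_zero]
  · rw [burgPhi2_eq]
    field_simp
    ring

theorem abs_burgPhi2_le (x : ℤ → ℝ) (n : ℕ) : |burgPhi2 x n| ≤ 1 := by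
  by_cases h0 : burgDen x n = 0
  · rw [burgPhi2_eq, h0]
    simp
  have hD : autocov x n 0 0 2 + autocov x n 1 1 2 ≠ 0 := fun hD => h0 (by
    have h1 := abs_two_mul_autocov_le x n
    rw [hD] at h1
    have h2 : autocov x n 0 1 2 = 0 := by linarith [abs_nonpos_iff.1 h1]
    rw [burgDen, hD, h2]
    ring)
  have h1 := burgDen_eq x n hD rfl
  have h2 := abs_cross_le x n (2 * autocov x n 0 1 2 / (autocov x n 0 0 2 + autocov x n 1 1 2))
  have h3 := one_sub_burgPhi2_mul x n
  set r := 2 * autocov x n 0 1 2 / (autocov x n 0 0 2 + autocov x n 1 1 2)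
  set d := autocov x n 0 0 3 + autocov x n 2 2 3 + 2 * r ^ 2 * autocov x n 1 1 3 -
        2 * r * (autocov x n 0 1 3 + autocov x n 2 1 3) with hd
  have hd0 : d ≠ 0 := fun h => h0 (by rw [h1, h, mul_zero])
  -- With r = 2F/D the estimate is twice the residual cross product over the total residual energy
  -- d, that is, Burg's reflection coefficient.
  have h4 : burgPhi2 x n * d = 2 * (autocov x n 0 2 3 + r ^ 2 * autocov x n 1 1 3 -
      r * (autocov x n 0 1 3 + autocov x n 2 1 3)) := by
    refine mul_left_cancel₀ (pow_ne_zero 2 hD) ?_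
    rw [h1] at h3
    linear_combination -h3 + (autocov x n 0 0 2 + autocov x n 1 1 2) ^ 2 * hd
  rw [← h4, abs_mul] at h2
  have h5 : 0 < d := lt_of_le_of_ne ((by positivity : 0 ≤ |burgPhi2 x n| * |d|).trans h2) hd0.symm
  rw [abs_of_pos h5] at h2
  exact le_of_mul_le_mul_right (by linarith) h5

theorem abs_burgPhi1_le (x : ℤ → ℝ) (n : ℕ) : |burgPhi1 x n| ≤ 2 := by
  have h1 := abs_two_mul_autocov_le x n
  have h2 := abs_le.1 (abs_burgPhi2_le x n)
  rw [burgPhi1_eq, abs_mul, abs_div]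
  have h3 : |2 * autocov x n 0 1 2| / |autocov x n 0 0 2 + autocov x n 1 1 2| ≤ 1 :=
    div_le_one_of_le₀ (h1.trans (le_abs_self _)) (abs_nonneg _)
  have h4 : |1 - burgPhi2 x n| ≤ 2 := by
    rw [abs_le]
    constructor <;> linarith
  calc _ ≤ 1 * (2 : ℝ) := mul_le_mul h3 h4 (abs_nonneg _) zero_le_one
    _ = 2 := one_mul 2

theorem burgPhi2_mul (x : ℤ → ℝ) (n : ℕ) : burgPhi2 x n * burgDen x n = burgNum₂ x n := by
  have := one_sub_burgPhi2_mul x n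
  rw [burgNum₂]
  rw [burgDen] at this ⊢
  linear_combination -this

theorem burgPhi1_mul (x : ℤ → ℝ) (n : ℕ) : burgPhi1 x n * burgDen x n = burgNum₁ x n := by
  rw [burgPhi1_eq, mul_assoc, one_sub_burgPhi2_mul, burgNum₁]
  by_cases hD : autocov x n 0 0 2 + autocov x n 1 1 2 = 0
  · simp [hD]
  · field_simp

theorem sum_linear_sq {ι : Type*} (s : Finset ι) (f g : ι → ℝ) (b c : ℝ) :
    ∑ t ∈ s, (b * f t + c * g t) ^ 2 = b ^ 2 * (∑ t ∈ s, f t ^ 2) +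
      2 * b * c * (∑ t ∈ s, f t * g t) + c ^ 2 * ∑ t ∈ s, g t ^ 2 := by
  simp only [Finset.mul_sum, ← Finset.sum_add_distrib]
  exact Finset.sum_congr rfl fun t _ => by ring

/-- If the Gram determinant of `f` and `g` vanishes, so do the numerators in Cramer's rule. -/
theorem cramer_numerator_eq_zero {ι : Type*} (s : Finset ι) (f g h : ι → ℝ)
    (hdet : (∑ t ∈ s, f t ^ 2) * (∑ t ∈ s, g t ^ 2) - (∑ t ∈ s, f t * g t) ^ 2 = 0) :
    (∑ t ∈ s, h t * f t) * (∑ t ∈ s, g t ^ 2) -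
      (∑ t ∈ s, h t * g t) * (∑ t ∈ s, f t * g t) = 0 := by
  set B := ∑ t ∈ s, g t ^ 2 with hB
  set M := ∑ t ∈ s, f t * g t with hM
  have h1 : ∑ t ∈ s, (B * f t + -M * g t) ^ 2 = 0 := by
    rw [sum_linear_sq, ← hM, ← hB]
    linear_combination B * hdet
  have h2 := (Finset.sum_eq_zero_iff_of_nonneg fun t _ => sq_nonneg _).1 h1
  have h3 : (∑ t ∈ s, h t * f t) * B - (∑ t ∈ s, h t * g t) * M =
      ∑ t ∈ s, h t * (B * f t + -M * g t) := by
    rw [Finset.sum_mul, Finset.sum_mul, ← Finset.sum_sub_distrib]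
    exact Finset.sum_congr rfl fun t _ => by ring
  rw [h3]
  exact Finset.sum_eq_zero fun t ht => by rw [pow_eq_zero_iff two_ne_zero |>.1 (h2 t ht), mul_zero]

/-- Stated for general lags p, q so that both numerators of Cramer's rule are covered by exchanging
1 and 2. -/
theorem lsPhi_mul_aux (x : ℤ → ℝ) (n p q : ℕ) (hdet : autocov x n p p 3 * autocov x n q q 3 -
    autocov x n p q 3 ^ 2 = 0) : autocov x n 0 p 3 * autocov x n q q 3 -
    autocov x n 0 q 3 * autocov x n p q 3 = 0 := by
  rcases Nat.eq_zero_or_pos n with rfl | hn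
  · simp [autocov]
  have hn0 : (n : ℝ) ≠ 0 := by positivity
  have key := cramer_numerator_eq_zero (Finset.Icc 3 n)
    (fun t : ℕ => x ((t : ℤ) - p) - sampleMean x n) (fun t : ℕ => x ((t : ℤ) - q) - sampleMean x n)
    (fun t : ℕ => x ((t : ℤ) - (0 : ℕ)) - sampleMean x n)
  simp only [autocov, ← sq] at hdet ⊢
  have h1 := key (by
    field_simp at hdet
    linear_combination hdet)
  field_simp
  linear_combination h1

theorem lsPhi1_mul (x : ℤ → ℝ) (n : ℕ) : lsPhi1 x n * lsDet x n =
    autocov x n 0 1 3 * autocov x n 2 2 3 - autocov x n 0 2 3 * autocov x n 1 2 3 := by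
  by_cases h0 : lsDet x n = 0
  · rw [h0, mul_zero, lsPhi_mul_aux x n 1 2 h0]
  · rw [lsPhi1, div_mul_cancel₀ _ h0]

theorem lsPhi2_mul (x : ℤ → ℝ) (n : ℕ) : lsPhi2 x n * lsDet x n =
    autocov x n 0 2 3 * autocov x n 1 1 3 - autocov x n 0 1 3 * autocov x n 1 2 3 := by
  by_cases h0 : lsDet x n = 0
  · have h1 := lsPhi_mul_aux x n 2 1 (by
      rw [lsDet] at h0
      rw [autocov_comm x n 2 1]
      linear_combination h0)
    rw [autocov_comm x n 2 1] at h1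
    rw [h0, mul_zero, h1]
  · rw [lsPhi2, div_mul_cancel₀ _ h0]

end DeterministicBounds

/-! ### Inverse determinants and negative Gaussian moments -/

section NegativeMoments

open scoped ENNReal

/-- The integrand is a multiple of the Cauchy density with location -B/C and scale √(AC - B²)/C. -/
theorem lintegral_inv_quadratic {A B C : ℝ} (hC : 0 < C) (hdet : 0 < A * C - B ^ 2) :
    ∫⁻ x, ENNReal.ofReal ((A + 2 * B * x + C * x ^ 2)⁻¹) =
      ENNReal.ofReal (Real.pi / √(A * C - B ^ 2)) := by
  set s := √(A * C - B ^ 2) with hs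
  have hs0 : 0 < s := Real.sqrt_pos.2 hdet
  have hs2 : s ^ 2 = A * C - B ^ 2 := Real.sq_sqrt hdet.le
  set g : ℝ≥0 := (s / C).toNNReal with hg
  have hgr : (g : ℝ) = s / C := Real.coe_toNNReal _ (by positivity)
  have hg0 : g ≠ 0 := by
    rw [← NNReal.coe_ne_zero, hgr]
    positivity
  have key : ∀ x, ENNReal.ofReal ((A + 2 * B * x + C * x ^ 2)⁻¹) =
      ENNReal.ofReal (Real.pi / s) * cauchyPDF (-B / C) g x := fun x => by
    rw [cauchyPDF_def, ← ENNReal.ofReal_mul (by positivity), cauchyPDFReal_def, hgr]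
    congr 1
    have e : (x - -B / C) ^ 2 + (s / C) ^ 2 = (A + 2 * B * x + C * x ^ 2) / C := by
      rw [div_pow, hs2]
      field_simp
      ring
    rw [e]
    have := Real.pi_pos.ne'
    field_simp
  simp only [key]
  rw [lintegral_const_mul _ (measurable_cauchyPDF _ _), lintegral_cauchyPDF_eq_one _ hg0, mul_one]

theorem lintegral_pow_le_of_isProbabilityMeasure {α : Type*} [MeasurableSpace α] {ν : Measure α}
    [IsProbabilityMeasure ν] {f : α → ℝ≥0∞} (hf : AEMeasurable f ν) {k : ℕ} (hk : 1 < k) :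
    (∫⁻ x, f x ∂ν) ^ k ≤ ∫⁻ x, f x ^ k ∂ν := by
  have hk1 : (1 : ℝ) < k := by exact_mod_cast hk
  have h1 := ENNReal.lintegral_mul_le_Lp_mul_Lq ν (Real.HolderConjugate.conjExponent hk1) hf
    (aemeasurable_const (b := (1 : ℝ≥0∞)))
  simp only [Pi.mul_apply, mul_one, ENNReal.one_rpow, lintegral_const, measure_univ] at h1
  calc (∫⁻ x, f x ∂ν) ^ k ≤ ((∫⁻ x, f x ^ (k : ℝ) ∂ν) ^ (1 / (k : ℝ))) ^ k := by gcongr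
    _ = ∫⁻ x, f x ^ k ∂ν := by
        rw [← ENNReal.rpow_natCast, ← ENNReal.rpow_mul, one_div, inv_mul_cancel₀ (by linarith),
          ENNReal.rpow_one]
        simp only [ENNReal.rpow_natCast]

/-- Weighting by 1 + x² turns the previous integral into a Cauchy expectation equal to det^{-1/2};
Jensen with exponent 8 follows. The random worst direction of the form is thereby replaced by an
average over fixed directions. -/
theorem inv_det_pow_le_lintegral {A B C : ℝ} (hC : 0 ≤ C) (hdet : 0 ≤ A * C - B ^ 2) :
    ENNReal.ofReal ((A * C - B ^ 2)⁻¹ ^ 4) ≤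
      ∫⁻ x, (ENNReal.ofReal ((A + 2 * B * x + C * x ^ 2) / (1 + x ^ 2)))⁻¹ ^ 8
        ∂(cauchyMeasure 0 1) := by
  -- For a singular form the real inverse 0⁻¹ = 0 makes the left side 0.
  rcases hdet.eq_or_lt with h0 | hdet
  · rw [← h0]
    simp
  have hC : 0 < C := by
    refine lt_of_le_of_ne hC fun h => ?_
    rw [← h] at hdet
    nlinarith [sq_nonneg B]
  set s := √(A * C - B ^ 2) with hs
  have hs0 : 0 < s := Real.sqrt_pos.2 hdet
  have hs2 : s ^ 2 = A * C - B ^ 2 := Real.sq_sqrt hdet.le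
  have hq : ∀ x, 0 < A + 2 * B * x + C * x ^ 2 := fun x => by
    have : C * (A + 2 * B * x + C * x ^ 2) = (A * C - B ^ 2) + (C * x + B) ^ 2 := by ring
    have h2 : 0 < C * (A + 2 * B * x + C * x ^ 2) := by rw [this]; positivity
    exact pos_of_mul_pos_right h2 hC.le
  have hm : Measurable fun x : ℝ =>
      (ENNReal.ofReal ((A + 2 * B * x + C * x ^ 2) / (1 + x ^ 2)))⁻¹ := by fun_prop
  have h1 : ∫⁻ x, (ENNReal.ofReal ((A + 2 * B * x + C * x ^ 2) / (1 + x ^ 2)))⁻¹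
      ∂(cauchyMeasure 0 1) = ENNReal.ofReal (s⁻¹) := by
    rw [cauchyMeasure_of_scale_ne_zero _ one_ne_zero,
      lintegral_withDensity_eq_lintegral_mul _ (measurable_cauchyPDF _ _) hm]
    have key : ∀ x, (cauchyPDF 0 1 * fun x =>
        (ENNReal.ofReal ((A + 2 * B * x + C * x ^ 2) / (1 + x ^ 2)))⁻¹) x =
        ENNReal.ofReal (Real.pi⁻¹) * ENNReal.ofReal ((A + 2 * B * x + C * x ^ 2)⁻¹) := fun x => by
      have := hq x
      rw [Pi.mul_apply, cauchyPDF_def, ← ENNReal.ofReal_inv_of_pos (by positivity),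
        ← ENNReal.ofReal_mul (cauchyPDF_pos 0 one_ne_zero x).le,
        ← ENNReal.ofReal_mul (by positivity), cauchyPDFReal_def]
      congr 1
      simp only [NNReal.coe_one, sub_zero]
      field_simp
      ring
    simp only [key]
    rw [lintegral_const_mul _ (by fun_prop), lintegral_inv_quadratic hC hdet,
      ← ENNReal.ofReal_mul (by positivity)]
    congr 1
    have := Real.pi_pos.ne'
    rw [← hs]
    field_simp
  refine le_trans (le_of_eq ?_)
    (lintegral_pow_le_of_isProbabilityMeasure hm.aemeasurable (by norm_num : 1 < 8))
  rw [h1, ← ENNReal.ofReal_pow (by positivity), ← hs2]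
  congr 1
  rw [inv_pow, inv_pow, ← pow_mul]

/-- `|x| ^ (-1/2)` as an extended non-negative real. -/
noncomputable def invSqrtAbs (x : ℝ) : ℝ≥0∞ := (ENNReal.ofReal |x| ^ (1 / 2 : ℝ))⁻¹

theorem measurable_invSqrtAbs : Measurable invSqrtAbs := by
  unfold invSqrtAbs
  fun_prop

theorem lintegral_invSqrtAbs_lt_top : ∫⁻ x in Set.Icc (-1) 1, invSqrtAbs x < ∞ := by
  have hpos : ∫⁻ x in Set.Ioc 0 1, invSqrtAbs x < ∞ := by
    have h1 : IntegrableOn (fun x : ℝ => x ^ (-(1 / 2) : ℝ)) (Set.Ioc 0 1) :=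
      (intervalIntegrable_iff_integrableOn_Ioc_of_le zero_le_one).1
        (intervalIntegral.intervalIntegrable_rpow' (by norm_num))
    refine lt_of_eq_of_lt ?_ h1.lintegral_lt_top
    refine setLIntegral_congr_fun measurableSet_Ioc fun x hx => ?_
    simp only [invSqrtAbs]
    rw [abs_of_pos hx.1, ENNReal.ofReal_rpow_of_pos hx.1, Real.rpow_neg hx.1.le,
      ENNReal.ofReal_inv_of_pos (Real.rpow_pos_of_pos hx.1 _)]
  have hneg : ∫⁻ x in Set.Ico (-1) 0, invSqrtAbs x = ∫⁻ x in Set.Ioc 0 1, invSqrtAbs x := by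
    have h2 := (Measure.measurePreserving_neg (volume : Measure ℝ)).setLIntegral_comp_preimage
      (s := Set.Ioc (0 : ℝ) 1) measurableSet_Ioc measurable_invSqrtAbs
    rw [← h2]
    have e : (Neg.neg : ℝ → ℝ) ⁻¹' Set.Ioc 0 1 = Set.Ico (-1) 0 := by
      ext x
      simp only [Set.mem_preimage, Set.mem_Ioc, Set.mem_Ico]
      constructor <;> rintro ⟨h1, h2⟩ <;> constructor <;> linarith
    rw [e]
    simp only [invSqrtAbs, abs_neg]
  have hsub : Set.Icc (-1 : ℝ) 1 ⊆ (Set.Ico (-1) 0 ∪ Set.Ioc 0 1) ∪ {0} := by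
    rintro x ⟨h1, h2⟩
    rcases lt_trichotomy x 0 with h | h | h
    · exact Or.inl (Or.inl ⟨h1, h⟩)
    · exact Or.inr h
    · exact Or.inl (Or.inr ⟨h, h2⟩)
  calc ∫⁻ x in Set.Icc (-1) 1, invSqrtAbs x
      ≤ ∫⁻ x in (Set.Ico (-1) 0 ∪ Set.Ioc 0 1) ∪ {0}, invSqrtAbs x := lintegral_mono_set hsub
    _ ≤ (∫⁻ x in Set.Ico (-1) 0, invSqrtAbs x) + (∫⁻ x in Set.Ioc 0 1, invSqrtAbs x) +
        ∫⁻ x in {0}, invSqrtAbs x :=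
        (lintegral_union_le _ _ _).trans (add_le_add (lintegral_union_le _ _ _) le_rfl)
    _ < ∞ := by
        have h0 : ∫⁻ x in ({0} : Set ℝ), invSqrtAbs x = 0 :=
          setLIntegral_measure_zero _ _ Real.volume_singleton
        rw [hneg, h0, add_zero]
        exact ENNReal.add_lt_top.2 ⟨hpos, hpos⟩

/-- Negative moments of Gaussian variables, uniformly for variance bounded below. -/
theorem lintegral_invSqrtAbs_gaussian_le {c : ℝ≥0} (hc : 0 < c) : ∃ K : ℝ≥0∞, K < ∞ ∧
    ∀ s : ℝ≥0, c ≤ s → ∫⁻ x, invSqrtAbs x ∂(gaussianReal 0 s) ≤ K := by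
  set D : ℝ≥0∞ := ENNReal.ofReal ((√(2 * Real.pi * c))⁻¹) with hD
  refine ⟨D * (∫⁻ x in Set.Icc (-1) 1, invSqrtAbs x) + 1, ENNReal.add_lt_top.2
    ⟨ENNReal.mul_lt_top ENNReal.ofReal_lt_top lintegral_invSqrtAbs_lt_top, ENNReal.one_lt_top⟩,
    fun s hs => ?_⟩
  have hs0 : s ≠ 0 := (hc.trans_le hs).ne'
  -- The singularity at 0 is integrable against a bounded density, and outside [-1, 1] the function
  -- is at most 1. A lower bound on the variance bounds the density.
  have hle : ∀ x, invSqrtAbs x ≤ (Set.Icc (-1) 1).indicator invSqrtAbs x + 1 := fun x => by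
    by_cases hx : x ∈ Set.Icc (-1 : ℝ) 1
    · rw [Set.indicator_of_mem hx]
      exact le_self_add
    · rw [Set.indicator_of_notMem hx, zero_add, invSqrtAbs, ENNReal.inv_le_one]
      refine ENNReal.one_le_rpow ?_ (by norm_num)
      rw [ENNReal.one_le_ofReal]
      by_contra! h
      exact hx (abs_le.1 h.le)
  have hpdf : ∀ x, gaussianPDF 0 s x ≤ D := fun x => by
    rw [gaussianPDF, hD]
    refine ENNReal.ofReal_le_ofReal ?_
    rw [gaussianPDFReal]
    have h1 : Real.exp (-(x - 0) ^ 2 / (2 * s)) ≤ 1 := by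
      rw [Real.exp_le_one_iff]
      exact div_nonpos_of_nonpos_of_nonneg (by nlinarith [sq_nonneg (x - 0)]) (by positivity)
    have hc' : (0 : ℝ) < c := by exact_mod_cast hc
    have hs' : (c : ℝ) ≤ s := by exact_mod_cast hs
    have h2 : (√(2 * Real.pi * s))⁻¹ ≤ (√(2 * Real.pi * c))⁻¹ := by
      have := Real.pi_pos
      gcongr
    calc _ ≤ (√(2 * Real.pi * c))⁻¹ * 1 := by gcongr
      _ = _ := mul_one _
  calc ∫⁻ x, invSqrtAbs x ∂(gaussianReal 0 s)
      ≤ ∫⁻ x, ((Set.Icc (-1) 1).indicator invSqrtAbs x + 1) ∂(gaussianReal 0 s) :=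
        lintegral_mono hle
    _ = ∫⁻ x, (Set.Icc (-1) 1).indicator invSqrtAbs x ∂(gaussianReal 0 s) + 1 := by
        rw [lintegral_add_right _ measurable_const]
        simp
    _ ≤ D * (∫⁻ x in Set.Icc (-1) 1, invSqrtAbs x) + 1 := by
        gcongr
        have hmi : Measurable ((Set.Icc (-1 : ℝ) 1).indicator invSqrtAbs) :=
          measurable_invSqrtAbs.indicator measurableSet_Icc
        rw [gaussianReal_of_var_ne_zero 0 hs0,
          lintegral_withDensity_eq_lintegral_mul _ (measurable_gaussianPDF 0 s) hmi,
          ← lintegral_indicator measurableSet_Icc, ← lintegral_const_mul _ hmi]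
        refine lintegral_mono fun x => ?_
        rw [Pi.mul_apply]
        gcongr
        exact hpdf x

end NegativeMoments

/-! ### Independent windows of innovations below the regression form -/

section LeastSquaresMoments

open scoped ENNReal

variable {Ω : Type*} [MeasurableSpace Ω] {P : Measure Ω}

namespace IsCausalAR2

variable [IsProbabilityMeasure P] {φ₁ φ₂ : ℝ} {v : ℝ≥0} {F : ℤ → MeasurableSpace Ω} {γ : ℤ → ℝ}
  {a y : ℤ → Ω → ℝ}

/-- A normalized combination of three consecutive innovations. -/
noncomputable def window (a : ℤ → Ω → ℝ) (i : ℕ) (x : ℝ) (ω : Ω) : ℝ :=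
  (a (5 + 4 * i) ω + (x - 1) * a (4 + 4 * i) ω + -x * a (3 + 4 * i) ω) / √(1 + x ^ 2)

omit [IsProbabilityMeasure P] in
theorem window_law (h : IsCausalAR2 P φ₁ φ₂ v F γ a y) (i : ℕ) (x : ℝ) :
    ∃ s : ℝ≥0, v ≤ s ∧ P.map (window a i x) = gaussianReal 0 s := by
  have hx : 0 < √(1 + x ^ 2) := Real.sqrt_pos.2 (by positivity)
  have hx2 : √(1 + x ^ 2) ^ 2 = 1 + x ^ 2 := Real.sq_sqrt (by positivity)
  set c := (√(1 + x ^ 2))⁻¹ with hc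
  have l1 := gaussianReal_const_mul (h.law (5 + 4 * i)) c
  have l2 := gaussianReal_const_mul (h.law (4 + 4 * i)) (c * (x - 1))
  have l3 := gaussianReal_const_mul (h.law (3 + 4 * i)) (c * -x)
  rw [mul_zero] at l1 l2 l3
  have m3 : Measurable[F (3 + 4 * i)] (fun ω => c * -x * a (3 + 4 * i) ω) :=
    (h.a_meas _).const_mul _
  have m2 : Measurable[F (4 + 4 * i)] (fun ω => c * (x - 1) * a (4 + 4 * i) ω) :=
    (h.a_meas _).const_mul _
  have i1 : IndepFun (fun ω => c * -x * a (3 + 4 * i) ω) (fun ω => c * (x - 1) * a (4 + 4 * i) ω)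
      P := (h.indep (4 + 4 * i) _ (m3.mono (h.mono (by omega)) le_rfl)).comp measurable_id
        (measurable_const_mul (c * (x - 1)))
  have l32 := gaussianReal_add_gaussianReal_of_indepFun i1 l3.map_eq l2.map_eq
  have m32 : Measurable[F (4 + 4 * i)] ((fun ω => c * -x * a (3 + 4 * i) ω) +
      (fun ω => c * (x - 1) * a (4 + 4 * i) ω)) :=
    (m3.mono (h.mono (by omega)) le_rfl).add m2
  have i2 : IndepFun ((fun ω => c * -x * a (3 + 4 * i) ω) +
      (fun ω => c * (x - 1) * a (4 + 4 * i) ω)) (fun ω => c * a (5 + 4 * i) ω) P :=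
    (h.indep (5 + 4 * i) _ (m32.mono (h.mono (by omega)) le_rfl)).comp measurable_id
        (measurable_const_mul c)
  have l := gaussianReal_add_gaussianReal_of_indepFun i2 l32 l1.map_eq
  simp only [add_zero] at l
  have hw : window a i x = ((fun ω => c * -x * a (3 + 4 * i) ω) +
      (fun ω => c * (x - 1) * a (4 + 4 * i) ω)) + fun ω => c * a (5 + 4 * i) ω := by
    funext ω
    simp only [window, Pi.add_apply, hc]
    ring
  refine ⟨_, ?_, hw ▸ l⟩
  · rw [← NNReal.coe_le_coe]
    push_cast
    have hcx : c ^ 2 * (1 + x ^ 2) = 1 := by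
      rw [hc, inv_pow, hx2]
      field_simp
    have hv := v.2
    -- The outer two innovations alone contribute variance v, because c²(1 + x²) = 1.
    have e : (c * -x) ^ 2 * (v : ℝ) + (c * (x - 1)) ^ 2 * v + c ^ 2 * v =
        v + (c * (x - 1)) ^ 2 * v := by
      linear_combination (v : ℝ) * hcx
    rw [e]
    have : 0 ≤ (c * (x - 1)) ^ 2 * (v : ℝ) := by positivity
    linarith

omit [IsProbabilityMeasure P] in
theorem measurable_a (h : IsCausalAR2 P φ₁ φ₂ v F γ a y) (t : ℤ) : Measurable (a t) :=
  (h.a_meas t).mono (h.le t) le_rfl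

omit [IsProbabilityMeasure P] in
theorem window_measurable (h : IsCausalAR2 P φ₁ φ₂ v F γ a y) (i : ℕ) (x : ℝ) :
    Measurable[F (5 + 4 * i)] (window a i x) := by
  unfold window
  have m1 := h.a_meas (5 + 4 * i)
  have m2 := (h.a_meas (4 + 4 * i)).mono (h.mono (by omega : (4 + 4 * i : ℤ) ≤ 5 + 4 * i)) le_rfl
  have m3 := (h.a_meas (3 + 4 * i)).mono (h.mono (by omega : (3 + 4 * i : ℤ) ≤ 5 + 4 * i)) le_rfl
  exact ((m1.add (m2.const_mul _)).add (m3.const_mul _)).div_const _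

omit [MeasurableSpace Ω] in
theorem window_measurable_future (i : ℕ) (x : ℝ) :
    Measurable[⨆ s ∈ Set.Ioi (2 + 4 * i : ℤ), MeasurableSpace.comap (a s) inferInstance]
      (window a i x) := by
  have m : ∀ s : ℤ, 2 + 4 * i < s →
      Measurable[⨆ s ∈ Set.Ioi (2 + 4 * i : ℤ), MeasurableSpace.comap (a s) inferInstance] (a s) :=
    fun s hs => Measurable.mono (comap_measurable (a s))
      (le_iSup₂_of_le (f := fun (s : ℤ) (_ : s ∈ Set.Ioi (2 + 4 * i : ℤ)) =>
        MeasurableSpace.comap (a s) inferInstance) s hs le_rfl) le_rfl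
  unfold window
  exact (((m _ (by omega)).add ((m _ (by omega)).const_mul _)).add
    ((m _ (by omega)).const_mul _)).div_const _

/-- Windows with index below k are known by time 4k + 1, while window k uses only innovations after
time 4k + 2. The expectation of the product therefore factorizes. -/
theorem lintegral_prod_window_le (h : IsCausalAR2 P φ₁ φ₂ v F γ a y) {K : ℝ≥0∞}
    (hK : ∀ s : ℝ≥0, v ≤ s → ∫⁻ x, invSqrtAbs x ∂(gaussianReal 0 s) ≤ K) (x : ℝ) (k : ℕ) :
    ∫⁻ ω, ∏ i ∈ Finset.range k, invSqrtAbs (window a i x ω) ∂P ≤ K ^ k := by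
  have hE : ∀ i, ∫⁻ ω, invSqrtAbs (window a i x ω) ∂P ≤ K := fun i => by
    obtain ⟨s, hs, hl⟩ := h.window_law i x
    rw [← lintegral_map measurable_invSqrtAbs
      ((h.window_measurable i x).mono (h.le _) le_rfl), hl]
    exact hK s hs
  induction k with
  | zero => simp
  | succ k ih =>
    simp only [Finset.prod_range_succ]
    have mp : Measurable[F (2 + 4 * k)]
        (fun ω => ∏ i ∈ Finset.range k, invSqrtAbs (window a i x ω)) := by
      refine Finset.measurable_fun_prod _ fun i hi => measurable_invSqrtAbs.comp ?_
      have := Finset.mem_range.1 hi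
      exact (h.window_measurable i x).mono (h.mono (by omega)) le_rfl
    have mk : Measurable[⨆ s ∈ Set.Ioi (2 + 4 * k : ℤ), MeasurableSpace.comap (a s) inferInstance]
        (fun ω => invSqrtAbs (window a k x ω)) :=
      measurable_invSqrtAbs.comp (window_measurable_future k x)
    rw [lintegral_mul_eq_lintegral_mul_lintegral_of_independent_measurableSpace (h.le _)
      (iSup₂_le fun s _ => (h.measurable_a s).comap_le) (h.indep_future (2 + 4 * k)) mp mk, pow_succ]
    exact mul_le_mul' ih (hE k)

omit [IsProbabilityMeasure P] in
/-- The bound of a combination of innovations by the sum of squares of the regressors. -/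
theorem window_sq_le (h : IsCausalAR2 P φ₁ φ₂ v F γ a y) {i n : ℕ} (hn : 6 + 4 * i ≤ n) (x : ℝ)
    (ω : Ω) (c : ℝ) :
    (a (5 + 4 * i) ω + (x - 1) * a (4 + 4 * i) ω + -x * a (3 + 4 * i) ω) ^ 2 ≤
      4 * (1 + (1 + φ₁) ^ 2 + (φ₁ - φ₂) ^ 2 + φ₂ ^ 2) *
      ∑ t ∈ Finset.Icc 3 n, (1 * (y ((t : ℤ) - (1 : ℕ)) ω - c) +
        x * (y ((t : ℤ) - (2 : ℕ)) ω - c)) ^ 2 := by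
  set X : ℕ → ℝ := fun t => 1 * (y ((t : ℤ) - (1 : ℕ)) ω - c) +
    x * (y ((t : ℤ) - (2 : ℕ)) ω - c) with hX
  have hsub : X (3 + 4 * i) ^ 2 + X (4 + 4 * i) ^ 2 + X (5 + 4 * i) ^ 2 + X (6 + 4 * i) ^ 2 ≤
      ∑ t ∈ Finset.Icc 3 n, X t ^ 2 := by
    have h1 : Finset.Icc (3 + 4 * i) (3 + 4 * i + 3) ⊆ Finset.Icc 3 n :=
      Finset.Icc_subset_Icc (by omega) (by omega)
    refine le_trans (le_of_eq ?_) (Finset.sum_le_sum_of_subset_of_nonneg h1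
      fun t _ _ => sq_nonneg _)
    rw [Finset.sum_Icc_succ_top (by omega), Finset.sum_Icc_succ_top (by omega),
      Finset.sum_Icc_succ_top (by omega), Finset.Icc_self, Finset.sum_singleton]
    ring_nf
  -- The filter (1 - B)(1 - φ₁B - φ₂B²), with B the backward shift, is applied to X. The
  -- autoregressive factor leaves innovations, and the difference removes the constant c, which will
  -- be the random sample mean.
  have hW : a (5 + 4 * i) ω + (x - 1) * a (4 + 4 * i) ω + -x * a (3 + 4 * i) ω =
      X (6 + 4 * i) - (1 + φ₁) * X (5 + 4 * i) + (φ₁ - φ₂) * X (4 + 4 * i) +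
        φ₂ * X (3 + 4 * i) := by
    have r1 := h.recursion (5 + 4 * i) ω
    have r2 := h.recursion (4 + 4 * i) ω
    have r3 := h.recursion (3 + 4 * i) ω
    simp only [hX]
    push_cast
    ring_nf at r1 r2 r3 ⊢
    linear_combination -r1 - (x - 1) * r2 + x * r3
  rw [hW]
  set p := X (6 + 4 * i)
  set q := X (5 + 4 * i)
  set r := X (4 + 4 * i)
  set s := X (3 + 4 * i)
  have h4 : ∀ a b c d : ℝ, (a + b + c + d) ^ 2 ≤ 4 * (a ^ 2 + b ^ 2 + c ^ 2 + d ^ 2) :=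
    fun a b c d => by
      nlinarith [sq_nonneg (a - b), sq_nonneg (a - c), sq_nonneg (a - d),
        sq_nonneg (b - c), sq_nonneg (b - d), sq_nonneg (c - d)]
  have h5 := h4 p (-(1 + φ₁) * q) ((φ₁ - φ₂) * r) (φ₂ * s)
  set T := 1 + (1 + φ₁) ^ 2 + (φ₁ - φ₂) ^ 2 + φ₂ ^ 2 with hT
  have k1 : p ^ 2 ≤ T * p ^ 2 :=
    le_mul_of_one_le_left (sq_nonneg p) (by
      linarith [sq_nonneg (1 + φ₁), sq_nonneg (φ₁ - φ₂), sq_nonneg φ₂])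
  have k2 : (-(1 + φ₁) * q) ^ 2 ≤ T * q ^ 2 := by
    rw [mul_pow, neg_sq]
    exact mul_le_mul_of_nonneg_right (by
      linarith [sq_nonneg (φ₁ - φ₂), sq_nonneg φ₂]) (sq_nonneg q)
  have k3 : ((φ₁ - φ₂) * r) ^ 2 ≤ T * r ^ 2 := by
    rw [mul_pow]
    exact mul_le_mul_of_nonneg_right (by
      linarith [sq_nonneg (1 + φ₁), sq_nonneg φ₂]) (sq_nonneg r)
  have k4 : (φ₂ * s) ^ 2 ≤ T * s ^ 2 := by
    rw [mul_pow]
    exact mul_le_mul_of_nonneg_right (by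
      linarith [sq_nonneg (1 + φ₁), sq_nonneg (φ₁ - φ₂)]) (sq_nonneg s)
  have hT0 : 0 ≤ T := by positivity
  have h6 := mul_le_mul_of_nonneg_left hsub hT0
  have e : p - (1 + φ₁) * q + (φ₁ - φ₂) * r + φ₂ * s =
      p + -(1 + φ₁) * q + (φ₁ - φ₂) * r + φ₂ * s := by ring
  rw [e]
  linarith

end IsCausalAR2

end LeastSquaresMoments

/-! ### Second moments of the least squares estimators -/

section LeastSquaresIntegrability

open scoped ENNReal

/-- Each factor |V|^{-1/2} is at least (Mr)^{-1/4}, so 32 = 4 · 8 factors are needed to dominate r⁻⁸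
up to the constant M⁸. -/
theorem inv_pow_le_prod_invSqrtAbs {M r : ℝ} (hM : 0 < M) (V : ℕ → ℝ)
    (hV : ∀ i < 32, V i ^ 2 ≤ M * r) :
    (ENNReal.ofReal r)⁻¹ ^ 8 ≤
      ENNReal.ofReal M ^ 8 * ∏ i ∈ Finset.range 32, invSqrtAbs (V i) := by
  have h1 : ∀ i < 32, (ENNReal.ofReal (M * r))⁻¹ ≤ invSqrtAbs (V i) ^ 4 := fun i hi => by
    have e : invSqrtAbs (V i) ^ 4 = (ENNReal.ofReal (V i ^ 2))⁻¹ := by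
      rw [invSqrtAbs, ← ENNReal.inv_pow, ← ENNReal.rpow_mul_natCast, ← sq_abs,
        ENNReal.ofReal_pow (abs_nonneg _)]
      norm_num
    rw [e]
    exact ENNReal.inv_le_inv.2 (ENNReal.ofReal_le_ofReal (hV i hi))
  have h2 : ((ENNReal.ofReal (M * r))⁻¹ ^ 8) ^ 4 ≤
      (∏ i ∈ Finset.range 32, invSqrtAbs (V i)) ^ 4 := by
    rw [← Finset.prod_pow, ← pow_mul]
    calc (ENNReal.ofReal (M * r))⁻¹ ^ (8 * 4)
        = ∏ _i ∈ Finset.range 32, (ENNReal.ofReal (M * r))⁻¹ := by simp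
      _ ≤ _ := Finset.prod_le_prod' fun i hi => h1 i (Finset.mem_range.1 hi)
  have h3 : (ENNReal.ofReal (M * r))⁻¹ ^ 8 ≤ ∏ i ∈ Finset.range 32, invSqrtAbs (V i) :=
    (ENNReal.pow_le_pow_left_iff (by norm_num)).1 h2
  have h4 : (ENNReal.ofReal r)⁻¹ = ENNReal.ofReal M * (ENNReal.ofReal (M * r))⁻¹ := by
    have hM0 : ENNReal.ofReal M ≠ 0 := (ENNReal.ofReal_pos.2 hM).ne'
    rw [ENNReal.ofReal_mul hM.le, ENNReal.mul_inv (Or.inl hM0) (Or.inl ENNReal.ofReal_ne_top),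
      ← mul_assoc, ENNReal.mul_inv_cancel hM0 ENNReal.ofReal_ne_top, one_mul]
  rw [h4, mul_pow]
  exact mul_le_mul' le_rfl h3

theorem autocov_quadratic (x : ℤ → ℝ) (n : ℕ) (s : ℝ) :
    autocov x n 1 1 3 + 2 * autocov x n 1 2 3 * s + autocov x n 2 2 3 * s ^ 2 =
      (∑ t ∈ Finset.Icc 3 n, (1 * (x ((t : ℤ) - (1 : ℕ)) - sampleMean x n) +
        s * (x ((t : ℤ) - (2 : ℕ)) - sampleMean x n)) ^ 2) / n := by
  rw [sum_linear_sq]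
  simp only [autocov, ← sq]
  ring

theorem lsDet_nonneg (x : ℤ → ℝ) (n : ℕ) : 0 ≤ lsDet x n := by
  have h := discrim_le_zero (a := autocov x n 2 2 3) (b := 2 * autocov x n 1 2 3)
    (c := autocov x n 1 1 3) fun s => by
      have := autocov_quadratic x n s
      have h2 : 0 ≤ autocov x n 1 1 3 + 2 * autocov x n 1 2 3 * s + autocov x n 2 2 3 * s ^ 2 := by
        rw [this]
        positivity
      linarith
  rw [discrim] at h
  rw [lsDet]
  linarith

variable {Ω : Type*} [MeasurableSpace Ω] {P : Measure Ω}

namespace IsCausalAR2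

variable [IsProbabilityMeasure P] {φ₁ φ₂ : ℝ} {v : ℝ≥0} {F : ℤ → MeasurableSpace Ω} {γ : ℤ → ℝ}
  {a y : ℤ → Ω → ℝ}

/-- By Tonelli the direction x is fixed first, and then the windows for that x are independent. The
bound 130 = 6 + 4 · 31 is the last time needed by the 32 windows. -/
theorem lintegral_inv_lsDet_le (h : IsCausalAR2 P φ₁ φ₂ v F γ a y) {K : ℝ≥0∞}
    (hK : ∀ s : ℝ≥0, v ≤ s → ∫⁻ x, invSqrtAbs x ∂(gaussianReal 0 s) ≤ K) {n : ℕ}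
    (hn : 130 ≤ n) :
    ∫⁻ ω, ENNReal.ofReal ((lsDet (fun t => y t ω) n)⁻¹ ^ 4) ∂P ≤
      ENNReal.ofReal (n * (4 * (1 + (1 + φ₁) ^ 2 + (φ₁ - φ₂) ^ 2 + φ₂ ^ 2))) ^ 8 * K ^ 32 := by
  set M : ℝ := n * (4 * (1 + (1 + φ₁) ^ 2 + (φ₁ - φ₂) ^ 2 + φ₂ ^ 2)) with hM
  have hn0 : (0 : ℝ) < n := by exact_mod_cast (by omega : 0 < n)
  have hM0 : 0 < M := by positivity
  have hma := fun t => h.measurable_a t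
  have hmeas : Measurable fun p : Ω × ℝ => ENNReal.ofReal M ^ 8 *
      ∏ i ∈ Finset.range 32, invSqrtAbs (window a i p.2 p.1) := by
    refine Measurable.const_mul (Finset.measurable_fun_prod _ fun i _ =>
      measurable_invSqrtAbs.comp ?_) _
    have hf : Measurable (fun p : Ω × ℝ => p.1) := measurable_fst
    have h1 := (hma (5 + 4 * i)).comp hf
    have h2 := (hma (4 + 4 * i)).comp hf
    have h3 := (hma (3 + 4 * i)).comp hf
    have h4 : Measurable (fun p : Ω × ℝ => p.2) := measurable_snd
    unfold window
    exact ((h1.add ((h4.sub_const 1).mul h2)).add (h4.neg.mul h3)).div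
      ((h4.pow_const 2).const_add 1).sqrt
  calc ∫⁻ ω, ENNReal.ofReal ((lsDet (fun t => y t ω) n)⁻¹ ^ 4) ∂P
      ≤ ∫⁻ ω, ∫⁻ x, ENNReal.ofReal M ^ 8 *
          ∏ i ∈ Finset.range 32, invSqrtAbs (window a i x ω) ∂(cauchyMeasure 0 1) ∂P := by
        refine lintegral_mono fun ω => ?_
        refine le_trans (inv_det_pow_le_lintegral ?_ (lsDet_nonneg _ _)) (lintegral_mono fun x => ?_)
        · have := autocov_quadratic (fun t => y t ω) n
          rw [autocov]
          simp only [← sq]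
          positivity
        · refine inv_pow_le_prod_invSqrtAbs hM0 _ fun i hi => ?_
          rw [autocov_quadratic, window, div_pow, Real.sq_sqrt (by positivity)]
          have h1 := h.window_sq_le (i := i) (n := n) (by omega) x ω
            (sampleMean (fun t => y t ω) n)
          have h2 := div_le_div_of_nonneg_right h1 (by positivity : (0 : ℝ) ≤ 1 + x ^ 2)
          refine h2.trans (le_of_eq ?_)
          rw [hM]
          field_simp
    _ = ∫⁻ x, ∫⁻ ω, ENNReal.ofReal M ^ 8 *
          ∏ i ∈ Finset.range 32, invSqrtAbs (window a i x ω) ∂P ∂(cauchyMeasure 0 1) :=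
        lintegral_lintegral_swap hmeas.aemeasurable
    _ ≤ ∫⁻ _x, ENNReal.ofReal M ^ 8 * K ^ 32 ∂(cauchyMeasure 0 1) := by
        refine lintegral_mono fun x => ?_
        rw [lintegral_const_mul]
        · exact mul_le_mul' le_rfl (h.lintegral_prod_window_le hK x 32)
        · exact Finset.measurable_fun_prod _ fun i _ => measurable_invSqrtAbs.comp
            ((h.window_measurable i x).mono (h.le _) le_rfl)
    _ = _ := by simp

/-- Quotients by the determinant of the normal equations have polynomially bounded second moments. -/
theorem sq_moment_of_mul_lsDet (h : IsCausalAR2 P φ₁ φ₂ v F γ a y) (hv : 0 < v)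
    {T N : ℕ → Ω → ℝ} (hN : BddMoments P N)
    (hT : ∀ n ω, T n ω = N n ω / lsDet (fun t => y t ω) n) :
    ∃ K : ℝ, ∀ᶠ n : ℕ in atTop, Integrable (fun ω => T n ω ^ 2) P ∧
      ∫ ω, T n ω ^ 2 ∂P ≤ K * (n : ℝ) ^ 8 := by
  obtain ⟨K, hKt, hK⟩ := lintegral_invSqrtAbs_gaussian_le hv
  obtain ⟨C, hC⟩ := hN.bound 2
  set L := 4 * (1 + (1 + φ₁) ^ 2 + (φ₁ - φ₂) ^ 2 + φ₂ ^ 2) with hL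
  have hL0 : 0 < L := by positivity
  refine ⟨|C| + L ^ 8 * (K ^ 32).toReal, ?_⟩
  filter_upwards [eventually_ge_atTop 130] with n hn
  have hn1 : (1 : ℝ) ≤ n := by exact_mod_cast (by omega : 1 ≤ n)
  have hm : AEStronglyMeasurable (fun ω => lsDet (fun t => y t ω) n) P := by
    have := fun m k => (h.autocov_bdd m k 3 n).aesm ()
    exact ((this 1 1).mul (this 2 2)).sub ((this 1 2).pow 2)
  have hm4 : AEStronglyMeasurable (fun ω => (lsDet (fun t => y t ω) n)⁻¹ ^ 4) P :=
    (hm.aemeasurable.inv.pow_const 4).aestronglyMeasurable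
  have hb := h.lintegral_inv_lsDet_le hK hn
  rw [← hL] at hb
  have hbt : ENNReal.ofReal (n * L) ^ 8 * K ^ 32 < ∞ :=
    ENNReal.mul_lt_top (ENNReal.pow_lt_top ENNReal.ofReal_lt_top) (ENNReal.pow_lt_top hKt)
  have hpos : ∀ ω, 0 ≤ (lsDet (fun t => y t ω) n)⁻¹ ^ 4 := fun ω => by positivity
  have hi : Integrable (fun ω => (lsDet (fun t => y t ω) n)⁻¹ ^ 4) P :=
    ⟨hm4, (hasFiniteIntegral_iff_ofReal (Eventually.of_forall hpos)).2 (hb.trans_lt hbt)⟩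
  have hI : ∫ ω, (lsDet (fun t => y t ω) n)⁻¹ ^ 4 ∂P ≤ (n * L) ^ 8 * (K ^ 32).toReal := by
    rw [integral_eq_lintegral_of_nonneg_ae (Eventually.of_forall hpos) hm4]
    refine (ENNReal.toReal_mono hbt.ne hb).trans (le_of_eq ?_)
    rw [ENNReal.toReal_mul, ENNReal.toReal_pow, ENNReal.toReal_ofReal (by positivity)]
  -- The inequality 2uv ≤ u² + v² separates numerator from determinant, which is why the fourth
  -- inverse power is controlled.
  have hle : ∀ ω, T n ω ^ 2 ≤ N n ω ^ (2 * 2) + (lsDet (fun t => y t ω) n)⁻¹ ^ 4 := fun ω => by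
    rw [hT, div_eq_mul_inv]
    nlinarith [sq_nonneg (N n ω ^ 2 - (lsDet (fun t => y t ω) n)⁻¹ ^ 2),
      sq_nonneg (N n ω * (lsDet (fun t => y t ω) n)⁻¹)]
  have hTm : AEStronglyMeasurable (T n) P := by
    have : T n = fun ω => N n ω / lsDet (fun t => y t ω) n := funext (hT n)
    rw [this]
    exact ((hN.aesm n).aemeasurable.div hm.aemeasurable).aestronglyMeasurable
  have hs := (hC n).1.add hi
  have hTi : Integrable (fun ω => T n ω ^ 2) P :=
    hs.mono' (hTm.pow 2) (Eventually.of_forall fun ω => by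
      rw [Real.norm_of_nonneg (sq_nonneg _)]
      exact hle ω)
  refine ⟨hTi, (integral_mono hTi hs hle).trans ?_⟩
  rw [integral_add' (hC n).1 hi]
  have h1 := (hC n).2
  have h2 : |C| ≤ |C| * (n : ℝ) ^ 8 := le_mul_of_one_le_right (abs_nonneg _) (one_le_pow₀ hn1)
  have h3 := le_abs_self C
  have e : (|C| + L ^ 8 * (K ^ 32).toReal) * (n : ℝ) ^ 8 =
      |C| * (n : ℝ) ^ 8 + (n * L) ^ 8 * (K ^ 32).toReal := by ring
  rw [e]
  linarith

end IsCausalAR2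

end LeastSquaresIntegrability

/-! ### Geometric decay of the impulse response -/

section ImpulseResponse

open scoped ENNReal

/-- The solutions of an admissible recursion are bounded. -/
theorem IsCausalAR2.Admissible.exists_abs_le {φ₁ φ₂ : ℝ} (h : IsCausalAR2.Admissible φ₁ φ₂)
    {d : ℕ → ℝ} (hd : ∀ j, d (j + 2) = φ₁ * d (j + 1) + φ₂ * d j) : ∃ K, ∀ j, |d j| ≤ K := by
  obtain ⟨r, hr, h1, h2, h3, h4⟩ := h.exists_param
  -- A Lyapunov function: positive definite since |r| < 1, and decreasing along the recursion by (1
  -- - φ₂²)(d j - r d (j+1))².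
  set V : ℕ → ℝ := fun j => d (j + 1) ^ 2 + d j ^ 2 - 2 * r * d (j + 1) * d j with hV
  have hstep : ∀ j, V (j + 1) ≤ V j := fun j => by
    have e : V j - V (j + 1) = ((1 - φ₂) * (1 + φ₂)) * (d j - r * d (j + 1)) ^ 2 := by
      simp only [hV, hd, hr]
      ring
    have : 0 ≤ ((1 - φ₂) * (1 + φ₂)) * (d j - r * d (j + 1)) ^ 2 := by positivity
    linarith
  have hmono : ∀ j, V j ≤ V 0 := fun j => antitone_nat_of_succ_le hstep (Nat.zero_le j)
  have hpos : 0 < (1 - r) * (1 + r) := by positivity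
  refine ⟨√(V 0 / ((1 - r) * (1 + r))), fun j => Real.abs_le_sqrt ?_⟩
  rw [le_div_iff₀ hpos]
  have e : V j = (d (j + 1) - r * d j) ^ 2 + d j ^ 2 * ((1 - r) * (1 + r)) := by
    simp only [hV]
    ring
  linarith [hmono j, sq_nonneg (d (j + 1) - r * d j)]

/-- The admissible region is open. Dividing a solution by ρ^j changes its coefficients to φ₁/ρ and
φ₂/ρ², so boundedness of the rescaled solution becomes geometric decay of the original. -/
theorem IsCausalAR2.Admissible.exists_scale {φ₁ φ₂ : ℝ} (h : IsCausalAR2.Admissible φ₁ φ₂) :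
    ∃ ρ : ℝ, 0 < ρ ∧ ρ < 1 ∧ IsCausalAR2.Admissible (φ₁ / ρ) (φ₂ / ρ ^ 2) := by
  have c1 : Tendsto (fun ρ : ℝ => φ₁ / ρ) (𝓝[<] 1) (𝓝 φ₁) := by
    have : ContinuousAt (fun ρ : ℝ => φ₁ / ρ) 1 := by fun_prop (disch := norm_num)
    simpa using this.tendsto.mono_left nhdsWithin_le_nhds
  have c2 : Tendsto (fun ρ : ℝ => φ₂ / ρ ^ 2) (𝓝[<] 1) (𝓝 φ₂) := by
    have : ContinuousAt (fun ρ : ℝ => φ₂ / ρ ^ 2) 1 := by fun_prop (disch := norm_num)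
    simpa using this.tendsto.mono_left nhdsWithin_le_nhds
  have e0 : ∀ᶠ ρ : ℝ in 𝓝[<] 1, 0 < ρ :=
    nhdsWithin_le_nhds (lt_mem_nhds (by norm_num : (0 : ℝ) < 1))
  have e1 := c2.abs.eventually_lt_const h.abs_lt_one
  have e2 := (c1.add c2).eventually_lt_const h.add_lt
  have e3 := (c2.sub c1).eventually_lt_const h.sub_lt
  obtain ⟨ρ, ⟨h0, h1, h2, h3⟩, h4⟩ :=
    ((e0.and (e1.and (e2.and e3))).and self_mem_nhdsWithin).exists
  exact ⟨ρ, h0, h4, h1, h2, h3⟩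

/-- The impulse response of an AR(2) recursion. -/
noncomputable def impulseResponse (φ₁ φ₂ : ℝ) : ℕ → ℝ
  | 0 => 1
  | 1 => φ₁
  | j + 2 => φ₁ * impulseResponse φ₁ φ₂ (j + 1) + φ₂ * impulseResponse φ₁ φ₂ j

theorem IsCausalAR2.Admissible.abs_impulseResponse_le {φ₁ φ₂ : ℝ}
    (h : IsCausalAR2.Admissible φ₁ φ₂) :
    ∃ K ρ : ℝ, 0 < ρ ∧ ρ < 1 ∧ ∀ j, |impulseResponse φ₁ φ₂ j| ≤ K * ρ ^ j := by
  obtain ⟨ρ, h0, h1, hadm⟩ := h.exists_scale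
  obtain ⟨K, hK⟩ := hadm.exists_abs_le (d := fun j => impulseResponse φ₁ φ₂ j / ρ ^ j) fun j => by
    rw [impulseResponse]
    field_simp
    ring
  refine ⟨K, ρ, h0, h1, fun j => ?_⟩
  have := hK j
  rwa [abs_div, abs_of_pos (pow_pos h0 j), div_le_iff₀ (pow_pos h0 j)] at this

theorem IsCausalAR2.Admissible.summable_impulseResponse {φ₁ φ₂ : ℝ}
    (h : IsCausalAR2.Admissible φ₁ φ₂) : Summable fun j => |impulseResponse φ₁ φ₂ j| := by
  obtain ⟨K, ρ, h0, h1, hK⟩ := h.abs_impulseResponse_le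
  exact Summable.of_nonneg_of_le (fun _ => abs_nonneg _) hK
    ((summable_geometric_of_lt_one h0.le h1).mul_left K)

theorem eq_sum_impulseResponse {φ₁ φ₂ : ℝ} {a y : ℤ → ℝ}
    (h : ∀ t, y t = φ₁ * y (t - 1) + φ₂ * y (t - 2) + a t) (t : ℤ) (N : ℕ) :
    y t = ∑ j ∈ Finset.range (N + 1), impulseResponse φ₁ φ₂ j * a (t - j) +
      (impulseResponse φ₁ φ₂ (N + 1) * y (t - N - 1) +
        φ₂ * impulseResponse φ₁ φ₂ N * y (t - N - 2)) := by
  induction N with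
  | zero =>
    have := h t
    simp only [zero_add, Finset.range_one, Finset.sum_singleton, impulseResponse]
    push_cast
    simp only [sub_zero]
    linarith
  | succ N ih =>
    have h1 := h (t - N - 1)
    rw [Finset.sum_range_succ, impulseResponse]
    push_cast
    rw [show t - ((N : ℤ) + 1) = t - N - 1 by ring, show t - (N : ℤ) - 1 - 1 = t - N - 2 by ring,
      show t - (N : ℤ) - 1 - 2 = t - N - 3 by ring] at *
    rw [ih, h1]
    ring_nf

end ImpulseResponse

/-! ### From uniform Lᵖ norms to uniform moments -/

section BoundedMoments

open scoped ENNReal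

variable {Ω ι : Type*} [MeasurableSpace Ω] {P : Measure Ω}

theorem BddMoments.of_eLpNorm [IsProbabilityMeasure P] {X : ι → Ω → ℝ}
    (hX : ∀ i, AEStronglyMeasurable (X i) P)
    (h : ∀ m : ℕ, ∃ B : ℝ≥0∞, B < ∞ ∧ ∀ i, eLpNorm (X i) ((m : ℝ≥0) + 1 : ℝ≥0) P ≤ B) :
    BddMoments P X := by
  refine ⟨hX, fun m => ?_⟩
  rcases m with _ | m
  · exact ⟨1, fun i => by simp⟩
  obtain ⟨B, hB, hle⟩ := h (2 * m + 1)
  refine ⟨(B ^ (2 * (m + 1))).toReal, fun i => ?_⟩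
  have hp : ((((2 * m + 1 : ℕ) : ℝ≥0) + 1 : ℝ≥0) : ℝ) = ((2 * (m + 1) : ℕ) : ℝ) := by
    push_cast
    ring
  have hnn : ∀ ω, 0 ≤ X i ω ^ (2 * (m + 1)) := fun ω => (even_two_mul _).pow_nonneg _
  have key : ∫⁻ ω, ENNReal.ofReal (X i ω ^ (2 * (m + 1))) ∂P ≤ B ^ (2 * (m + 1)) := by
    have h1 := eLpNorm_nnreal_pow_eq_lintegral (μ := P) (f := X i)
      (p := ((2 * m + 1 : ℕ) : ℝ≥0) + 1) (by positivity)
    rw [hp] at h1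
    simp only [ENNReal.rpow_natCast] at h1
    calc ∫⁻ ω, ENNReal.ofReal (X i ω ^ (2 * (m + 1))) ∂P
        = ∫⁻ ω, ‖X i ω‖ₑ ^ (2 * (m + 1)) ∂P := by
          refine lintegral_congr fun ω => ?_
          rw [← (even_two_mul (m + 1)).pow_abs, ENNReal.ofReal_pow (abs_nonneg _),
            Real.enorm_eq_ofReal_abs]
      _ = _ := h1.symm
      _ ≤ B ^ (2 * (m + 1)) := pow_le_pow_left' (hle i) _
  have hBt : B ^ (2 * (m + 1)) < ∞ := ENNReal.pow_lt_top hB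
  have hm : AEStronglyMeasurable (fun ω => X i ω ^ (2 * (m + 1))) P := (hX i).pow _
  refine ⟨⟨hm, (hasFiniteIntegral_iff_ofReal (Eventually.of_forall hnn)).2
    (key.trans_lt hBt)⟩, ?_⟩
  rw [integral_eq_lintegral_of_nonneg_ae (Eventually.of_forall hnn) hm]
  exact ENNReal.toReal_mono hBt.ne key

end BoundedMoments

/-! ### Independence up to null sets -/

section IndependenceModuloNull

variable {Ω : Type*} {mΩ : MeasurableSpace Ω} {P : Measure Ω}

/-- Independence sees events only up to null sets; this permits enlarging a filtration by null
modifications. -/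
theorem Indep.of_ae_eq_left {m₁ m₁' m₂ : MeasurableSpace Ω} (h : Indep m₁ m₂ P)
    (hm : ∀ s, MeasurableSet[m₁'] s → ∃ t, MeasurableSet[m₁] t ∧ s =ᵐ[P] t) : Indep m₁' m₂ P := by
  rw [Indep_iff] at h ⊢
  intro s u hs hu
  obtain ⟨t, ht, hst⟩ := hm s hs
  rw [measure_congr hst, measure_congr (hst.inter (ae_eq_refl u)), h t u ht hu]

end IndependenceModuloNull

/-! ### Moving average representation and its moments -/

section Causality

open scoped ENNReal

variable {Ω : Type*} [MeasurableSpace Ω] {P : Measure Ω} [IsProbabilityMeasure P] {φ₁ φ₂ : ℝ}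
  {a y : ℤ → Ω → ℝ}

omit [IsProbabilityMeasure P] in
/-- Along a subsequence, the moving average expansion converges almost surely. -/
theorem IsCausalAR2.Admissible.exists_tendsto_ae (hadm : IsCausalAR2.Admissible φ₁ φ₂)
    (ha : ∀ t, Measurable (a t)) (hy : ∀ t, Integrable (y t) P)
    (h : ∀ t ω, y t ω = φ₁ * y (t - 1) ω + φ₂ * y (t - 2) ω + a t ω) {C : ℝ}
    (hC : ∀ t, ∫ ω, |y t ω| ∂P ≤ C) (t : ℤ) : ∃ ns : ℕ → ℕ, ∀ᵐ ω ∂P, Tendsto (fun k =>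
      ∑ j ∈ Finset.range (ns k + 1), impulseResponse φ₁ φ₂ j * a (t - j) ω) atTop (𝓝 (y t ω)) := by
  have hψ : Tendsto (impulseResponse φ₁ φ₂) atTop (𝓝 0) :=
    (tendsto_zero_iff_abs_tendsto_zero _).2 hadm.summable_impulseResponse.tendsto_atTop_zero
  have hb : Tendsto (fun N => (|impulseResponse φ₁ φ₂ (N + 1)| + |φ₂ * impulseResponse φ₁ φ₂ N|) * C)
      atTop (𝓝 0) := by
    have h1 := (hψ.comp (tendsto_add_atTop_nat 1)).abs
    have h2 := (hψ.const_mul φ₂).abs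
    simpa using (h1.add h2).mul_const C
  have hmeas : TendstoInMeasure P (fun (N : ℕ) ω =>
      ∑ j ∈ Finset.range (N + 1), impulseResponse φ₁ φ₂ j * a (t - j) ω) atTop (y t) := by
    -- The remainder consists of two values of y in the remote past, with vanishing coefficients and
    -- uniformly bounded first moments.
    refine tendstoInMeasure_of_tendsto_eLpNorm one_ne_zero (fun N => ?_)
      (hy t).aestronglyMeasurable ?_
    · exact (Finset.measurable_fun_sum _ fun j _ => (ha _).const_mul _).aestronglyMeasurable
    refine tendsto_of_tendsto_of_tendsto_of_le_of_le tendsto_const_nhds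
      (ENNReal.ofReal_zero ▸ ENNReal.tendsto_ofReal hb) (fun _ => zero_le) fun N => ?_
    have e : ((fun ω => ∑ j ∈ Finset.range (N + 1), impulseResponse φ₁ φ₂ j * a (t - j) ω) - y t) =
        fun ω => -(impulseResponse φ₁ φ₂ (N + 1) * y (t - N - 1) ω +
          φ₂ * impulseResponse φ₁ φ₂ N * y (t - N - 2) ω) := by
      funext ω
      have := eq_sum_impulseResponse (a := fun t => a t ω) (y := fun t => y t ω)
        (fun t => h t ω) t N
      simp only [Pi.sub_apply]
      linarith
    have i1 := (hy (t - N - 1)).const_mul (impulseResponse φ₁ φ₂ (N + 1))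
    have i2 := (hy (t - N - 2)).const_mul (φ₂ * impulseResponse φ₁ φ₂ N)
    have i3 : Integrable (fun ω => -(impulseResponse φ₁ φ₂ (N + 1) * y (t - N - 1) ω +
          φ₂ * impulseResponse φ₁ φ₂ N * y (t - N - 2) ω)) P := (i1.add i2).neg
    rw [e, eLpNorm_one_eq_lintegral_enorm, ← ofReal_integral_norm_eq_lintegral_enorm i3]
    refine ENNReal.ofReal_le_ofReal ?_
    calc ∫ ω, ‖-(impulseResponse φ₁ φ₂ (N + 1) * y (t - N - 1) ω +
          φ₂ * impulseResponse φ₁ φ₂ N * y (t - N - 2) ω)‖ ∂P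
        ≤ ∫ ω, (|impulseResponse φ₁ φ₂ (N + 1)| * |y (t - N - 1) ω| +
          |φ₂ * impulseResponse φ₁ φ₂ N| * |y (t - N - 2) ω|) ∂P := by
          refine integral_mono i3.norm
            (((hy _).abs.const_mul _).add ((hy _).abs.const_mul _)) fun ω => ?_
          simp only [norm_neg, Real.norm_eq_abs, ← abs_mul]
          exact abs_add_le _ _
      _ = |impulseResponse φ₁ φ₂ (N + 1)| * ∫ ω, |y (t - N - 1) ω| ∂P +
          |φ₂ * impulseResponse φ₁ φ₂ N| * ∫ ω, |y (t - N - 2) ω| ∂P := by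
          rw [integral_add ((hy _).abs.const_mul _) ((hy _).abs.const_mul _),
            integral_const_mul, integral_const_mul]
      _ ≤ _ := by
          rw [add_mul]
          gcongr
          · exact hC _
          · exact hC _
  obtain ⟨ns, -, hns⟩ := hmeas.exists_seq_tendsto_ae
  exact ⟨ns, hns⟩

/-- By Minkowski, the partial moving averages have Lᵖ norm at most Σ|ψ_j| times that of one
innovation, with ψ the impulse response. Fatou transfers the bound to the almost sure limit. -/
theorem IsCausalAR2.Admissible.bddMoments (hadm : IsCausalAR2.Admissible φ₁ φ₂)
    (ha : ∀ t, Measurable (a t)) (hy : ∀ t, Integrable (y t) P)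
    (h : ∀ t ω, y t ω = φ₁ * y (t - 1) ω + φ₂ * y (t - 2) ω + a t ω) {C : ℝ}
    (hC : ∀ t, ∫ ω, |y t ω| ∂P ≤ C) {v : ℝ≥0}
    (hlaw : ∀ t, HasLaw (a t) (gaussianReal 0 v) P) : BddMoments P y := by
  refine BddMoments.of_eLpNorm (fun t => (hy t).aestronglyMeasurable) fun m => ?_
  set p : ℝ≥0 := (m : ℝ≥0) + 1 with hp
  have hp1 : (1 : ℝ≥0∞) ≤ p := by
    rw [hp]
    push_cast
    exact le_add_self
  set G := eLpNorm id p (gaussianReal 0 v) with hG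
  have hGt : G < ∞ := (memLp_id_gaussianReal p).2
  have hGa : ∀ s, eLpNorm (a s) p P = G := fun s => by
    rw [hG, ← (hlaw s).map_eq, eLpNorm_map_measure aestronglyMeasurable_id (ha s).aemeasurable]
    rfl
  refine ⟨ENNReal.ofReal (∑' j, |impulseResponse φ₁ φ₂ j|) * G,
    ENNReal.mul_lt_top ENNReal.ofReal_lt_top hGt, fun t => ?_⟩
  obtain ⟨ns, hns⟩ := hadm.exists_tendsto_ae ha hy h hC t
  have hm : ∀ k, AEStronglyMeasurable (fun ω => ∑ j ∈ Finset.range (ns k + 1),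
      impulseResponse φ₁ φ₂ j * a (t - j) ω) P := fun k =>
    (Finset.measurable_fun_sum _ fun j _ => (ha _).const_mul _).aestronglyMeasurable
  refine Lp.eLpNorm_le_of_ae_tendsto (Eventually.of_forall fun k => ?_) hm hns
  have e : (fun ω => ∑ j ∈ Finset.range (ns k + 1), impulseResponse φ₁ φ₂ j * a (t - j) ω) =
      ∑ j ∈ Finset.range (ns k + 1), impulseResponse φ₁ φ₂ j • a (t - j) := by
    funext ω
    simp [Finset.sum_apply]
  rw [e]
  refine (eLpNorm_sum_le (fun j _ => ((ha _).const_smul _).aestronglyMeasurable) hp1).trans ?_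
  simp only [eLpNorm_const_smul, hGa, ← Finset.sum_mul]
  gcongr
  simp only [Real.enorm_eq_ofReal_abs]
  rw [← ENNReal.ofReal_sum_of_nonneg fun _ _ => abs_nonneg _]
  exact ENNReal.ofReal_le_ofReal
    (hadm.summable_impulseResponse.sum_le_tsum _ fun _ _ => abs_nonneg _)

end Causality

/-! ### From stationary to causal processes -/

section Reduction

variable {Ω : Type*} {mΩ : MeasurableSpace Ω} {P : Measure Ω} [IsProbabilityMeasure P]
  {μ φ₁ φ₂ : ℝ} {σ : ℝ≥0} {a z : ℤ → Ω → ℝ}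

omit [IsProbabilityMeasure P] in
theorem IsStationaryAR2.integral_innovation (hz : IsStationaryAR2 P μ φ₁ φ₂ σ a z) (t : ℤ) :
    Integrable (a t) P ∧ ∫ ω, a t ω ∂P = 0 := by
  have h := hz.innovation_law t
  constructor
  · have : Integrable id (P.map (a t)) := by
      rw [h.map_eq]
      exact (memLp_id_gaussianReal (μ := 0) (v := σ ^ 2) 1).integrable (by simp)
    exact this.comp_aemeasurable h.aemeasurable
  · have e := integral_map h.aemeasurable (f := id) aestronglyMeasurable_id
    rw [h.map_eq] at e
    simpa using e.symm

/-- Taking expectations in the recursion gives (1 - φ₁ - φ₂)(E z - μ) = 0. -/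
theorem IsStationaryAR2.integral_eq (hz : IsStationaryAR2 P μ φ₁ φ₂ σ a z) (hsum : φ₁ + φ₂ < 1)
    (t : ℤ) : ∫ ω, z t ω ∂P = μ := by
  have hi : ∀ t, Integrable (z t) P := fun t => (hz.memLp t).integrable (by norm_num)
  have h1 : ∀ s, ∫ ω, (z s ω - μ) ∂P = ∫ ω, z t ω ∂P - μ := fun s => by
    rw [integral_sub (hi s) (integrable_const _), hz.mean_stationary s t]
    simp
  have h2 := integral_congr_ae (hz.recursion t)
  have h0 : ∀ (c : ℝ) (s : ℤ), Integrable (fun ω => c * (z s ω - μ)) P := fun c s =>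
    ((hi s).sub (integrable_const μ)).const_mul c
  have h5 : Integrable (fun ω => φ₁ * (z (t - 1) ω - μ) + φ₂ * (z (t - 2) ω - μ)) P :=
    (h0 _ _).add (h0 _ _)
  rw [integral_add h5 (hz.integral_innovation t).1,
    integral_add (h0 _ _) (h0 _ _), integral_const_mul, integral_const_mul,
    h1, h1, h1, (hz.integral_innovation t).2] at h2
  have h3 : (∫ ω, z t ω ∂P - μ) * (1 - φ₁ - φ₂) = 0 := by linear_combination h2
  rcases mul_eq_zero.1 h3 with h4 | h4
  · linarith
  · linarith

/-- A stationary AR(2) process is, up to null sets and centring, a causal one. -/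
theorem IsStationaryAR2.exists_isCausalAR2 (hz : IsStationaryAR2 P μ φ₁ φ₂ σ a z)
    (hadm : IsCausalAR2.Admissible φ₁ φ₂) :
    ∃ (F : ℤ → MeasurableSpace Ω) (γ : ℤ → ℝ) (b y : ℤ → Ω → ℝ),
      IsCausalAR2 P φ₁ φ₂ (σ ^ 2) F γ b y ∧ ∀ t, z t =ᵐ[P] fun ω => y t ω + μ := by
  set y : ℤ → Ω → ℝ := fun t ω => (hz.memLp t).1.mk (z t) ω - μ with hy
  -- The innovations are redefined as residuals of the measurable version, so that the recursion
  -- holds at every ω.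
  set b : ℤ → Ω → ℝ := fun t ω => y t ω - φ₁ * y (t - 1) ω - φ₂ * y (t - 2) ω with hb
  have hym : ∀ t, Measurable (y t) := fun t =>
    (hz.memLp t).1.stronglyMeasurable_mk.measurable.sub_const μ
  have hbm : ∀ t, Measurable (b t) := fun t =>
    ((hym t).sub ((hym _).const_mul _)).sub ((hym _).const_mul _)
  have hyz : ∀ t, (fun ω => z t ω - μ) =ᵐ[P] y t := fun t => by
    filter_upwards [(hz.memLp t).1.ae_eq_mk] with ω hω
    simp only [hy]
    rw [hω]
  have hrec : ∀ t ω, y t ω = φ₁ * y (t - 1) ω + φ₂ * y (t - 2) ω + b t ω := fun t ω => by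
    simp only [hb]
    ring
  have hba : ∀ t, b t =ᵐ[P] a t := fun t => by
    filter_upwards [hz.recursion t, hyz t, hyz (t - 1), hyz (t - 2)] with ω h0 h1 h2 h3
    simp only [hb]
    rw [← h1, ← h2, ← h3, h0]
    ring
  have hlaw : ∀ t, HasLaw (b t) (gaussianReal 0 (σ ^ 2)) P := fun t =>
    (hz.innovation_law t).congr (hba t)
  have hind : iIndepFun b P := hz.innovation_indep.congr fun t => (hba t).symm
  have hL2 : ∀ t, MemLp (y t) 2 P := fun t =>
    (memLp_congr_ae (hyz t)).1 ((hz.memLp t).sub (memLp_const μ))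
  have hi : ∀ t, Integrable (y t) P := fun t => (hL2 t).integrable (by norm_num)
  have hmean : ∀ t, ∫ ω, y t ω ∂P = 0 := fun t => by
    rw [← integral_congr_ae (hyz t), integral_sub ((hz.memLp t).integrable (by norm_num))
      (integrable_const _), hz.integral_eq hadm.add_lt]
    simp
  have hcov : ∀ s t, ∫ ω, y s ω * y t ω ∂P = cov[z s, z t; P] := fun s t => by
    rw [covariance, hz.integral_eq hadm.add_lt, hz.integral_eq hadm.add_lt]
    exact integral_congr_ae (((hyz s).mul (hyz t)).symm)
  have hstat : ∀ s t, ∫ ω, y s ω * y t ω ∂P = cov[z (s - t), z 0; P] := fun s t => by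
    rw [hcov, ← hz.cov_stationary (s - t) 0 t, sub_add_cancel, zero_add]
  have hC : ∀ t, ∫ ω, |y t ω| ∂P ≤ 1 + cov[z 0, z 0; P] := fun t => by
    have h1 := hstat t t
    rw [sub_self] at h1
    rw [← h1]
    have hsq : Integrable (fun ω => y t ω * y t ω) P := (hL2 t).integrable_mul (hL2 t)
    have h2 : ∫ ω, |y t ω| ∂P ≤ ∫ ω, (1 + y t ω * y t ω) ∂P :=
      integral_mono (hi t).abs ((integrable_const _).add hsq) fun ω => by
        simpa [sq] using BddMoments.abs_le_one_add_sq (y t ω)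
    rw [integral_add (integrable_const _) hsq] at h2
    simpa using h2
  have hbdd : BddMoments P y := hadm.bddMoments hbm hi hrec hC hlaw
  let A : ℤ → MeasurableSpace Ω := fun t =>
    ⨆ s ∈ Set.Iic t, MeasurableSpace.comap (b s) inferInstance
  have hAb : ∀ s t, s ≤ t → Measurable[A t] (b s) := fun s t hst =>
    Measurable.mono (comap_measurable (b s))
      (le_iSup₂_of_le (f := fun (s : ℤ) (_ : s ∈ Set.Iic t) =>
        MeasurableSpace.comap (b s) inferInstance) s hst le_rfl) le_rfl
  have hA : ∀ t, A t ≤ mΩ := fun t => iSup₂_le fun s _ => (hbm s).comap_le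
  have hAmono : Monotone A := fun s t hst =>
    iSup₂_le fun u hu => le_iSup₂_of_le (f := fun (s : ℤ) (_ : s ∈ Set.Iic t) =>
        MeasurableSpace.comap (b s) inferInstance) u (le_trans hu hst) le_rfl
  -- `y t` is only an almost sure limit of `A t`-measurable sums, hence the null modifications.
  -- Intersecting with `mΩ` keeps `F t` below the ambient σ-algebra.
  let F : ℤ → MeasurableSpace Ω := fun t => eventuallyMeasurableSpace (A t) (ae P) ⊓ mΩ
  refine ⟨F, fun k => cov[z k, z 0; P], b, y, ?_, fun t => ?_⟩
  · refine ⟨fun s t hst => ?_, fun t => inf_le_right, fun t => ?_, hrec, fun t => ?_, hlaw, hbdd,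
      hmean, hstat⟩
    · refine inf_le_inf ?_ le_rfl
      rintro u ⟨w, hw, huw⟩
      exact ⟨w, hAmono hst w hw, huw⟩
    · obtain ⟨ns, hns⟩ := hadm.exists_tendsto_ae hbm hi hrec hC t
      have hS : ∀ k, Measurable[A t] fun ω => ∑ j ∈ Finset.range (ns k + 1),
          impulseResponse φ₁ φ₂ j * b (t - j) ω := fun k =>
        Finset.measurable_fun_sum _ fun j _ => (hAb _ _ (by omega)).const_mul _
      have hlim := Measurable.limsup hS
      have hev : EventuallyMeasurable (A t) (ae P) (y t) :=
        hlim.eventuallyMeasurable_of_eventuallyEq (by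
          filter_upwards [hns] with ω hω
          exact hω.limsup_eq.symm)
      exact fun s hs => ⟨hev hs, hym t hs⟩
    · refine Indep.of_ae_eq_left (indep_iSup_of_disjoint (fun s => (hbm s).comap_le)
        ((iIndepFun_iff_iIndep _ _ _).1 hind) (S := Set.Iic t) ?_) fun s hs => hs.1
      exact Set.disjoint_left.2 fun u hu hu' =>
        not_lt.2 (Set.mem_Iic.1 hu) (Set.mem_Ioi.1 hu')
  · filter_upwards [hyz t] with ω hω
    rw [← hω]
    ring

end Reduction

/-! ### Shift invariance, measurability and the final assembly -/

section Estimators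

theorem sampleMean_add_const (x : ℤ → ℝ) (c : ℝ) {n : ℕ} (hn : n ≠ 0) :
    sampleMean (fun t => x t + c) n = sampleMean x n + c := by
  have : (n : ℝ) ≠ 0 := by exact_mod_cast hn
  simp only [sampleMean, Finset.sum_add_distrib, Finset.sum_const, Nat.card_Icc, nsmul_eq_mul]
  field_simp
  simp [mul_comm]

theorem autocov_add_const (x : ℤ → ℝ) (c : ℝ) (n m k i : ℕ) :
    autocov (fun t => x t + c) n m k i = autocov x n m k i := by
  rcases eq_or_ne n 0 with rfl | hn
  · simp [autocov]
  · simp only [autocov, sampleMean_add_const x c hn, add_sub_add_right_eq_sub]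

theorem burgPhi2_add_const (x : ℤ → ℝ) (c : ℝ) (n : ℕ) :
    burgPhi2 (fun t => x t + c) n = burgPhi2 x n := by
  simp only [burgPhi2, autocov_add_const]

theorem burgPhi1_add_const (x : ℤ → ℝ) (c : ℝ) (n : ℕ) :
    burgPhi1 (fun t => x t + c) n = burgPhi1 x n := by
  simp only [burgPhi1, burgPhi2_add_const, autocov_add_const]

theorem lsPhi1_add_const (x : ℤ → ℝ) (c : ℝ) (n : ℕ) :
    lsPhi1 (fun t => x t + c) n = lsPhi1 x n := by
  simp only [lsPhi1, lsDet, autocov_add_const]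

theorem lsPhi2_add_const (x : ℤ → ℝ) (c : ℝ) (n : ℕ) :
    lsPhi2 (fun t => x t + c) n = lsPhi2 x n := by
  simp only [lsPhi2, lsDet, autocov_add_const]

variable {Ω : Type*} [MeasurableSpace Ω] {P : Measure Ω}

/-- Almost surely z is y plus one constant at all times simultaneously, because time is countable. A
shift-invariant statistic therefore agrees on both processes. -/
theorem HasBiasToOrderInv.of_tendsto {y z : ℤ → Ω → ℝ} {T : (ℤ → ℝ) → ℕ → ℝ} {θ b c : ℝ}
    (hz : ∀ t, z t =ᵐ[P] fun ω => y t ω + c) (hT : ∀ x n, T (fun t => x t + c) n = T x n)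
    (h : (∀ᶠ n : ℕ in atTop, Integrable (fun ω => T (fun t => y t ω) n) P) ∧
      Tendsto (fun n : ℕ => (n : ℝ) * ∫ ω, (T (fun t => y t ω) n - θ) ∂P) atTop (𝓝 b)) :
    HasBiasToOrderInv P z T θ b := by
  have he : ∀ n, (fun ω => T (fun t => z t ω) n) =ᵐ[P] fun ω => T (fun t => y t ω) n := fun n => by
    filter_upwards [ae_all_iff.2 hz] with ω hω
    rw [← hT (fun t => y t ω)]
    exact congrArg (fun x => T x n) (funext hω)
  refine ⟨h.1.mono fun n hn => hn.congr (he n).symm, ?_⟩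
  have hn0 : ∀ᶠ n : ℕ in atTop, (n : ℝ) ≠ 0 :=
    (eventually_ne_atTop 0).mono fun n hn => Nat.cast_ne_zero.2 hn
  rw [isLittleO_iff_tendsto' (hn0.mono fun n hn h0 => absurd h0 (one_div_ne_zero hn))]
  have h2 := h.2.sub_const b
  rw [sub_self] at h2
  refine h2.congr' ?_
  filter_upwards [hn0] with n hn
  have e : ∫ ω, (T (fun t => z t ω) n - θ) ∂P = ∫ ω, (T (fun t => y t ω) n - θ) ∂P :=
    integral_congr_ae ((he n).sub (ae_eq_refl fun _ => θ))
  rw [e]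
  field_simp

theorem sq_moment_of_abs_le [IsProbabilityMeasure P] {T : ℕ → Ω → ℝ} {c : ℝ}
    (hT : ∀ n, AEStronglyMeasurable (T n) P) (h : ∀ n ω, |T n ω| ≤ c) (n : ℕ) :
    Integrable (fun ω => T n ω ^ 2) P ∧ ∫ ω, T n ω ^ 2 ∂P ≤ c ^ 2 * (n : ℝ) ^ 0 := by
  have hle : ∀ ω, T n ω ^ 2 ≤ c ^ 2 := fun ω => sq_le_sq' (abs_le.1 (h n ω)).1 (abs_le.1 (h n ω)).2
  have hi : Integrable (fun ω => T n ω ^ 2) P :=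
    (integrable_const (c ^ 2)).mono' ((hT n).pow 2) (Eventually.of_forall fun ω => by
      rw [Real.norm_of_nonneg (sq_nonneg _)]
      exact hle ω)
  exact ⟨hi, (integral_mono hi (integrable_const _) hle).trans (by simp)⟩

namespace IsCausalAR2

variable [IsProbabilityMeasure P] {φ₁ φ₂ : ℝ} {v : ℝ≥0} {F : ℤ → MeasurableSpace Ω} {γ : ℤ → ℝ}
  {a y : ℤ → Ω → ℝ}

theorem aemeasurable_autocov (h : IsCausalAR2 P φ₁ φ₂ v F γ a y) (n m k i : ℕ) :
    AEMeasurable (fun ω => autocov (fun t => y t ω) n m k i) P :=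
  ((h.autocov_bdd m k i n).aesm ()).aemeasurable

theorem aestronglyMeasurable_burgPhi2 (h : IsCausalAR2 P φ₁ φ₂ v F γ a y) (n : ℕ) :
    AEStronglyMeasurable (fun ω => burgPhi2 (fun t => y t ω) n) P := by
  have hA := h.aemeasurable_autocov n
  have hC := (hA 0 0 3).add (hA 2 2 3)
  have hD := (hA 0 0 2).add (hA 1 1 2)
  have hF := hA 0 1 2
  have hH := (hA 0 1 3).add (hA 2 1 3)
  exact (((hC.mul (hD.pow_const 2)).sub (((hA 0 2 3).const_mul 2).mul (hD.pow_const 2))).div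
    (((hC.mul (hD.pow_const 2)).add (((hF.pow_const 2).const_mul 8).mul (hA 1 1 3))).sub
      (((hF.const_mul 4).mul hH).mul hD))).const_sub 1 |>.aestronglyMeasurable

theorem aestronglyMeasurable_burgPhi1 (h : IsCausalAR2 P φ₁ φ₂ v F γ a y) (n : ℕ) :
    AEStronglyMeasurable (fun ω => burgPhi1 (fun t => y t ω) n) P := by
  have hA := h.aemeasurable_autocov n
  have hB := (h.aestronglyMeasurable_burgPhi2 n).aemeasurable
  exact ((((hA 0 1 2).const_mul 2).div ((hA 0 0 2).add (hA 1 1 2))).mul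
    (hB.const_sub 1)).aestronglyMeasurable

theorem aestronglyMeasurable_lsPhi1 (h : IsCausalAR2 P φ₁ φ₂ v F γ a y) (n : ℕ) :
    AEStronglyMeasurable (fun ω => lsPhi1 (fun t => y t ω) n) P := by
  have hA := h.aemeasurable_autocov n
  unfold lsPhi1 lsDet
  refine AEMeasurable.aestronglyMeasurable ?_
  fun_prop

theorem aestronglyMeasurable_lsPhi2 (h : IsCausalAR2 P φ₁ φ₂ v F γ a y) (n : ℕ) :
    AEStronglyMeasurable (fun ω => lsPhi2 (fun t => y t ω) n) P := by
  have hA := h.aemeasurable_autocov n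
  unfold lsPhi2 lsDet
  refine AEMeasurable.aestronglyMeasurable ?_
  fun_prop

theorem autocov_bddMoments (h : IsCausalAR2 P φ₁ φ₂ v F γ a y) (hv : 0 < v)
    (hadm : Admissible φ₁ φ₂) :
    (∀ m, BddMoments P fun n ω => autocov (fun t => y t ω) n m m 3) ∧
    (∀ m, BddMoments P fun n ω => autocov (fun t => y t ω) n m (m + 1) 3) ∧
    (∀ m, BddMoments P fun n ω => autocov (fun t => y t ω) n m (m + 2) 3) := by
  obtain ⟨r, hr, h1, h2, h3, h4⟩ := hadm.exists_param
  obtain ⟨Δ, g, e, τ, hg, he, hΔ, j0, j1, j2⟩ := h.autocov_jets hv hr h1 h2 h3 h4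
  exact ⟨fun m => ((j0 m 3).bdd hΔ).bdd, fun m => ((j1 m 3).bdd hΔ).bdd,
    fun m => ((j2 m 3).bdd hΔ).bdd⟩

end IsCausalAR2

end Estimators

theorem mainTheorem2 {Ω : Type*} [MeasurableSpace Ω] (P : Measure Ω) [IsProbabilityMeasure P]
    (μ φ₁ φ₂ : ℝ) (σ : ℝ≥0) (hσ : 0 < σ)
    (hadm : |φ₂| < 1) (hsum : φ₁ + φ₂ < 1) (hdiff : φ₂ - φ₁ < 1)
    (a z : ℤ → Ω → ℝ) (hz : IsStationaryAR2 P μ φ₁ φ₂ σ a z) :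
    (HasBiasToOrderInv P z burgPhi1 φ₁ (-(1 + φ₁ + φ₂)) ∧
      HasBiasToOrderInv P z burgPhi2 φ₂ (-(2 + 4 * φ₂))) ∧
    (HasBiasToOrderInv P z lsPhi1 φ₁ (-(1 + φ₁ + φ₂)) ∧
      HasBiasToOrderInv P z lsPhi2 φ₂ (-(2 + 4 * φ₂))) := by
  have hadm : IsCausalAR2.Admissible φ₁ φ₂ := ⟨hadm, hsum, hdiff⟩
  obtain ⟨F, γ, b, y, h, hzy⟩ := hz.exists_isCausalAR2 hadm
  have hv : 0 < σ ^ 2 := pow_pos hσ 2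
  obtain ⟨b0, b1, b2⟩ := h.autocov_bddMoments hv hadm
  refine ⟨⟨?_, ?_⟩, ?_, ?_⟩
  · have hm := h.aestronglyMeasurable_burgPhi1
    exact .of_tendsto hzy (fun x n => burgPhi1_add_const x μ n) (h.burg_tendsto₁ hv hadm hm
      (Eventually.of_forall (sq_moment_of_abs_le hm fun n ω => abs_burgPhi1_le _ n))
      fun n ω => burgPhi1_mul _ n)
  · have hm := h.aestronglyMeasurable_burgPhi2
    exact .of_tendsto hzy (fun x n => burgPhi2_add_const x μ n) (h.burg_tendsto₂ hv hadm hm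
      (Eventually.of_forall (sq_moment_of_abs_le hm fun n ω => abs_burgPhi2_le _ n))
      fun n ω => burgPhi2_mul _ n)
  · obtain ⟨K, hK⟩ := h.sq_moment_of_mul_lsDet hv (T := fun n ω => lsPhi1 (fun t => y t ω) n)
      (((b1 0).mul (b0 2)).sub ((b2 0).mul (b1 1))) fun n ω => rfl
    exact .of_tendsto hzy (fun x n => lsPhi1_add_const x μ n) (h.ls_tendsto₁ hv hadm
      h.aestronglyMeasurable_lsPhi1 hK fun n ω => lsPhi1_mul _ n)
  · obtain ⟨K, hK⟩ := h.sq_moment_of_mul_lsDet hv (T := fun n ω => lsPhi2 (fun t => y t ω) n)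
      (((b2 0).mul (b0 1)).sub ((b1 0).mul (b1 1))) fun n ω => rfl
    exact .of_tendsto hzy (fun x n => lsPhi2_add_const x μ n) (h.ls_tendsto₂ hv hadm
      h.aestronglyMeasurable_lsPhi2 hK fun n ω => lsPhi2_mul _ n)
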